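/- **Setting.** A supplier with unit cost $c$ sells to a retailer with unit selling price $s$, $0\le c<s$. In each period $t=1,\dots,T$ the supplier posts a wholesale price $w_t\in[0,s]$, the retailer orders $q_t(w_t)$ and the supplier earns $(w_t-c)\,q_t(w_t)$; then the demand $\xi_t$ is realized and is seen by the retailer only. Demands are i.i.d. with law $F_0=F_{\theta_0}$ in a parametric family $(F_\theta)_{\theta\in\Theta}$. The *MLE retailer* computes in period $t$ a maximizer $\theta_t\in\Theta$ of the likelihood of $\xi_1,\dots,\xi_{t-1}$ ($\theta_1\in\Theta$ is arbitrary), and his orders are at most $\bar q>0$: with $\hat F_t(x)=F_{\theta_t}(x)$ for $x<\bar q$ and $\hat F_t(x)=1$ for $x\ge\bar q$, he orders $q_t(w)=\min\{q\in\Xi:\hat F_t(q)\ge 1-w/s\}$, where $\Xi=[0,\bar q]$ or, for demand with finite support, $\Xi$ is the support. The regret $\mathrm{Reg}(\pi,T)$ of a pricing policy $\pi$ given the demands is the expectation over the random choices of $\pi$ of $$\sum_{t=1}^T\Big(\sup_{w\in[0,s]}(w-c)q_t(w)-(w_t-c)q_t(w_t)\Big).$$ **Policy $\pi_{\rm LUNA}$**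 on levels $0\le y_1<\dots<y_M$ with $K=\lceil \bar q^{-1/3}T^{1/3}\rceil$. It runs in epochs. *Exploration:* in the $k$-th period of the epoch, $k\le K$, post $\bar w_k=c+(k-1)(s-c)/K$ and record the order $o_k$. Then let $k^*$ maximize $\varphi_k=(\bar w_k-c)o_k$ (ties broken by any fixed rule), $y^*=o_{k^*}$. *Exploitation:* in the $j$-th period of the epoch, $j>K$, let $\Delta=\sqrt{M/j}$. With probability $1-\min\{1,\Delta\}$ post $w_0=\max\{\bar w_{k^*}-\Delta/y^*,0\}$ ($w_0=\bar w_{k^*}$ if $y^*=0$), and start a new epoch if the order is less than $y^*$. Otherwise choose $m\in\{1,\dots,M\}$ uniformly; if $y_m>0$ and $w_m=(\varphi_{k^*}+\Delta+y_m s/K)/y_m+c\le s$, post $w_m$ and start a new epoch if the order is at least $y_m$; if $y_m=0$ or $w_m>s$, post $s$ and continue the epoch. **Policy $\pi_{\rm LUNAC}$:** run $\pi_{\rm LUNA}$ (same $K$) on the levels $z_n=(n-1)\bar q/(N-1)$, $n=1,\dots,N$, $N=\lceil\bar q^{-1/4}T^{1/4}\rceil$, where each observed order is rounded up to the next level before it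 is passed to $\pi_{\rm LUNA}$. **Theorem.** In (i), (iii), (iv), for every $q_0>0$ there are constants $C,k$, depending only on $s,c,q_0$ and $F_0$, such that for all $\bar q\ge q_0$ and $T\ge1$, with probability at least $1-1/T$ over the demands, $$\mathrm{Reg}(\pi_{\rm LUNAC},T)\le C(1+\ln T)^k\big(\bar q^{5/4}T^{3/4}+\bar q^{17/12}T^{7/12}\big):$$ (i) $F_0$ is the Poisson distribution with mean $\lambda>0$, and the retailer fits the Poisson family with means in $[0,\infty)$; (iii) $F_0$ is the exponential distribution with rate $\lambda>0$, and the retailer fits the exponential family with rates in $(0,\infty)$; (iv) $F_0$ is the normal distribution $N(\mu,\sigma^2)$, $\sigma>0$, and the retailer fits the normal family with the known variance $\sigma^2$ and means in $\mathbb R$. (ii) For every $\eta>0$ there are constants $C,k$, depending only on $s,c,\eta$, such that for all $M$, all points $0\le y_1<\dots<y_M=\bar q$ with $\bar q>0$ and whose positive members are at least $\eta$, every categorical distribution $F_0$ on these points, and all $T\ge1$, if the retailer fits the family of all distributions on $\{y_1,\dots,y_M\}$, then almost surely, and hence also in expectation over the demands, $$\mathrm{Reg}(\pi_{\rm LUNA},T)\le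 C(1+\ln T)^k\,\bar q^{4/3}M^{1/3}T^{2/3}.$$ -/

import Mathlib

open MeasureTheory ProbabilityTheory
open scoped NNReal ENNReal

noncomputable section

namespace Wholesale

/-! ### The retailer's best response and the supplier's regret -/

/-- Best response of a retailer who perceives the distribution function `F` on the set `Ξ` of
possible order quantities, facing the wholesale price `w` and the selling price `s`:
the smallest `q ∈ Ξ` with `F q ≥ 1 - w / s`. -/
def order (Ξ : Set ℝ) (F : ℝ → ℝ) (s w : ℝ) : ℝ :=
  sInf {q | q ∈ Ξ ∧ 1 - w / s ≤ F q}

/-- The supplier's profit `(w - c) q`. -/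
def profit (c w q : ℝ) : ℝ := (w - c) * q

/-- Loss of the supplier in a period in which the retailer answers every price `v` by the order
`r v` and the supplier posts `w`, against the best price in `[0, s]` for this period. -/
def periodRegret (c s : ℝ) (r : ℝ → ℝ) (w : ℝ) : ℝ :=
  sSup ((fun v => profit c v (r v)) '' Set.Icc 0 s) - profit c w (r w)

/-- A randomized pricing policy with memory states `S` and internal random choices in the finite
type `A`. In state `σ` the choice `a` is drawn with probability `draw σ a`, the price `price σ a`
is posted, and after the order `q` has been observed the memory becomes `next σ a q`. -/
structure PricingPolicy (S A : Type) [Fintype A] where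
  init : S
  draw : S → A → ℝ
  draw_nonneg : ∀ σ a, 0 ≤ draw σ a
  draw_sum : ∀ σ, ∑ a, draw σ a = 1
  price : S → A → ℝ
  next : S → A → ℝ → S

/-- Expected regret over the `n` periods `t, …, t + n - 1`, starting in memory state `σ`, against
a retailer whose order in period `t` at price `w` is `r t w`; the expectation is over the
internal random choices of the policy. -/
def PricingPolicy.regretFrom {S A : Type} [Fintype A] (π : PricingPolicy S A) (c s : ℝ)
    (r : ℕ → ℝ → ℝ) : ℕ → ℕ → S → ℝ
  | 0, _, _ => 0
  | n + 1, t, σ => ∑ a, π.draw σ a *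
      (periodRegret c s (r t) (π.price σ a) +
        π.regretFrom c s r n (t + 1) (π.next σ a (r t (π.price σ a))))

/-- Expected dynamic regret over the horizon `T`. Periods are numbered `0, …, T - 1`. -/
def PricingPolicy.regret {S A : Type} [Fintype A] (π : PricingPolicy S A) (c s : ℝ)
    (r : ℕ → ℝ → ℝ) (T : ℕ) : ℝ :=
  π.regretFrom c s r T 0 π.init

/-! ### The policy LUNA -/

/-- Memory of LUNA: the number of completed periods of the current epoch, and the orders observed
during the exploration phase of the current epoch. -/
structure LunaState (K : ℕ) where
  elapsed : ℕ
  obs : Fin K → ℝ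

/-- A rule that selects a maximizer of every finite list of observed profits. -/
def IsArgmaxRule {K : ℕ} (sel : (Fin K → ℝ) → Fin K) : Prop :=
  ∀ (g : Fin K → ℝ) (k : Fin K), g k ≤ g (sel g)

/-- The exploratory price number `k`; numbering starts at `0`. -/
def explorePrice (c s : ℝ) {K : ℕ} (k : Fin K) : ℝ := (k : ℝ) * ((s - c) / K) + c

/-- Profits observed in the exploration phase. -/
def exploreProfit (c s : ℝ) {K : ℕ} (obs : Fin K → ℝ) (k : Fin K) : ℝ :=
  profit c (explorePrice c s k) (obs k)

/-- The index of the best exploratory price. -/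
def bestIndex (c s : ℝ) {K : ℕ} (sel : (Fin K → ℝ) → Fin K) (obs : Fin K → ℝ) : Fin K :=
  sel (exploreProfit c s obs)

/-- The best profit observed in the exploration phase. -/
def bestProfit (c s : ℝ) {K : ℕ} (sel : (Fin K → ℝ) → Fin K) (obs : Fin K → ℝ) : ℝ :=
  exploreProfit c s obs (bestIndex c s sel obs)

/-- The order observed at the best exploratory price. -/
def bestOrder (c s : ℝ) {K : ℕ} (sel : (Fin K → ℝ) → Fin K) (obs : Fin K → ℝ) : ℝ :=
  obs (bestIndex c s sel obs)

/-- The margin `√(M / j)` in the `j`-th period of an epoch. -/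
def margin (M j : ℕ) : ℝ := Real.sqrt ((M : ℝ) / j)

/-- The probability, in the `j`-th period of an epoch, of testing one of the `M` demand levels
(the number `√(M / j)`, capped at `1` since it has to be a probability). -/
def testProb (M j : ℕ) : ℝ := min 1 (margin M j)

/-- The surrogate price. If the order observed at the best exploratory price is `0`, then this is
the best exploratory price itself (as `x / 0 = 0`). -/
def surrogatePrice (c s : ℝ) {K : ℕ} (sel : (Fin K → ℝ) → Fin K) (M j : ℕ) (obs : Fin K → ℝ) :
    ℝ :=
  max (explorePrice c s (bestIndex c s sel obs) - margin M j / bestOrder c s sel obs) 0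

/-- The price at which the order `y` would give the profit
`best observed profit + margin + y s / K`. -/
def testPrice (c s : ℝ) {K : ℕ} (sel : (Fin K → ℝ) → Fin K) (M j : ℕ) (obs : Fin K → ℝ) (y : ℝ) :
    ℝ :=
  (bestProfit c s sel obs + margin M j + y * s / K) / y + c

/-- The level `y` can be tested: its test price exists and is an admissible price. -/
def Testable (c s : ℝ) {K : ℕ} (sel : (Fin K → ℝ) → Fin K) (M j : ℕ) (obs : Fin K → ℝ) (y : ℝ) :
    Prop :=
  0 < y ∧ testPrice c s sel M j obs y ≤ s

/-- Distribution of the internal choice of LUNA. The choice `none` stands for the surrogate price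
(for the next exploratory price in the exploration phase), `some m` for a test of level `m`. -/
def lunaDraw (M K : ℕ) (σ : LunaState K) : Option (Fin M) → ℝ
  | none => if σ.elapsed < K then 1 else 1 - testProb M (σ.elapsed + 1)
  | some _ => if σ.elapsed < K then 0 else testProb M (σ.elapsed + 1) / M

open scoped Classical in
/-- Price posted by LUNA. A level that cannot be tested, because its test price is larger than
`s` or infinite, leads to the largest admissible price `s`. -/
def lunaPrice (c s : ℝ) {M K : ℕ} (y : Fin M → ℝ) (sel : (Fin K → ℝ) → Fin K) (σ : LunaState K) :
    Option (Fin M) → ℝ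
  | none =>
      if h : σ.elapsed < K then explorePrice c s (⟨σ.elapsed, h⟩ : Fin K)
      else surrogatePrice c s sel M (σ.elapsed + 1) σ.obs
  | some m =>
      if Testable c s sel M (σ.elapsed + 1) σ.obs (y m) then
        testPrice c s sel M (σ.elapsed + 1) σ.obs (y m)
      else s

/-- The criterion that ends an epoch during the exploitation phase, after the order `q`. -/
def LunaRestart (c s : ℝ) {M K : ℕ} (y : Fin M → ℝ) (sel : (Fin K → ℝ) → Fin K)
    (σ : LunaState K) (q : ℝ) : Option (Fin M) → Prop
  | none => q < bestOrder c s sel σ.obs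
  | some m => Testable c s sel M (σ.elapsed + 1) σ.obs (y m) ∧ y m ≤ q

open scoped Classical in
/-- Memory update of LUNA after the order `q`. -/
def lunaNext (c s : ℝ) {M K : ℕ} (y : Fin M → ℝ) (sel : (Fin K → ℝ) → Fin K) (σ : LunaState K)
    (a : Option (Fin M)) (q : ℝ) : LunaState K :=
  if h : σ.elapsed < K then
    { elapsed := σ.elapsed + 1, obs := Function.update σ.obs ⟨σ.elapsed, h⟩ q }
  else if LunaRestart c s y sel σ q a then
    { elapsed := 0, obs := fun _ => 0 }
  else
    { elapsed := σ.elapsed + 1, obs := σ.obs }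

theorem testProb_nonneg (M j : ℕ) : 0 ≤ testProb M j :=
  le_min zero_le_one (Real.sqrt_nonneg _)

theorem testProb_le_one (M j : ℕ) : testProb M j ≤ 1 := min_le_left _ _

theorem lunaDraw_nonneg (M K : ℕ) (σ : LunaState K) (a : Option (Fin M)) :
    0 ≤ lunaDraw M K σ a := by
  cases a with
  | none =>
    unfold lunaDraw
    split_ifs
    · exact zero_le_one
    · exact sub_nonneg.2 (testProb_le_one _ _)
  | some m =>
    unfold lunaDraw
    split_ifs
    · exact le_rfl
    · exact div_nonneg (testProb_nonneg _ _) (Nat.cast_nonneg _)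

theorem lunaDraw_sum (M K : ℕ) (σ : LunaState K) : ∑ a, lunaDraw M K σ a = 1 := by
  rw [Fintype.sum_option]
  unfold lunaDraw
  by_cases h : σ.elapsed < K
  · simp [h]
  · rcases Nat.eq_zero_or_pos M with rfl | hM
    · simp [h, testProb, margin]
    · have : (M : ℝ) ≠ 0 := by positivity
      simp only [h, if_false, Finset.sum_const, Finset.card_univ, Fintype.card_fin, nsmul_eq_mul]
      field_simp
      ring

/-- LUNA for the demand levels `y`, with `K` exploratory prices. -/
def luna (c s : ℝ) {M K : ℕ} (y : Fin M → ℝ) (sel : (Fin K → ℝ) → Fin K) :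
    PricingPolicy (LunaState K) (Option (Fin M)) where
  init := { elapsed := 0, obs := fun _ => 0 }
  draw := lunaDraw M K
  draw_nonneg := lunaDraw_nonneg M K
  draw_sum := lunaDraw_sum M K
  price := lunaPrice c s y sel
  next := lunaNext c s y sel

/-- The number of exploratory prices for an unknown variation budget, `⌈b ^ (-1/3) T ^ (1/3)⌉`,
where `b` is the upper bound on the orders. -/
def gridSize (b : ℝ) (T : ℕ) : ℕ := ⌈b ^ (-(1 / 3) : ℝ) * (T : ℝ) ^ (1 / 3 : ℝ)⌉₊

/-! ### The policy LUNAC -/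

/-- The number of discretization points for an unknown variation budget,
`⌈b ^ (-1/4) T ^ (1/4)⌉`. -/
def levelCount (b : ℝ) (T : ℕ) : ℕ := ⌈b ^ (-(1 / 4) : ℝ) * (T : ℝ) ^ (1 / 4 : ℝ)⌉₊

/-- `N` equally spaced points of `[0, b]`; numbering starts at `0`. -/
def level (b : ℝ) {N : ℕ} (n : Fin N) : ℝ := (n : ℝ) * b / ((N : ℝ) - 1)

/-- The smallest of the `N` points that is at least `q`. -/
def roundUp (b : ℝ) (N : ℕ) (q : ℝ) : ℝ :=
  sInf {x | x ∈ Set.range (level b : Fin N → ℝ) ∧ q ≤ x}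

/-- LUNAC: it runs LUNA on the `N` points, with every order rounded up to such a point before it
is reported to LUNA. -/
def lunac (c s b : ℝ) (N : ℕ) {K : ℕ} (sel : (Fin K → ℝ) → Fin K) :
    PricingPolicy (LunaState K) (Option (Fin N)) :=
  { luna c s (level b : Fin N → ℝ) sel with
    next := fun σ a q => lunaNext c s (level b : Fin N → ℝ) sel σ a (roundUp b N q) }

/-! ### The retailer who uses maximum likelihood estimation -/

/-- `est` is a maximum likelihood estimator for the family of densities `f θ`, `θ : Θ`: for each
sample of values in `supp`, of any size, it returns a parameter that maximizes the likelihood.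
(For the empty sample, every parameter does.) -/
def IsMLE {D Θ : Type} (f : Θ → D → ℝ) (supp : Set D) (est : (t : ℕ) → (Fin t → D) → Θ) : Prop :=
  ∀ (t : ℕ) (x : Fin t → D), (∀ i, x i ∈ supp) → ∀ θ : Θ,
    ∏ i, f θ (x i) ≤ ∏ i, f (est t x) (x i)

/-- The fitted distribution function, set to `1` from the bound `b` on the orders on. -/
def perceived (b : ℝ) (μ : Measure ℝ) (x : ℝ) : ℝ := if x < b then cdf μ x else 1

/-- Order, at price `w` in period `t` (after `t` demand observations), of a retailer who fits the
family `F` by the estimator `est` to the past demands. -/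
def fittedOrder {D Θ : Type} (Ξ : Set ℝ) (s b : ℝ) (F : Θ → Measure ℝ)
    (est : (t : ℕ) → (Fin t → D) → Θ) (ξ : ℕ → D) (t : ℕ) (w : ℝ) : ℝ :=
  order Ξ (perceived b (F (est t fun i => ξ i))) s w

/-- Expected regret of LUNAC over the horizon `T`, given the demands `ξ`, against the retailer who
fits the family `F` by `est` and never orders more than `b`. -/
def lunacRegret {D Θ : Type} (c s b : ℝ) (T : ℕ) (sel : (Fin (gridSize b T) → ℝ) → Fin (gridSize b T))
    (F : Θ → Measure ℝ) (est : (t : ℕ) → (Fin t → D) → Θ) (ξ : ℕ → D) : ℝ :=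
  (lunac c s b (levelCount b T) sel).regret c s (fittedOrder (Set.Icc 0 b) s b F est ξ) T

/-- Expected regret of LUNA over the horizon `T`, given the demands `ξ`, for demand on the points
`y` with largest point `b`, against the retailer who fits the family `F` by `est`. -/
def lunaRegret {D Θ : Type} (c s b : ℝ) {M : ℕ} (y : Fin M → ℝ) (T : ℕ)
    (sel : (Fin (gridSize b T) → ℝ) → Fin (gridSize b T))
    (F : Θ → Measure ℝ) (est : (t : ℕ) → (Fin t → D) → Θ) (ξ : ℕ → D) : ℝ :=
  (luna c s y sel).regret c s (fittedOrder (Set.range y) s b F est ξ) T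

end Wholesale

end

noncomputable section

namespace Wholesale

/-! ### Amortized analysis of LUNA -/

/-! The demands enter only through the responses `r t` of the retailer, so the regret is first
bounded for a fixed sequence of responses. By induction on the number of remaining periods, the
expected cost-to-go is at most `potential` (`regretFrom_le_potential`). In a quiet exploitation
period the surrogate price loses the grid error, the rounding error, a multiple of the margin `√(M /
j)`, and possibly what is lost by selling below the unit cost (`periodRegret_surrogatePrice_le`). If
the test of some level would end the epoch, the surrogate price may be bad; but this level is drawn
with probability `1 / √(M j)`, and the potential is built so that a restart leaves a surplus `R √(M
j)`, whose expectation is the maximal loss `R` of a period. The inequality `√(M x) ≤ α x + M / (4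
α)` makes the cost of an epoch linear in its length, so that the lengths add up to the horizon
whenever the random restarts occur. Restarts are paid for by a budget `Ψ` that falls by at least one
at each of them.

An order is a quantile at `1 - w / s`, so a uniform change of the distribution function by `v` acts
like a shift of the price by `s v` (`order_shiftBound`). The prices of LUNA contain margins such
that an epoch of length `j`, apart from the first one, ends only if the shift within it is at least
`√(M / j) / b` (`LevelTrigger.margin_le`, `SurrogateTrigger.margin_le`). Trading total variation `V`
against time gives, up to constants, at most `1 + (V² T b² / M)^(1/3)` epochs
(`one_le_of_margin_le`, `regret_le_of_variation`). One more observation after `t` of them moves the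
fitted distribution function by `O(log T / t)`: surely for the empirical distribution, with high
probability for the other families, so `V` is polylogarithmic. With `T = b x ^ 12` the rates become
`b² x⁹` for LUNAC and `b² x⁸ M^(1/3)` for LUNA; the first summand of the rate of LUNAC suffices.

What remains is the loss below the unit cost: the surrogate price subtracts `margin / y*`, which is
large if the best observed order `y*` is tiny. For Poisson and categorical demand positive orders
are bounded away from `0`. For exponential demand, and for normal demand with `F₀ 0 < 1 - c / s`, a
profit bounded away from `0` is possible after a short initial phase, which bounds `y*` from below
or makes the margin large (`surrogate_loss_le_of_profit`). For normal demand with `F₀ 0 ≥ 1 - c /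
s`, the orders at prices above the unit cost are `O(√(log T / t))`. Then epochs last, up to
logarithms, as long as the time elapsed before them, so there are only polylogarithmically many, and
the loss is quadratic in the gap below the unit cost (`lunac_regret_le_of_small_orders`). -/

/-- LUNA, with every order passed through `ρ` before it is reported. -/
def lunaRounded (c s : ℝ) {M K : ℕ} (y : Fin M → ℝ) (sel : (Fin K → ℝ) → Fin K) (ρ : ℝ → ℝ) :
    PricingPolicy (LunaState K) (Option (Fin M)) :=
  { luna c s y sel with next := fun σ a q => lunaNext c s y sel σ a (ρ q) }

/-- The orders reported in the exploration phase of an epoch that starts in period `t₀`. -/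
def exploreObs (c s : ℝ) (K : ℕ) (ρ : ℝ → ℝ) (r : ℕ → ℝ → ℝ) (t₀ : ℕ) : Fin K → ℝ :=
  fun k => ρ (r (t₀ + k) (explorePrice c s k))

/-- The surrogate price ends the epoch that started in period `t₀`, after `e` periods. -/
def SurrogateTrigger (c s : ℝ) (M : ℕ) {K : ℕ} (sel : (Fin K → ℝ) → Fin K) (ρ : ℝ → ℝ)
    (r : ℕ → ℝ → ℝ) (t₀ e : ℕ) : Prop :=
  ρ (r (t₀ + e) (surrogatePrice c s sel M (e + 1) (exploreObs c s K ρ r t₀))) <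
    bestOrder c s sel (exploreObs c s K ρ r t₀)

/-- The test of level `m` ends the epoch that started in period `t₀`, after `e` periods. -/
def LevelTrigger (c s : ℝ) {M K : ℕ} (y : Fin M → ℝ) (sel : (Fin K → ℝ) → Fin K) (ρ : ℝ → ℝ)
    (r : ℕ → ℝ → ℝ) (t₀ e : ℕ) (m : Fin M) : Prop :=
  Testable c s sel M (e + 1) (exploreObs c s K ρ r t₀) (y m) ∧
    y m ≤ ρ (r (t₀ + e) (testPrice c s sel M (e + 1) (exploreObs c s K ρ r t₀) (y m)))

theorem margin_nonneg (M j : ℕ) : 0 ≤ margin M j := Real.sqrt_nonneg _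

/-- Concavity of the square root. It lets the margins of an epoch telescope into `√(M e)`. -/
theorem margin_le_sqrt_diff (M e : ℕ) :
    margin M (e + 1) ≤ 2 * (√((M : ℝ) * (e + 1 : ℕ)) - √((M : ℝ) * e)) := by
  unfold margin
  rw [Real.sqrt_div' _ (by positivity), Real.sqrt_mul (by positivity), Real.sqrt_mul (by positivity),
    ← mul_sub, div_le_iff₀ (by positivity)]
  have h1 : √((e + 1 : ℕ) : ℝ) * √((e + 1 : ℕ) : ℝ) = e + 1 := by
    rw [Real.mul_self_sqrt (by positivity)]; push_cast; rfl
  have h2 : √(e : ℝ) * √(e : ℝ) = e := Real.mul_self_sqrt (by positivity)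
  have h3 := Real.sqrt_nonneg (M : ℝ)
  have h4 : 1 ≤ 2 * (√((e + 1 : ℕ) : ℝ) - √(e : ℝ)) * √((e + 1 : ℕ) : ℝ) := by
    nlinarith [sq_nonneg (√((e + 1 : ℕ) : ℝ) - √(e : ℝ))]
  nlinarith

/-- A given level is tested with probability `margin / M`, so a surplus `R √(M j)` at a restart is
worth exactly `R` in expectation. -/
theorem margin_mul_sqrt {M : ℕ} (hM : 0 < M) (e : ℕ) :
    margin M (e + 1) / M * √((M : ℝ) * (e + 1 : ℕ)) = 1 := by
  unfold margin
  have hM' : (0 : ℝ) < M := by exact_mod_cast hM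
  have h1 : √(M : ℝ) * √(M : ℝ) = M := Real.mul_self_sqrt hM'.le
  have h2 : 0 < √((e + 1 : ℕ) : ℝ) := by positivity
  rw [Real.sqrt_div' _ (by positivity), Real.sqrt_mul (by positivity)]
  field_simp
  rw [sq, h1]

/-- The harmonic numbers. -/
def harm (n : ℕ) : ℝ := ∑ i ∈ Finset.range n, 1 / ((i : ℝ) + 1)

theorem harm_succ (n : ℕ) : harm (n + 1) = harm n + 1 / ((n : ℝ) + 1) :=
  Finset.sum_range_succ _ _

theorem harm_mono {m n : ℕ} (h : m ≤ n) : harm m ≤ harm n :=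
  Finset.sum_le_sum_of_subset_of_nonneg (Finset.range_mono h) fun _ _ _ => by positivity

theorem harm_nonneg (n : ℕ) : 0 ≤ harm n := Finset.sum_nonneg fun _ _ => by positivity

theorem harm_le (n : ℕ) : harm n ≤ 1 + Real.log n := by
  have h := harmonic_le_one_add_log n
  refine le_trans (le_of_eq ?_) h
  simp [harm, harmonic]

/-- Average of the costs of the choices of LUNA in the exploitation phase. -/
theorem option_average_le {M : ℕ} (hM : 0 < M) {p X Y : ℝ} (hp : 0 ≤ p) (hp1 : p ≤ 1)
    {f : Option (Fin M) → ℝ} {g : Fin M → ℝ} (h0 : f none ≤ X) (h : ∀ m, f (some m) ≤ Y - g m)  :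
    (1 - p) * f none + ∑ m, p / M * f (some m) ≤ (1 - p) * X + p * Y - ∑ m, p / M * g m := by
  have hM' : (M : ℝ) ≠ 0 := by positivity
  have h1 : ∑ m, p / M * f (some m) ≤ ∑ m : Fin M, (p / M * Y - p / M * g m) := by
    refine Finset.sum_le_sum fun m _ => ?_
    rw [← mul_sub]
    exact mul_le_mul_of_nonneg_left (h m) (by positivity)
  rw [Finset.sum_sub_distrib, Finset.sum_const, Finset.card_univ, Fintype.card_fin,
    nsmul_eq_mul] at h1
  have h2 : (M : ℝ) * (p / M * Y) = p * Y := by field_simp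
  have h3 : (1 - p) * f none ≤ (1 - p) * X := mul_le_mul_of_nonneg_left h0 (by linarith)
  linarith

/-- Bound for the regret over the last `n` of `T` periods, when `e` periods of the current epoch,
which started in period `t₀`, are completed. -/
def potential (M K T : ℕ) (κ R C₁ α G Q : ℝ) (Ψ : ℕ → ℝ) (n e t₀ : ℕ) : ℝ :=
  n * κ + R * ((K - e : ℕ) : ℝ) + C₁ * (α * (n + e) + M / (4 * α) - √((M : ℝ) * e)) +
    G * (harm T - harm e) + Q * Ψ t₀

/-- Arithmetic and geometric mean of `α x` and `M / (4 α)`. The bound is affine in the length `x` of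
an epoch, hence additive over epochs. -/
theorem sqrt_mul_le (M : ℕ) {α x : ℝ} (hα : 0 < α) (hx : 0 ≤ x) :
    √((M : ℝ) * x) ≤ α * x + M / (4 * α) := by
  apply Real.sqrt_le_iff.2
  refine ⟨by positivity, ?_⟩
  have h : (M : ℝ) * x = 4 * (α * x) * (M / (4 * α)) := by field_simp
  nlinarith [sq_nonneg (α * x - M / (4 * α))]

/-- The term `R (K - e)` loses one unit `R`; the growth of `√(M e)` and of `harm e` only helps. -/
theorem explore_step {M K T : ℕ} {κ R C₁ α G Q : ℝ} {Ψ : ℕ → ℝ} (hκ : 0 ≤ κ) (hC : 0 ≤ C₁)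
    (hG : 0 ≤ G) {n e t₀ : ℕ} (he : e < K) :
    R + potential M K T κ R C₁ α G Q Ψ n (e + 1) t₀ ≤ potential M K T κ R C₁ α G Q Ψ (n + 1) e t₀ := by
  unfold potential
  have h1 : ((K - e : ℕ) : ℝ) = ((K - (e + 1) : ℕ) : ℝ) + 1 := by
    have : K - e = (K - (e + 1)) + 1 := by omega
    rw [this]; push_cast; rfl
  have h2 : √((M : ℝ) * e) ≤ √((M : ℝ) * (e + 1 : ℕ)) := by
    apply Real.sqrt_le_sqrt; push_cast; nlinarith [(Nat.cast_nonneg M : (0 : ℝ) ≤ M)]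
  have h3 := harm_mono (Nat.le_succ e)
  rw [h1]
  have h4 := mul_le_mul_of_nonneg_left h2 hC
  have h5 := mul_le_mul_of_nonneg_left h3 hG
  push_cast at *
  simp only [Nat.succ_eq_add_one] at *
  nlinarith

/-- The three costs are paid by `n κ`, by the growth of `√(M e)` and by that of `harm e`. The factor
`2` in `C₁` is the one in `margin_le_sqrt_diff`. -/
theorem exploit_step {M K T : ℕ} {κ R C₁ C₂ α G Q : ℝ} {Ψ : ℕ → ℝ} (hC : 0 ≤ C₁)
    (hC₁ : C₁ = 2 * (R + C₂)) {n e t₀ : ℕ} (he : K ≤ e) :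
    κ + (R + C₂) * margin M (e + 1) + G / (e + 1) + potential M K T κ R C₁ α G Q Ψ n (e + 1) t₀ ≤
      potential M K T κ R C₁ α G Q Ψ (n + 1) e t₀ := by
  unfold potential
  have h1 : K - (e + 1) = 0 := by omega
  have h2 : K - e = 0 := by omega
  rw [h1, h2, harm_succ]
  have h3 := mul_le_mul_of_nonneg_left (margin_le_sqrt_diff M e) hC
  rw [hC₁] at *
  push_cast at *
  rw [div_eq_mul_one_div G]
  nlinarith

/-- One unit of `Ψ` releases `Q`, which finances a fresh epoch. The released `C₁ α (e + 1)`,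
together with the part `C₁ M / α` of `Q`, outweighs `√(M (e + 1))` with the coefficient `C₁ + R`:
`C₁` for the square root that disappears from the potential, `R` for the surplus. -/
theorem restart_step {M K T : ℕ} {κ R C₁ α G Q : ℝ} {Ψ : ℕ → ℝ} (hR : 0 ≤ R) (hC : 2 * R ≤ C₁)
    (hα : 0 < α) (hG : 0 ≤ G) (hQ : R * K + R + G * harm T + C₁ * M / α ≤ Q) {n e t₀ t₁ : ℕ}
    (he : K ≤ e) (heT : e + 1 ≤ T) (hΨ : Ψ t₁ + 1 ≤ Ψ t₀) :
    R + potential M K T κ R C₁ α G Q Ψ n 0 t₁ + R * √((M : ℝ) * (e + 1 : ℕ)) ≤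
      potential M K T κ R C₁ α G Q Ψ n (e + 1) t₀ := by
  unfold potential
  have h1 : K - (e + 1) = 0 := by omega
  rw [h1]
  have h2 : harm 0 = 0 := by simp [harm]
  have h3 := harm_mono heT
  have hM : (0 : ℝ) ≤ M := Nat.cast_nonneg M
  have hC' : 0 ≤ C₁ := by linarith
  have hQ0 : 0 ≤ Q := by
    refine le_trans ?_ hQ
    have := harm_nonneg T
    positivity
  have h4 : Q ≤ Q * (Ψ t₀ - Ψ t₁) := by nlinarith
  have h5 : (C₁ + R) * √((M : ℝ) * (e + 1 : ℕ)) ≤ C₁ * (α * (e + 1)) + C₁ * M / α := by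
    -- After `C₁ + R ≤ 3 C₁ / 2`, the weight `2 α / 3` makes the linear term exactly `C₁ α (e + 1)`.
    have h6 := sqrt_mul_le M (α := 2 / 3 * α) (x := (e + 1 : ℕ)) (by positivity) (by positivity)
    have h7 : (C₁ + R) * √((M : ℝ) * (e + 1 : ℕ)) ≤ (3 / 2 * C₁) * √((M : ℝ) * (e + 1 : ℕ)) :=
      mul_le_mul_of_nonneg_right (by linarith) (Real.sqrt_nonneg _)
    have h8 := mul_le_mul_of_nonneg_left h6 (by positivity : 0 ≤ 3 / 2 * C₁)
    have h9 : 3 / 2 * C₁ * (2 / 3 * α * (e + 1 : ℕ) + M / (4 * (2 / 3 * α))) =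
        C₁ * (α * (e + 1)) + 9 / 16 * (C₁ * M / α) := by
      push_cast; field_simp; ring
    have h10 : 0 ≤ C₁ * M / α := by positivity
    linarith
  have h6 := mul_le_mul_of_nonneg_left h3 hG
  have h7 := harm_nonneg (e + 1)
  rw [h2]
  push_cast at *
  simp only [mul_zero, Real.sqrt_zero, Nat.sub_zero]
  nlinarith [mul_nonneg hG h7]

section Core

variable {c s : ℝ} {M K T : ℕ} {y : Fin M → ℝ} {sel : (Fin K → ℝ) → Fin K} {ρ : ℝ → ℝ}
  {r : ℕ → ℝ → ℝ}

/-- The cost-to-go of LUNA satisfies the bound `potential`. -/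
theorem regretFrom_le_potential {κ R C₁ C₂ α G Q : ℝ} {Ψ : ℕ → ℝ} (hM : 0 < M) (hκ : 0 ≤ κ)
    (hR : 0 ≤ R) (hC₂ : 0 ≤ C₂) (hC₁ : C₁ = 2 * (R + C₂)) (hα : 0 < α) (hG : 0 ≤ G)
    (hQ : R * K + R + G * harm T + C₁ * M / α ≤ Q)
    (hΨ0 : ∀ t, t ≤ T → 0 ≤ Ψ t)
    (hnn : ∀ t (k : Fin K), 0 ≤ ρ (r t (explorePrice c s k)))
    (hreg : ∀ t (σ : LunaState K) a, (∀ k, 0 ≤ σ.obs k) → periodRegret c s (r t) (lunaPrice c s y sel σ a) ≤ R)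
    (hΨ : ∀ t₀ e, K ≤ e → t₀ + e < T → (SurrogateTrigger c s M sel ρ r t₀ e ∨
      ∃ m, LevelTrigger c s y sel ρ r t₀ e m) → Ψ (t₀ + e + 1) + 1 ≤ Ψ t₀)
    (hgood : ∀ t₀ e, K ≤ e → t₀ + e < T → margin M (e + 1) < 1 →
      ¬ SurrogateTrigger c s M sel ρ r t₀ e → (∀ m, ¬ LevelTrigger c s y sel ρ r t₀ e m) →
      periodRegret c s (r (t₀ + e))
        (surrogatePrice c s sel M (e + 1) (exploreObs c s K ρ r t₀)) ≤
        κ + C₂ * margin M (e + 1) + G / (e + 1)) (n : ℕ) :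
    ∀ (t₀ e : ℕ) (obs : Fin K → ℝ), t₀ + e + n = T → (∀ k, 0 ≤ obs k) →
      (∀ k : Fin K, (k : ℕ) < e → obs k = exploreObs c s K ρ r t₀ k) →
      (lunaRounded c s y sel ρ).regretFrom c s r n (t₀ + e) ⟨e, obs⟩ ≤
        potential M K T κ R C₁ α G Q Ψ n e t₀ := by
  have hC1 : 0 ≤ C₁ := by rw [hC₁]; positivity
  have hQ0 : 0 ≤ Q := by
    refine le_trans ?_ hQ
    have := harm_nonneg T
    positivity
  induction n with
  | zero =>
    intro t₀ e obs hT _ _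
    have h1 := sqrt_mul_le M hα (Nat.cast_nonneg e : (0 : ℝ) ≤ e)
    have h2 := harm_mono (show e ≤ T by omega)
    have h3 := hΨ0 t₀ (by omega)
    unfold PricingPolicy.regretFrom potential
    have h4 : 0 ≤ C₁ * (α * ((0 : ℕ) + e) + M / (4 * α) - √((M : ℝ) * e)) := by
      apply mul_nonneg hC1; push_cast; linarith
    have h5 : 0 ≤ G * (harm T - harm e) := mul_nonneg hG (by linarith)
    have h6 : 0 ≤ R * ((K - e : ℕ) : ℝ) := by positivity
    have h7 := mul_nonneg hQ0 h3
    push_cast at *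
    linarith
  | succ n ih =>
    intro t₀ e obs hT hobs0 hobs
    set π := lunaRounded c s y sel ρ with hπ
    set f : Option (Fin M) → ℝ := fun a =>
      periodRegret c s (r (t₀ + e)) (π.price ⟨e, obs⟩ a) +
        π.regretFrom c s r n (t₀ + e + 1) (π.next ⟨e, obs⟩ a (r (t₀ + e) (π.price ⟨e, obs⟩ a)))
      with hf
    have hunf : π.regretFrom c s r (n + 1) (t₀ + e) ⟨e, obs⟩ =
        ∑ a, lunaDraw M K ⟨e, obs⟩ a * f a := rfl
    rw [hunf, Fintype.sum_option]
    rcases lt_or_ge e K with he | he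
    · have h1 : f none ≤ R + potential M K T κ R C₁ α G Q Ψ n (e + 1) t₀ := by
        refine add_le_add (hreg (t₀ + e) ⟨e, obs⟩ none hobs0) ?_
        have hnext : π.next ⟨e, obs⟩ none (r (t₀ + e) (π.price ⟨e, obs⟩ none)) =
            ⟨e + 1, Function.update obs ⟨e, he⟩ (ρ (r (t₀ + e) (explorePrice c s ⟨e, he⟩)))⟩ := by
          simp [hπ, lunaRounded, luna, lunaNext, lunaPrice, he]
        rw [hnext]
        refine ih t₀ (e + 1) _ (by omega) (fun k => ?_) fun k hk => ?_
        · rcases eq_or_ne k ⟨e, he⟩ with rfl | hne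
          · simpa using hnn _ _
          · rw [Function.update_of_ne hne]
            exact hobs0 k
        rcases eq_or_ne k ⟨e, he⟩ with rfl | hne
        · simp [exploreObs]
        · rw [Function.update_of_ne hne]
          exact hobs k (by
            have : (k : ℕ) ≠ e := fun h => hne (Fin.ext h)
            omega)
      simp only [lunaDraw, he, if_true, one_mul, zero_mul, Finset.sum_const_zero, add_zero]
      exact h1.trans (explore_step hκ hC1 hG he)
    · have hobs' : obs = exploreObs c s K ρ r t₀ := funext fun k => hobs k (by omega)
      subst hobs'
      have hnot : ¬ e < K := by omega
      have heT : t₀ + e < T := by omega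
      set N₀ := potential M K T κ R C₁ α G Q Ψ n (e + 1) t₀ with hN₀
      set g := R * √((M : ℝ) * (e + 1 : ℕ)) with hg
      have hg0 : 0 ≤ g := by positivity
      have hstay : ∀ a, ¬ LunaRestart c s y sel ⟨e, exploreObs c s K ρ r t₀⟩
          (ρ (r (t₀ + e) (π.price ⟨e, exploreObs c s K ρ r t₀⟩ a))) a →
          f a ≤ periodRegret c s (r (t₀ + e)) (π.price ⟨e, exploreObs c s K ρ r t₀⟩ a) + N₀ := by
        intro a ha
        refine add_le_add le_rfl ?_
        have hnext : π.next ⟨e, exploreObs c s K ρ r t₀⟩ a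
            (r (t₀ + e) (π.price ⟨e, exploreObs c s K ρ r t₀⟩ a)) =
            ⟨e + 1, exploreObs c s K ρ r t₀⟩ := by
          simp only [hπ, lunaRounded, lunaNext, hnot, dif_neg, not_false_eq_true]
          rw [if_neg]
          exact ha
        rw [hnext]
        exact ih t₀ (e + 1) _ (by omega) hobs0 fun k _ => rfl
      have hrestart : ∀ a, LunaRestart c s y sel ⟨e, exploreObs c s K ρ r t₀⟩
          (ρ (r (t₀ + e) (π.price ⟨e, exploreObs c s K ρ r t₀⟩ a))) a →
          Ψ (t₀ + e + 1) + 1 ≤ Ψ t₀ → f a ≤ N₀ - g := by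
        intro a ha hΨ'
        have h1 : f a ≤ R + potential M K T κ R C₁ α G Q Ψ n 0 (t₀ + e + 1) := by
          refine add_le_add (hreg _ ⟨e, _⟩ a hobs0) ?_
          have hnext : π.next ⟨e, exploreObs c s K ρ r t₀⟩ a
              (r (t₀ + e) (π.price ⟨e, exploreObs c s K ρ r t₀⟩ a)) =
              ⟨0, fun _ => 0⟩ := by
            simp only [hπ, lunaRounded, lunaNext, hnot, dif_neg, not_false_eq_true]
            rw [if_pos]
            exact ha
          rw [hnext]
          exact ih (t₀ + e + 1) 0 _ (by omega) (fun _ => le_rfl) fun k hk => absurd hk (Nat.not_lt_zero _)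
        have h2 := restart_step (κ := κ) (M := M) (T := T) (n := n) hR (by linarith) hα hG hQ he
          (by omega) hΨ'
        linarith
      have hall : ∀ a, (LunaRestart c s y sel ⟨e, exploreObs c s K ρ r t₀⟩
          (ρ (r (t₀ + e) (π.price ⟨e, exploreObs c s K ρ r t₀⟩ a))) a →
          Ψ (t₀ + e + 1) + 1 ≤ Ψ t₀) → f a ≤ R + N₀ := by
        intro a ha
        by_cases h : LunaRestart c s y sel ⟨e, exploreObs c s K ρ r t₀⟩
          (ρ (r (t₀ + e) (π.price ⟨e, exploreObs c s K ρ r t₀⟩ a))) a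
        · linarith [hrestart a h (ha h)]
        · exact (hstay a h).trans (add_le_add (hreg _ ⟨e, _⟩ a hobs0) le_rfl)
      have hnone : LunaRestart c s y sel ⟨e, exploreObs c s K ρ r t₀⟩
          (ρ (r (t₀ + e) (π.price ⟨e, exploreObs c s K ρ r t₀⟩ none))) none ↔
          SurrogateTrigger c s M sel ρ r t₀ e := by
        simp [LunaRestart, SurrogateTrigger, hπ, lunaRounded, luna, lunaPrice, hnot]
      have hsome : ∀ m, LunaRestart c s y sel ⟨e, exploreObs c s K ρ r t₀⟩
          (ρ (r (t₀ + e) (π.price ⟨e, exploreObs c s K ρ r t₀⟩ (some m)))) (some m) ↔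
          LevelTrigger c s y sel ρ r t₀ e m := by
        intro m
        simp only [LunaRestart, LevelTrigger, hπ, lunaRounded, luna, lunaPrice]
        refine and_congr_right fun h => ?_
        rw [if_pos h]
      have hnoneR : f none ≤ R + N₀ := hall _ fun h => hΨ t₀ e he heT (Or.inl (hnone.1 h))
      have hsomeR : ∀ m, f (some m) ≤ R + N₀ - 0 := fun m => by
        rw [sub_zero]
        exact hall _ fun h => hΨ t₀ e he heT (Or.inr ⟨m, (hsome m).1 h⟩)
      have hstep := exploit_step (M := M) (T := T) (κ := κ) (G := G) (Q := Q) (α := α) (Ψ := Ψ)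
        (n := n) (t₀ := t₀) hC1 hC₁ he
      have hm0 := margin_nonneg M (e + 1)
      have hG0 : 0 ≤ G / ((e : ℝ) + 1) := by positivity
      have hp0 := testProb_nonneg M (e + 1)
      have hp1 := testProb_le_one M (e + 1)
      simp only [lunaDraw, hnot, if_false]
      -- If the margin is at least `1`, every period is a test, and its cost `R` is at most `R`
      -- times the margin.
      rcases le_or_gt 1 (margin M (e + 1)) with hΔ | hΔ
      · have hp : testProb M (e + 1) = 1 := min_eq_left hΔ
        have h := option_average_le hM hp0 hp1 hnoneR hsomeR
        rw [hp] at h ⊢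
        simp only [mul_zero, Finset.sum_const_zero] at h
        nlinarith [mul_nonneg (add_nonneg hR hC₂) (sub_nonneg.2 hΔ)]
      · have hp : testProb M (e + 1) = margin M (e + 1) := min_eq_right hΔ.le
        have hpR := mul_le_mul_of_nonneg_left hp1 hR
        -- If the surrogate price ends the epoch, the restart pays for it, and only the tests cost
        -- something.
        by_cases hS : SurrogateTrigger c s M sel ρ r t₀ e
        · have h1 : f none ≤ N₀ := by
            linarith [hrestart none (hnone.2 hS) (hΨ t₀ e he heT (Or.inl hS))]
          have h := option_average_le hM hp0 hp1 h1 hsomeR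
          simp only [mul_zero, Finset.sum_const_zero] at h
          rw [hp] at *
          nlinarith [mul_nonneg hC₂ hm0]
        -- If the test of one level `m` would end the epoch, all choices may cost `R`. The expected
        -- surplus from choosing `m` is again `R`, so only `R` times the margin is left.
        · by_cases hL : ∃ m, LevelTrigger c s y sel ρ r t₀ e m
          · obtain ⟨m, hm⟩ := hL
            have h1 : ∀ m', f (some m') ≤ R + N₀ - (if m' = m then g else 0) := by
              intro m'
              split_ifs with hmm
              · subst hmm
                linarith [hrestart (some m') ((hsome m').2 hm) (hΨ t₀ e he heT (Or.inr ⟨m', hm⟩))]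
              · exact hsomeR m'
            have h := option_average_le hM hp0 hp1 hnoneR h1
            simp only [mul_ite, mul_zero, Finset.sum_ite_eq', Finset.mem_univ, if_true] at h
            rw [hp] at *
            have h2 : margin M (e + 1) / M * g = R := by
              rw [hg, mul_left_comm, margin_mul_sqrt hM, mul_one]
            nlinarith [mul_nonneg (add_nonneg hR hC₂) hm0]
          · have hL' : ∀ m, ¬ LevelTrigger c s y sel ρ r t₀ e m := fun m hm => hL ⟨m, hm⟩
            have h1 : f none ≤ κ + C₂ * margin M (e + 1) + G / (e + 1) + N₀ := by
              refine (hstay none (fun h => hS (hnone.1 h))).trans (add_le_add ?_ le_rfl)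
              have := hgood t₀ e he heT hΔ hS hL'
              simpa [hπ, lunaRounded, luna, lunaPrice, hnot] using this
            have h := option_average_le hM hp0 hp1 h1 hsomeR
            simp only [mul_zero, Finset.sum_const_zero] at h
            rw [hp] at *
            nlinarith [mul_nonneg hC₂ hm0, mul_nonneg hm0 hκ, mul_nonneg hm0 hG0,
              mul_nonneg hm0 (mul_nonneg hC₂ hm0)]

/-- Regret of LUNA when the number of epochs is controlled by `Ψ`. -/
theorem regret_le_of_epochs {κ R C₂ G : ℝ} {Ψ : ℕ → ℝ} (hM : 0 < M) (hT : 1 ≤ T) (hκ : 0 ≤ κ)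
    (hR : 0 ≤ R) (hC₂ : 0 ≤ C₂) (hG : 0 ≤ G) (hΨ0 : ∀ t, t ≤ T → 0 ≤ Ψ t)
    (hnn : ∀ t (k : Fin K), 0 ≤ ρ (r t (explorePrice c s k)))
    (hreg : ∀ t (σ : LunaState K) a, (∀ k, 0 ≤ σ.obs k) → periodRegret c s (r t) (lunaPrice c s y sel σ a) ≤ R)
    (hΨ : ∀ t₀ e, K ≤ e → t₀ + e < T → (SurrogateTrigger c s M sel ρ r t₀ e ∨
      ∃ m, LevelTrigger c s y sel ρ r t₀ e m) → Ψ (t₀ + e + 1) + 1 ≤ Ψ t₀)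
    (hgood : ∀ t₀ e, K ≤ e → t₀ + e < T → margin M (e + 1) < 1 →
      ¬ SurrogateTrigger c s M sel ρ r t₀ e → (∀ m, ¬ LevelTrigger c s y sel ρ r t₀ e m) →
      periodRegret c s (r (t₀ + e))
        (surrogatePrice c s sel M (e + 1) (exploreObs c s K ρ r t₀)) ≤
        κ + C₂ * margin M (e + 1) + G / (e + 1)) :
    (lunaRounded c s y sel ρ).regret c s r T ≤ T * κ +
      (1 + Ψ 0) * (R * K + R + G * (1 + Real.log T)) +
      6 * (R + C₂) * √(M * (1 + Ψ 0) * T) := by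
  have hM' : (0 : ℝ) < M := by exact_mod_cast hM
  have hT' : (0 : ℝ) < T := by exact_mod_cast hT
  have hE : 0 < 1 + Ψ 0 := by linarith [hΨ0 0 (Nat.zero_le _)]
  -- This `α` balances the linear term `α T` against `(1 + Ψ 0) M / α`, the constant term of all
  -- epochs.
  set α := √(M * (1 + Ψ 0) / T) with hα
  have hα0 : 0 < α := by positivity
  have hα2 : α * α = M * (1 + Ψ 0) / T := Real.mul_self_sqrt (by positivity)
  have hsq : √(M * (1 + Ψ 0) * T) = α * T := by
    rw [hα, Real.sqrt_eq_iff_mul_self_eq (by positivity) (by positivity)]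
    rw [← hα, mul_mul_mul_comm, hα2]; field_simp
  have hdiv : (1 + Ψ 0) * (M / α) = α * T := by
    rw [mul_div_assoc', div_eq_iff hα0.ne', mul_right_comm, hα2]; field_simp
  have h := regretFrom_le_potential (C₁ := 2 * (R + C₂)) hM hκ hR hC₂ rfl hα0 hG le_rfl hΨ0 hnn hreg hΨ
    hgood     T 0 0 (fun _ => 0) (by omega) (fun _ => le_rfl) fun k hk => absurd hk (Nat.not_lt_zero _)
  refine le_trans h ?_
  unfold potential
  have h0 : harm 0 = 0 := by simp [harm]
  have h1 := mul_le_mul_of_nonneg_left (harm_le T) hG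
  have h2 := mul_le_mul_of_nonneg_left h1 hE.le
  have h3 : (M : ℝ) / (4 * α) = M / α / 4 := by field_simp
  have h4 : 2 * (R + C₂) * M / α = 2 * (R + C₂) * (M / α) := by ring
  have h5 : 0 ≤ (R + C₂) * (Ψ 0 * (M / α)) :=
    mul_nonneg (by positivity) (mul_nonneg (hΨ0 0 (Nat.zero_le _)) (by positivity))
  have h6 : 0 ≤ (R + C₂) * (M / α) := by positivity
  rw [hsq, h0, h3, h4]
  simp only [Nat.cast_zero, mul_zero, Real.sqrt_zero, Nat.sub_zero, sub_zero, add_zero]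
  have h7 : (R + C₂) * ((1 + Ψ 0) * (M / α)) = (R + C₂) * (α * T) := by rw [hdiv]
  nlinarith

end Core


/-! ### Prices, profits and triggers -/

/-- The orders `r t w` at prices in `[0, s]` are at most `b` and antitone in the price, and `ρ`
rounds them up to levels `y m`, by at most `ε`. -/
structure Observed (s b ε : ℝ) {M : ℕ} (y : Fin M → ℝ) (ρ : ℝ → ℝ) (r : ℕ → ℝ → ℝ) : Prop where
  nonneg : ∀ t w, 0 ≤ w → w ≤ s → 0 ≤ r t w
  le : ∀ t w, 0 ≤ w → w ≤ s → r t w ≤ b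
  anti : ∀ t w w', 0 ≤ w → w ≤ w' → w' ≤ s → r t w' ≤ r t w
  mono : ∀ p q, 0 ≤ p → p ≤ q → q ≤ b → ρ p ≤ ρ q
  le_round : ∀ q, 0 ≤ q → q ≤ b → q ≤ ρ q
  round_le : ∀ q, 0 ≤ q → q ≤ b → ρ q ≤ q + ε
  mem : ∀ t w, 0 ≤ w → w ≤ s → ρ (r t w) ∈ Set.range y
  level_le : ∀ m, y m ≤ b

/-- Up to a shift of the price by `δ`, the orders in period `t'` are at least those in period
`t`. -/
def ShiftBound (s : ℝ) (r : ℕ → ℝ → ℝ) (δ : ℝ) (t t' : ℕ) : Prop :=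
  ∀ w w', 0 ≤ w' → w' ≤ w - δ → w ≤ s → r t w ≤ r t' w'

section Period

variable {c s b ε : ℝ} {M K : ℕ} {y : Fin M → ℝ} {sel : (Fin K → ℝ) → Fin K} {ρ : ℝ → ℝ}
  {r : ℕ → ℝ → ℝ}

theorem le_explorePrice (hcs : c < s) (k : Fin K) : c ≤ explorePrice c s k := by
  have : 0 ≤ (s - c) / K := div_nonneg (by linarith) (Nat.cast_nonneg K)
  unfold explorePrice
  nlinarith [(Nat.cast_nonneg (k : ℕ) : (0 : ℝ) ≤ _)]

theorem explorePrice_lt (hcs : c < s) (k : Fin K) : explorePrice c s k < s := by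
  have hK : (0 : ℝ) < K := by exact_mod_cast k.pos
  have hk : (k : ℝ) < K := by exact_mod_cast k.isLt
  have h : (k : ℝ) * ((s - c) / K) < K * ((s - c) / K) :=
    mul_lt_mul_of_pos_right hk (div_pos (by linarith) hK)
  have h2 : (K : ℝ) * ((s - c) / K) = s - c := by field_simp
  unfold explorePrice
  linarith

theorem le_bestProfit (hsel : IsArgmaxRule sel) (obs : Fin K → ℝ) (k : Fin K) :
    (explorePrice c s k - c) * obs k ≤ bestProfit c s sel obs :=
  hsel (exploreProfit c s obs) k

theorem bestProfit_eq (obs : Fin K → ℝ) : bestProfit c s sel obs =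
    (explorePrice c s (bestIndex c s sel obs) - c) * bestOrder c s sel obs := rfl

theorem bestProfit_nonneg (hcs : c < s) {obs : Fin K → ℝ} (h0 : ∀ k, 0 ≤ obs k) :
    0 ≤ bestProfit c s sel obs :=
  mul_nonneg (sub_nonneg.2 (le_explorePrice hcs _)) (h0 _)

theorem surrogatePrice_le (hc : 0 ≤ c) (hcs : c < s) {obs : Fin K → ℝ} (h0 : ∀ k, 0 ≤ obs k)
    (j : ℕ) : surrogatePrice c s sel M j obs ≤ s := by
  unfold surrogatePrice
  have h1 : 0 ≤ margin M j / bestOrder c s sel obs := div_nonneg (margin_nonneg _ _) (h0 _)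
  exact max_le (by linarith [explorePrice_lt hcs (bestIndex c s sel obs)]) (by linarith)

theorem surrogatePrice_nonneg (j : ℕ) (obs : Fin K → ℝ) : 0 ≤ surrogatePrice c s sel M j obs :=
  le_max_right _ _

theorem le_testPrice (hc : 0 ≤ c) (hcs : c < s) (obs : Fin K → ℝ)
    (j : ℕ) {z : ℝ} (hz : 0 < z) :
    c + (bestProfit c s sel obs + margin M j) / z ≤ testPrice c s sel M j obs z := by
  have h2 : z * s / K / z = s / K := by field_simp
  unfold testPrice
  rw [add_div _ (z * s / K), h2]
  have : 0 ≤ s / K := div_nonneg (by linarith) (Nat.cast_nonneg K)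
  linarith

/-- The best profit is at most `(s - c) b`, and a price below the unit cost loses at most `c b`. -/
theorem periodRegret_le (hc : 0 ≤ c) (hcs : c < s) {q : ℝ → ℝ}
    (hq : ∀ w, 0 ≤ w → w ≤ s → 0 ≤ q w) (hqb : ∀ w, 0 ≤ w → w ≤ s → q w ≤ b)
    {w : ℝ} (h0 : 0 ≤ w) (hs : w ≤ s) : periodRegret c s q w ≤ s * b := by
  unfold periodRegret profit
  have h1 : sSup ((fun v => (v - c) * q v) '' Set.Icc 0 s) ≤ (s - c) * b := by
    refine csSup_le (Set.Nonempty.image _ ⟨0, le_rfl, by linarith⟩) ?_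
    rintro _ ⟨v, ⟨hv0, hvs⟩, rfl⟩
    have := hq v hv0 hvs
    have := hqb v hv0 hvs
    simp only
    nlinarith
  have h2 := hq w h0 hs
  have h3 := hqb w h0 hs
  nlinarith

/-- Prices below the unit cost have nonpositive profit, so `0 ≤ X` takes care of them. -/
theorem periodRegret_le_of_profit_le (hc : 0 ≤ c) (hcs : c < s) (O : Observed s b ε y ρ r) (t : ℕ)
    {w X : ℝ} (hX : 0 ≤ X) (h : ∀ v, c ≤ v → v ≤ s → (v - c) * r t v ≤ X) :
    periodRegret c s (r t) w ≤ X - (w - c) * r t w := by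
  unfold periodRegret profit
  refine sub_le_sub_right (csSup_le
    (Set.Nonempty.image _ (show (Set.Icc (0 : ℝ) s).Nonempty from ⟨0, le_rfl, by linarith⟩)) ?_) _
  rintro _ ⟨v, ⟨hv0, hvs⟩, rfl⟩
  rcases le_total c v with hv | hv
  · exact h v hv hvs
  · have := O.nonneg t v hv0 hvs
    simp only
    nlinarith

theorem lunaPrice_mem (hc : 0 ≤ c) (hcs : c < s) (σ : LunaState K) (h0 : ∀ k, 0 ≤ σ.obs k)
    (a : Option (Fin M)) : 0 ≤ lunaPrice c s y sel σ a ∧ lunaPrice c s y sel σ a ≤ s := by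
  cases a with
  | none =>
    unfold lunaPrice
    split_ifs with h
    · exact ⟨hc.trans (le_explorePrice hcs _), (explorePrice_lt hcs _).le⟩
    · exact ⟨surrogatePrice_nonneg _ _, surrogatePrice_le hc hcs h0 _⟩
  | some m =>
    by_cases h : Testable c s sel M (σ.elapsed + 1) σ.obs (y m)
    · simp only [lunaPrice, if_pos h]
      refine ⟨?_, h.2⟩
      refine le_trans ?_ (le_testPrice hc hcs _ _ h.1)
      have := bestProfit_nonneg (sel := sel) hcs h0
      have := margin_nonneg M (σ.elapsed + 1)
      have := h.1
      positivity
    · simp only [lunaPrice, if_neg h]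
      exact ⟨by linarith, le_rfl⟩

theorem Observed.round_nonneg (O : Observed s b ε y ρ r) (t : ℕ) {w : ℝ} (h0 : 0 ≤ w)
    (hs : w ≤ s) : 0 ≤ ρ (r t w) :=
  (O.nonneg t w h0 hs).trans (O.le_round _ (O.nonneg t w h0 hs) (O.le t w h0 hs))

theorem Observed.round_mono (O : Observed s b ε y ρ r) {t t' : ℕ} {w w' : ℝ} (h0 : 0 ≤ w)
    (hs : w ≤ s) (h0' : 0 ≤ w') (hs' : w' ≤ s) (h : r t w ≤ r t' w') :
    ρ (r t w) ≤ ρ (r t' w') :=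
  O.mono _ _ (O.nonneg t w h0 hs) h (O.le t' w' h0' hs')

theorem exploreObs_nonneg (hc : 0 ≤ c) (hcs : c < s) (O : Observed s b ε y ρ r) (t₀ : ℕ)
    (k : Fin K) : 0 ≤ exploreObs c s K ρ r t₀ k :=
  O.round_nonneg _ (hc.trans (le_explorePrice hcs _)) (explorePrice_lt hcs _).le

/-- If no test of a level ends the epoch, then all profits are bounded by the best profit that was
observed. -/
theorem profit_le_of_not_levelTrigger (hc : 0 ≤ c) (hcs : c < s) (O : Observed s b ε y ρ r)
    {t₀ e : ℕ} (h : ∀ m, ¬ LevelTrigger c s y sel ρ r t₀ e m) {v : ℝ} (hv : c ≤ v) (hvs : v ≤ s) :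
    (v - c) * ρ (r (t₀ + e) v) ≤ bestProfit c s sel (exploreObs c s K ρ r t₀) + margin M (e + 1) +
      ρ (r (t₀ + e) v) * s / K := by
  obtain ⟨m, hm⟩ := O.mem (t₀ + e) v (hc.trans hv) hvs
  have h0 := exploreObs_nonneg (K := K) hc hcs O t₀
  have hφ := bestProfit_nonneg (sel := sel) hcs h0
  have hΔ := margin_nonneg M (e + 1)
  rw [← hm]
  have hy : 0 ≤ y m := by rw [hm]; exact O.round_nonneg _ (hc.trans hv) hvs
  rcases hy.eq_or_lt with hy | hy
  · rw [← hy]; simp; linarith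
  -- Were `v` at least the test price of its own rounded order, the test price would be admissible
  -- and, orders being antitone, would attract at least that order; so the test would end the epoch.
  have hlt : v < testPrice c s sel M (e + 1) (exploreObs c s K ρ r t₀) (y m) := by
    by_contra hcon
    push Not at hcon
    refine h m ⟨⟨hy, hcon.trans hvs⟩, ?_⟩
    have h1 := le_testPrice (M := M) (sel := sel) hc hcs
      (exploreObs c s K ρ r t₀) (e + 1) hy
    have h2 : 0 ≤ (bestProfit c s sel (exploreObs c s K ρ r t₀) + margin M (e + 1)) / y m := by
      positivity
    rw [hm]
    have h3 : 0 ≤ testPrice c s sel M (e + 1) (exploreObs c s K ρ r t₀) (y m) := by linarith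
    rw [← hm]
    calc y m = ρ (r (t₀ + e) v) := hm
      _ ≤ _ := O.round_mono (hc.trans hv) hvs h3 (hcon.trans hvs) (O.anti _ _ _ h3 hcon hvs)
  unfold testPrice at hlt
  rw [← sub_lt_iff_lt_add, lt_div_iff₀ hy] at hlt
  linarith

/-- Regret at the surrogate price in a period in which nothing ends the epoch. -/
theorem periodRegret_surrogatePrice_le (hc : 0 ≤ c) (hcs : c < s) (hε : 0 ≤ ε)
    (O : Observed s b ε y ρ r) {t₀ e : ℕ} (hS : ¬ SurrogateTrigger c s M sel ρ r t₀ e)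
    (hL : ∀ m, ¬ LevelTrigger c s y sel ρ r t₀ e m) {loss : ℝ} (hl : 0 ≤ loss)
    (hloss : bestOrder c s sel (exploreObs c s K ρ r t₀) ≠ 0 →
      surrogatePrice c s sel M (e + 1) (exploreObs c s K ρ r t₀) < c →
      (c - surrogatePrice c s sel M (e + 1) (exploreObs c s K ρ r t₀)) *
        r (t₀ + e) (surrogatePrice c s sel M (e + 1) (exploreObs c s K ρ r t₀)) ≤ loss) :
    periodRegret c s (r (t₀ + e)) (surrogatePrice c s sel M (e + 1) (exploreObs c s K ρ r t₀)) ≤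
      b * s / K + s * ε + 2 * margin M (e + 1) + loss := by
  have h0 := exploreObs_nonneg (K := K) hc hcs O t₀
  set obs := exploreObs c s K ρ r t₀ with hobs
  have hφ := bestProfit_nonneg (sel := sel) hcs h0
  have hΔ := margin_nonneg M (e + 1)
  have hb : 0 ≤ b := (O.nonneg 0 c hc hcs.le).trans (O.le 0 c hc hcs.le)
  have hs0 : 0 ≤ s := by linarith
  have hK : 0 ≤ s / K := div_nonneg hs0 (Nat.cast_nonneg K)
  have hbK : b * s / K = b * (s / K) := mul_div_assoc _ _ _
  have hw0 := surrogatePrice_nonneg (c := c) (s := s) (sel := sel) (M := M) (e + 1) obs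
  have hws := surrogatePrice_le (sel := sel) (M := M) hc hcs h0 (e + 1)
  have h1 : ∀ v, c ≤ v → v ≤ s → (v - c) * r (t₀ + e) v ≤
      bestProfit c s sel obs + margin M (e + 1) + b * s / K := by
    intro v hv hvs
    have h2 := profit_le_of_not_levelTrigger hc hcs O hL hv hvs
    have h3 := O.le_round _ (O.nonneg (t₀ + e) v (hc.trans hv) hvs)
      (O.le (t₀ + e) v (hc.trans hv) hvs)
    obtain ⟨m, hm⟩ := O.mem (t₀ + e) v (hc.trans hv) hvs
    have h4 := O.level_le m
    rw [hm] at h4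
    have h5 : ρ (r (t₀ + e) v) * s / K ≤ b * s / K := by
      rw [mul_div_assoc, hbK]; exact mul_le_mul_of_nonneg_right h4 hK
    nlinarith
  have h2 := periodRegret_le_of_profit_le (w := surrogatePrice c s sel M (e + 1) obs) hc hcs O
    (t₀ + e) (by rw [hbK]; positivity) h1
  refine h2.trans ?_
  have hr := O.nonneg (t₀ + e) _ hw0 hws
  have hr' := O.le (t₀ + e) _ hw0 hws
  have hsε : 0 ≤ s * ε := by positivity
  rcases eq_or_ne (bestOrder c s sel obs) 0 with hy | hy
  · have h3 : bestProfit c s sel obs = 0 := by rw [bestProfit_eq, hy, mul_zero]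
    have h4 : c ≤ surrogatePrice c s sel M (e + 1) obs := by
      unfold surrogatePrice
      rw [hy, div_zero, sub_zero]
      exact (le_explorePrice hcs _).trans (le_max_left _ _)
    have := mul_nonneg (sub_nonneg.2 h4) hr
    linarith
  -- Below the unit cost, the markup at the best exploratory price is less than `margin / y*`. The
  -- best observed profit is then itself below the margin, and only `loss` is added.
  rcases lt_or_ge (surrogatePrice c s sel M (e + 1) obs) c with hw | hw
  · have h3 := hloss hy hw
    have hypos : 0 < bestOrder c s sel obs := lt_of_le_of_ne (h0 _) (Ne.symm hy)
    have h4 : explorePrice c s (bestIndex c s sel obs) - margin M (e + 1) / bestOrder c s sel obs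
        < c := lt_of_le_of_lt (le_max_left _ _) hw
    have h5 : bestProfit c s sel obs ≤ margin M (e + 1) := by
      rw [bestProfit_eq, ← le_div_iff₀ hypos]
      linarith
    linarith
  -- Above the unit cost, the order is still at least `y* - ε` and the price was reduced by at most
  -- `margin / y*`, so the profit falls by at most the margin and `s ε`.
  · have hypos : 0 < bestOrder c s sel obs := lt_of_le_of_ne (h0 _) (Ne.symm hy)
    have h3 : bestOrder c s sel obs ≤ r (t₀ + e) (surrogatePrice c s sel M (e + 1) obs) + ε :=
      (not_lt.1 hS).trans (O.round_le _ hr hr')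
    have h4 : explorePrice c s (bestIndex c s sel obs) - margin M (e + 1) / bestOrder c s sel obs
        ≤ surrogatePrice c s sel M (e + 1) obs := le_max_left _ _
    have h5 : bestProfit c s sel obs - margin M (e + 1) ≤
        (surrogatePrice c s sel M (e + 1) obs - c) * bestOrder c s sel obs := by
      have h6 := mul_le_mul_of_nonneg_right h4 hypos.le
      rw [sub_mul, div_mul_cancel₀ _ hy] at h6
      rw [bestProfit_eq]
      linarith
    have h7 := mul_le_mul_of_nonneg_left h3 (sub_nonneg.2 hw)
    have h8 : (surrogatePrice c s sel M (e + 1) obs - c) * ε ≤ s * ε :=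
      mul_le_mul_of_nonneg_right (by linarith) hε
    linarith

/-- A test of a level that ends an epoch detects a change of the orders. -/
theorem LevelTrigger.margin_le (hc : 0 ≤ c) (hcs : c < s) (hsel : IsArgmaxRule sel)
    (O : Observed s b ε y ρ r) {t₀ e : ℕ} {m : Fin M} (h : LevelTrigger c s y sel ρ r t₀ e m)
    {δ : ℝ} (hδ : ∀ k : Fin K, ShiftBound s r δ (t₀ + e) (t₀ + k)) :
    margin M (e + 1) ≤ δ * y m := by
  obtain ⟨⟨hy, hws⟩, hm⟩ := h
  have h0 := exploreObs_nonneg (K := K) hc hcs O t₀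
  set obs := exploreObs c s K ρ r t₀ with hobs
  have hφ := bestProfit_nonneg (sel := sel) hcs h0
  have hΔ := margin_nonneg M (e + 1)
  have hK0 : 0 < K := (bestIndex c s sel obs).pos
  have hK : (0 : ℝ) < K := by exact_mod_cast hK0
  by_contra hcon
  push Not at hcon
  have hw1 := le_testPrice (M := M) (sel := sel) hc hcs obs (e + 1) hy
  set w := testPrice c s sel M (e + 1) obs (y m) with hw
  set φ := bestProfit c s sel obs with hφd
  set Δ := margin M (e + 1) with hΔd
  have hweq : w = φ / y m + Δ / y m + s / K + c := by
    rw [hw, testPrice]; field_simp; ring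
  have hg : 0 < (s - c) / K := div_pos (by linarith) hK
  -- The first exploratory price at which the order `y m` would beat `φ`. It exceeds `φ / y m + c`
  -- by at most one grid step, which the summand `s / K` of the test price covers. If the margin
  -- exceeds `δ * y m`, it therefore lies at least `δ` below the test price, and the shift bound
  -- shows that it had attracted the order `y m`, against the maximality of `φ`.
  set k := ⌊φ / y m / ((s - c) / K)⌋₊ + 1 with hk
  have hk1 : φ / y m < k * ((s - c) / K) := by
    rw [← div_lt_iff₀ hg, hk]; push_cast; exact Nat.lt_floor_add_one _
  have hk2 : k * ((s - c) / K) ≤ φ / y m + (s - c) / K := by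
    have : ((⌊φ / y m / ((s - c) / K)⌋₊ : ℕ) : ℝ) ≤ φ / y m / ((s - c) / K) :=
      Nat.floor_le (by positivity)
    rw [le_div_iff₀ hg] at this
    rw [hk]; push_cast; linarith
  have hcK : 0 ≤ c / K := by positivity
  have hsK : (s - c) / K = s / K - c / K := sub_div _ _ _
  have hδ' : δ < Δ / y m := by rwa [lt_div_iff₀ hy]
  have hkw : k * ((s - c) / K) + c ≤ w - δ := by linarith
  have hw0 : 0 ≤ w := by have : 0 ≤ (φ + Δ) / y m := by positivity
                         linarith
  -- Strictness is needed for `k < K`. It comes from a positive margin or from `c / K > 0`; a zero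
  -- margin would force `M = 0`, and there is no level then.
  have hk3 : k * ((s - c) / K) < s - c := by
    have h1 : k * ((s - c) / K) ≤ s - c - Δ / y m := by linarith
    rcases hΔ.eq_or_lt with h2 | h2
    · rw [← h2] at hδ' hweq
      simp only [zero_div, add_zero] at hδ' hweq
      have hK1 : (s - c) / K ≤ s / K := by linarith
      rcases lt_or_ge (0 : ℝ) c with hc' | hc'
      · have : 0 < c / K := by positivity
        linarith
      · have hc0 : c = 0 := le_antisymm hc' hc
        by_contra hcon2
        push Not at hcon2
        have hM : (M : ℝ) = 0 := by
          by_contra hM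
          have : 0 < margin M (e + 1) := by
            unfold margin
            have : (0 : ℝ) < M := lt_of_le_of_ne (Nat.cast_nonneg M) (Ne.symm hM)
            positivity
          linarith
        have : M = 0 := by exact_mod_cast hM
        subst this
        exact m.elim0
    · have : 0 < Δ / y m := by positivity
      linarith
  have hkK : k < K := by
    have h1 : (k : ℝ) < K := by
      have h2 : (K : ℝ) * ((s - c) / K) = s - c := by field_simp
      exact lt_of_mul_lt_mul_right (by rw [h2]; exact hk3) hg.le
    exact_mod_cast h1
  have hprice : explorePrice c s (⟨k, hkK⟩ : Fin K) = k * ((s - c) / K) + c := rfl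
  have h1 : y m ≤ obs ⟨k, hkK⟩ := by
    refine hm.trans ?_
    have h2 := le_explorePrice hcs (⟨k, hkK⟩ : Fin K)
    exact O.round_mono hw0 hws (hc.trans h2) (explorePrice_lt hcs _).le
      (hδ ⟨k, hkK⟩ _ _ (hc.trans h2) (by rw [hprice]; exact hkw) hws)
  have h3 := le_bestProfit (c := c) (s := s) hsel obs ⟨k, hkK⟩
  rw [hprice] at h3
  rw [div_lt_iff₀ hy] at hk1
  have h4 : 0 ≤ (k : ℝ) * ((s - c) / K) := by positivity
  have h5 := mul_le_mul_of_nonneg_left h1 h4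
  linarith

/-- A surrogate price that ends an epoch detects a change of the orders. -/
theorem SurrogateTrigger.margin_le (hc : 0 ≤ c) (hcs : c < s)
    (O : Observed s b ε y ρ r) {t₀ e : ℕ} (h : SurrogateTrigger c s M sel ρ r t₀ e)
    {δ : ℝ} (hδ : ∀ k : Fin K, ShiftBound s r δ (t₀ + k) (t₀ + e))
    (h00 : ∀ (k : Fin K) w, 0 ≤ w → w ≤ s → r (t₀ + k) w ≤ r (t₀ + e) 0) :
    margin M (e + 1) ≤ δ * bestOrder c s sel (exploreObs c s K ρ r t₀) := by
  unfold SurrogateTrigger at h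
  have h0 := exploreObs_nonneg (K := K) hc hcs O t₀
  set obs := exploreObs c s K ρ r t₀ with hobs
  have hw0 := surrogatePrice_nonneg (c := c) (s := s) (sel := sel) (M := M) (e + 1) obs
  have hws := surrogatePrice_le (sel := sel) (M := M) hc hcs h0 (e + 1)
  have hy : 0 < bestOrder c s sel obs := (O.round_nonneg _ hw0 hws).trans_lt h
  by_contra hcon
  push Not at hcon
  rw [← lt_div_iff₀ hy] at hcon
  set k := bestIndex c s sel obs with hk
  have hk0 := hc.trans (le_explorePrice hcs k)
  have hks := (explorePrice_lt hcs k).le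
  refine absurd h (not_lt.2 ?_)
  change ρ (r (t₀ + k) (explorePrice c s k)) ≤ _
  refine O.round_mono hk0 hks hw0 hws ?_
  -- A surrogate price clipped at `0` need not be `δ` below the best exploratory price. The order at
  -- price `0` is compared through `h00` instead.
  rcases le_total (explorePrice c s k - margin M (e + 1) / bestOrder c s sel obs) 0 with h1 | h1
  · have h2 : surrogatePrice c s sel M (e + 1) obs = 0 := max_eq_right h1
    rw [h2]
    exact h00 k _ hk0 hks
  · have h2 : surrogatePrice c s sel M (e + 1) obs =
      explorePrice c s k - margin M (e + 1) / bestOrder c s sel obs := max_eq_left h1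
    exact hδ k _ _ hw0 (by rw [h2]; linarith) hks

theorem bestOrder_le (hc : 0 ≤ c) (hcs : c < s) (O : Observed s b ε y ρ r) (t₀ : ℕ) :
    bestOrder c s sel (exploreObs c s K ρ r t₀) ≤ b := by
  obtain ⟨m, hm⟩ := O.mem (t₀ + bestIndex c s sel (exploreObs c s K ρ r t₀))
    (explorePrice c s (bestIndex c s sel (exploreObs c s K ρ r t₀)))
    (hc.trans (le_explorePrice hcs _)) (explorePrice_lt hcs _).le
  exact hm.symm.le.trans (O.level_le m)

/-- Bound for the loss at a surrogate price below the unit cost. -/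
theorem surrogate_gap_le (hcs : c < s) {obs : Fin K → ℝ} (j : ℕ) :
    c - surrogatePrice c s sel M j obs ≤ margin M j / bestOrder c s sel obs := by
  have h1 : explorePrice c s (bestIndex c s sel obs) - margin M j / bestOrder c s sel obs
        ≤ surrogatePrice c s sel M j obs := le_max_left _ _
  linarith [le_explorePrice hcs (bestIndex c s sel obs)]

end Period


/-! ### Regret and the total variation of the orders -/

theorem ShiftBound.mono {s δ δ' : ℝ} {r : ℕ → ℝ → ℝ} {t t' : ℕ} (h : ShiftBound s r δ t t')
    (hδ : δ ≤ δ') : ShiftBound s r δ' t t' :=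
  fun w w' h0 hw hs => h w w' h0 (by linarith) hs

section Variation

variable {c s b ε : ℝ} {M K T : ℕ} {y : Fin M → ℝ} {sel : (Fin K → ℝ) → Fin K} {ρ : ℝ → ℝ}
  {r : ℕ → ℝ → ℝ}

/-- Regret of LUNA when the number of epochs is controlled by `Ψ`, in terms of the losses at
surrogate prices below the unit cost. -/
theorem regret_le_of_epochs_of_loss {C₃ G : ℝ} {Ψ : ℕ → ℝ} (hc : 0 ≤ c) (hcs : c < s) (hε : 0 ≤ ε)
    (hM : 0 < M) (hT : 1 ≤ T) (O : Observed s b ε y ρ r) (hC₃ : 0 ≤ C₃) (hG : 0 ≤ G)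
    (hΨ0 : ∀ t, t ≤ T → 0 ≤ Ψ t)
    (hΨ : ∀ t₀ e, K ≤ e → t₀ + e < T → (SurrogateTrigger c s M sel ρ r t₀ e ∨
      ∃ m, LevelTrigger c s y sel ρ r t₀ e m) → Ψ (t₀ + e + 1) + 1 ≤ Ψ t₀)
    (hloss : ∀ t₀ e, K ≤ e → t₀ + e < T → (∀ m, ¬ LevelTrigger c s y sel ρ r t₀ e m) →
      bestOrder c s sel (exploreObs c s K ρ r t₀) ≠ 0 →
      surrogatePrice c s sel M (e + 1) (exploreObs c s K ρ r t₀) < c →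
      (c - surrogatePrice c s sel M (e + 1) (exploreObs c s K ρ r t₀)) *
        r (t₀ + e) (surrogatePrice c s sel M (e + 1) (exploreObs c s K ρ r t₀)) ≤
      C₃ * margin M (e + 1) + G / (e + 1)) :
    (lunaRounded c s y sel ρ).regret c s r T ≤ T * (b * s / K + s * ε) +
      (1 + Ψ 0) * (s * b * K + s * b + G * (1 + Real.log T)) +
      6 * (s * b + (2 + C₃)) * √(M * (1 + Ψ 0) * T) := by
  have hb : 0 ≤ b := (O.nonneg 0 c hc hcs.le).trans (O.le 0 c hc hcs.le)
  have hs0 : 0 ≤ s := by linarith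
  refine regret_le_of_epochs hM hT (by positivity) (by positivity) (by positivity) hG hΨ0
    (fun t k => O.round_nonneg _ (hc.trans (le_explorePrice hcs _)) (explorePrice_lt hcs _).le)
    (fun t σ a h0 => ?_) hΨ fun t₀ e he heT _ hS hL => ?_
  · have h := lunaPrice_mem (y := y) (sel := sel) hc hcs σ h0 a
    exact periodRegret_le hc hcs (O.nonneg t) (O.le t) h.1 h.2
  · have hm := margin_nonneg M (e + 1)
    have h := periodRegret_surrogatePrice_le hc hcs hε O hS hL
      (loss := C₃ * margin M (e + 1) + G / (e + 1)) (by positivity) (hloss t₀ e he heT hL)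
    linarith

/-- An epoch of length `j` and variation `a` uses the shares `u = E a / V` and `v = E j / T` of two
budgets of total size `E`. The margin inequality says `M ≤ β² a² j`, which together with `hEV` gives
`u² v ≥ 1`; so `u + v < 1` is impossible. This is where the exponent `1 / 3` for the number of
epochs originates. -/
theorem one_le_of_margin_le {M j T : ℕ} {V E a β : ℝ} (hM : 0 < M) (hj : 0 < j) (hT : 0 < T)
    (hV : 0 < V) (hE : 0 < E) (ha : 0 ≤ a) (hEV : V ^ 2 * T * β ^ 2 ≤ E ^ 3 * M)
    (h : margin M j ≤ β * a) : 1 ≤ E / V * a + E / T * j := by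
  have hM' : (0 : ℝ) < M := by exact_mod_cast hM
  have hj' : (0 : ℝ) < j := by exact_mod_cast hj
  have hT' : (0 : ℝ) < T := by exact_mod_cast hT
  have h1 : (M : ℝ) / j ≤ (β * a) ^ 2 := Real.sqrt_le_iff.1 h |>.2
  rw [div_le_iff₀ hj'] at h1
  by_contra hcon
  push Not at hcon
  set u := E / V * a with hu
  set v := E / T * j with hv
  have hu0 : 0 ≤ u := by positivity
  have hv0 : 0 < v := by positivity
  have h2 : u ^ 2 * v < 1 := by nlinarith
  have h3 : u ^ 2 * v * (V ^ 2 * T) = E ^ 3 * (a ^ 2 * j) := by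
    rw [hu, hv]; field_simp
  have h4 : E ^ 3 * M ≤ E ^ 3 * ((β * a) ^ 2 * j) := mul_le_mul_of_nonneg_left h1 (by positivity)
  have h5 : E ^ 3 * ((β * a) ^ 2 * j) = u ^ 2 * v * (V ^ 2 * T * β ^ 2) := by
    linear_combination (-β ^ 2) * h3
  have h6 : 0 < V ^ 2 * T * β ^ 2 := by
    have : β ≠ 0 := by
      rintro rfl
      have : (M : ℝ) ≤ 0 := by simpa using h1
      linarith
    positivity
  nlinarith

/-- Regret of LUNA when the orders change by at most `s (A t' - A t)`, in terms of a shift of the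
price, between the periods `t` and `t'`. -/
theorem regret_le_of_variation {C₃ G V E : ℝ} {A : ℕ → ℝ} (hc : 0 ≤ c) (hcs : c < s) (hε : 0 ≤ ε)
    (hM : 0 < M) (hT : 1 ≤ T) (hsel : IsArgmaxRule sel) (O : Observed s b ε y ρ r) (hC₃ : 0 ≤ C₃)
    (hG : 0 ≤ G) (hA : Monotone A) (hA0 : A 0 = 0) (hV : 0 < V) (hAV : A T ≤ V) (hE : 0 < E)
    (hEV : V ^ 2 * T * (s * b) ^ 2 ≤ E ^ 3 * M)
    (hshift : ∀ t t', t ≤ t' → t' < T → ShiftBound s r (s * (A t' - A t)) t t' ∧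
      ShiftBound s r (s * (A t' - A t)) t' t)
    (hzero : ∀ t t' w, 1 ≤ t → t ≤ t' → t' < T → 0 ≤ w → w ≤ s → r t w ≤ r t' 0)
    (hloss : ∀ t₀ e, K ≤ e → t₀ + e < T → (∀ m, ¬ LevelTrigger c s y sel ρ r t₀ e m) →
      bestOrder c s sel (exploreObs c s K ρ r t₀) ≠ 0 →
      surrogatePrice c s sel M (e + 1) (exploreObs c s K ρ r t₀) < c →
      (c - surrogatePrice c s sel M (e + 1) (exploreObs c s K ρ r t₀)) *
        r (t₀ + e) (surrogatePrice c s sel M (e + 1) (exploreObs c s K ρ r t₀)) ≤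
      C₃ * margin M (e + 1) + G / (e + 1)) :
    (lunaRounded c s y sel ρ).regret c s r T ≤ T * (b * s / K + s * ε) +
      (2 + 2 * E) * (s * b * K + s * b + G * (1 + Real.log T)) +
      6 * (s * b + (2 + C₃)) * √(M * (2 + 2 * E) * T) := by
  have hT0 : (0 : ℝ) < T := by exact_mod_cast hT
  have hs0 : 0 ≤ s := by linarith
  -- Remaining variation and remaining time, each normalized to `E`. The extra unit at `t = 0` pays
  -- for the end of the first epoch: `hzero` says nothing about period `0`, whose fit uses no data.
  set Ψ : ℕ → ℝ := fun t => (if t = 0 then 1 else 0) + E / V * (V - A t) + E / T * (T - t) with hΨd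
  have hΨ00 : 1 + Ψ 0 = 2 + 2 * E := by
    simp only [hΨd, hA0, if_true]
    push_cast
    field_simp
    ring
  rw [← hΨ00]
  refine regret_le_of_epochs_of_loss hc hcs hε hM hT O hC₃ hG ?_ ?_ hloss
  · intro t ht
    have h1 := hA ht
    have h2 : (t : ℝ) ≤ T := by exact_mod_cast ht
    have h3 : 0 ≤ E / V * (V - A t) := mul_nonneg (by positivity) (by linarith)
    have h4 : 0 ≤ E / T * (T - t) := mul_nonneg (by positivity) (by linarith)
    simp only [hΨd]
    split_ifs <;> linarith
  · intro t₀ e he heT htr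
    have hmono : A t₀ ≤ A (t₀ + e + 1) := hA (by omega)
    have hdiff : Ψ t₀ - Ψ (t₀ + e + 1) = (if t₀ = 0 then 1 else 0) +
        E / V * (A (t₀ + e + 1) - A t₀) + E / T * ((e + 1 : ℕ) : ℝ) := by
      simp only [hΨd, Nat.add_eq_zero_iff, one_ne_zero, and_false, if_false]
      push_cast
      ring
    have hEV0 : 0 ≤ E / V * (A (t₀ + e + 1) - A t₀) := mul_nonneg (by positivity) (by linarith)
    have hET0 : 0 ≤ E / T * ((e + 1 : ℕ) : ℝ) := by positivity
    have hkey : margin M (e + 1) ≤ s * b * (A (t₀ + e + 1) - A t₀) →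
        Ψ (t₀ + e + 1) + 1 ≤ Ψ t₀ := by
      intro h
      have h1 := one_le_of_margin_le hM (Nat.succ_pos e) hT hV hE (by linarith) hEV h
      have h2 : (0 : ℝ) ≤ (if t₀ = 0 then 1 else 0) := by split_ifs <;> norm_num
      simp only [Nat.succ_eq_add_one] at h1
      linarith
    have hb : 0 ≤ b := (O.nonneg 0 c hc hcs.le).trans (O.le 0 c hc hcs.le)
    have hδ0 : s * (A (t₀ + e) - A t₀) ≤ s * (A (t₀ + e + 1) - A t₀) :=
      mul_le_mul_of_nonneg_left (sub_le_sub_right (hA (by omega)) _) hs0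
    have hδ1 : 0 ≤ s * (A (t₀ + e + 1) - A t₀) := mul_nonneg hs0 (by linarith)
    have hsh : ∀ k : Fin K, s * (A (t₀ + e) - A (t₀ + k)) ≤ s * (A (t₀ + e + 1) - A t₀) := by
      intro k
      refine le_trans (mul_le_mul_of_nonneg_left ?_ hs0) hδ0
      linarith [hA (show t₀ ≤ t₀ + (k : ℕ) by omega)]
    rcases htr with h | ⟨m, h⟩
    · rcases Nat.eq_zero_or_pos t₀ with h0 | h0
      · subst h0
        simp only [if_true] at hdiff
        linarith
      · have h1 := h.margin_le hc hcs O (δ := s * (A (t₀ + e + 1) - A t₀))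
          (fun k => (hshift (t₀ + k) (t₀ + e) (by omega) heT).1.mono (hsh k))
          (fun k w hw hws => hzero _ _ w (by omega) (by omega) heT hw hws)
        have h2 := bestOrder_le (K := K) (sel := sel) hc hcs O t₀
        apply hkey
        have h3 := mul_le_mul_of_nonneg_left h2 hδ1
        linarith
    · have h1 := h.margin_le hc hcs hsel O (δ := s * (A (t₀ + e + 1) - A t₀))
          (fun k => (hshift (t₀ + k) (t₀ + e) (by omega) heT).2.mono (hsh k))
      have h2 := O.level_le m
      apply hkey
      have h3 := mul_le_mul_of_nonneg_left h2 hδ1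
      linarith

/-! ### Losses at surrogate prices below the unit cost -/

/-- No large losses if the observed orders are `0` or at least `η`. -/
theorem surrogate_loss_le_of_order_ge (hc : 0 ≤ c) (hcs : c < s) (O : Observed s b ε y ρ r)
    {t₀ e : ℕ} {η : ℝ} (hη : 0 < η)
    (hy : η ≤ bestOrder c s sel (exploreObs c s K ρ r t₀)) :
    (c - surrogatePrice c s sel M (e + 1) (exploreObs c s K ρ r t₀)) *
        r (t₀ + e) (surrogatePrice c s sel M (e + 1) (exploreObs c s K ρ r t₀)) ≤
      b / η * margin M (e + 1) := by
  have h0 := exploreObs_nonneg (K := K) hc hcs O t₀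
  set obs := exploreObs c s K ρ r t₀ with hobs
  have hw0 := surrogatePrice_nonneg (c := c) (s := s) (sel := sel) (M := M) (e + 1) obs
  have hws := surrogatePrice_le (sel := sel) (M := M) hc hcs h0 (e + 1)
  have h1 := surrogate_gap_le (M := M) (sel := sel) hcs (obs := obs) (e + 1)
  have h2 : margin M (e + 1) / bestOrder c s sel obs ≤ margin M (e + 1) / η :=
    div_le_div_of_nonneg_left (margin_nonneg _ _) hη hy
  have h3 := O.nonneg (t₀ + e) _ hw0 hws
  have h4 := O.le (t₀ + e) _ hw0 hws
  have h5 : 0 ≤ margin M (e + 1) / η := div_nonneg (margin_nonneg _ _) hη.le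
  have h6 := mul_le_mul_of_nonneg_right (h1.trans h2) h3
  have h7 := mul_le_mul_of_nonneg_left h4 h5
  calc _ ≤ _ := h6
    _ ≤ _ := h7
    _ = _ := by ring

/-- No large losses in periods in which a positive profit is possible and no level test ends the
epoch. -/
theorem surrogate_loss_le_of_profit (hc : 0 ≤ c) (hcs : c < s) (O : Observed s b ε y ρ r)
    {t₀ e : ℕ} (hL : ∀ m, ¬ LevelTrigger c s y sel ρ r t₀ e m) {w₁ q₁ : ℝ} (hw₁ : c < w₁)
    (hw₁s : w₁ ≤ s) (hq₁ : 0 < q₁) (hr : q₁ ≤ r (t₀ + e) w₁) (hK : 2 * s / (w₁ - c) ≤ K) :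
    (c - surrogatePrice c s sel M (e + 1) (exploreObs c s K ρ r t₀)) *
        r (t₀ + e) (surrogatePrice c s sel M (e + 1) (exploreObs c s K ρ r t₀)) ≤
      4 * s * b / (q₁ * (w₁ - c)) * margin M (e + 1) := by
  have h0 := exploreObs_nonneg (K := K) hc hcs O t₀
  have hP := profit_le_of_not_levelTrigger hc hcs O hL hw₁.le hw₁s
  set obs := exploreObs c s K ρ r t₀ with hobs
  have hφ := bestProfit_nonneg (sel := sel) hcs h0
  have hΔ := margin_nonneg M (e + 1)
  have hw0 := surrogatePrice_nonneg (c := c) (s := s) (sel := sel) (M := M) (e + 1) obs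
  have hws := surrogatePrice_le (sel := sel) (M := M) hc hcs h0 (e + 1)
  have hd : 0 < w₁ - c := by linarith
  have hs0 : 0 < s := by linarith
  have hK0 : (0 : ℝ) < K := lt_of_lt_of_le (by positivity) hK
  have hρ : q₁ ≤ ρ (r (t₀ + e) w₁) :=
    hr.trans (O.le_round _ (O.nonneg _ _ (by linarith) hw₁s) (O.le _ _ (by linarith) hw₁s))
  have hq0 : 0 < ρ (r (t₀ + e) w₁) := hq₁.trans_le hρ
  -- The lower bound on `K` keeps the grid error below half of the profit at `w₁`.
  have h1 : ρ (r (t₀ + e) w₁) * s / K ≤ ρ (r (t₀ + e) w₁) * ((w₁ - c) / 2) := by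
    rw [mul_div_assoc]
    refine mul_le_mul_of_nonneg_left ?_ hq0.le
    rw [div_le_iff₀ hd] at hK
    rw [div_le_iff₀ hK0]
    linarith
  have h2 : q₁ * (w₁ - c) / 2 ≤ bestProfit c s sel obs + margin M (e + 1) := by
    have := mul_le_mul_of_nonneg_right hρ hd.le
    linarith
  have hrn := O.nonneg (t₀ + e) _ hw0 hws
  have hrb := O.le (t₀ + e) _ hw0 hws
  have hb : 0 ≤ b := hrn.trans hrb
  -- Either the margin is so large that the trivial loss `s b` is a multiple of it, or the best
  -- observed profit, hence also the best order, is bounded away from `0`.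
  rcases le_total (q₁ * (w₁ - c) / 4) (margin M (e + 1)) with h3 | h3
  · have h4 : (c - surrogatePrice c s sel M (e + 1) obs) *
        r (t₀ + e) (surrogatePrice c s sel M (e + 1) obs) ≤ s * b := by nlinarith
    have h5 : 1 ≤ 4 / (q₁ * (w₁ - c)) * margin M (e + 1) := by
      rw [div_mul_eq_mul_div, le_div_iff₀ (by positivity)]; linarith
    calc _ ≤ s * b := h4
      _ ≤ s * b * (4 / (q₁ * (w₁ - c)) * margin M (e + 1)) :=
        le_mul_of_one_le_right (by positivity) h5
      _ = _ := by ring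
  · have h4 : q₁ * (w₁ - c) / (4 * s) ≤ bestOrder c s sel obs := by
      have h5 := explorePrice_lt hcs (bestIndex c s sel obs)
      have h6 : bestProfit c s sel obs ≤ s * bestOrder c s sel obs := by
        rw [bestProfit_eq]
        exact mul_le_mul_of_nonneg_right (by linarith) (h0 _)
      rw [div_le_iff₀ (by positivity)]
      linarith
    have h5 := surrogate_loss_le_of_order_ge (e := e) (M := M) hc hcs O
      (by positivity) h4
    refine h5.trans (le_of_eq ?_)
    field_simp

end Variation

/-! ### Orders as quantiles -/

section Order

variable {s b : ℝ} {Ξ : Set ℝ} {F F' : ℝ → ℝ}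

/-- The infimum on the right is over a smaller set, which contains `b`; it is not the default value
of `sInf` at the empty set. -/
theorem order_le_order (hs : 0 < s) (hΞ : Ξ ⊆ Set.Icc 0 b) (hbΞ : b ∈ Ξ) (hb : F' b = 1)
    {w w' : ℝ} (h0 : 0 ≤ w') (h : ∀ q ∈ Ξ, 1 - w' / s ≤ F' q → 1 - w / s ≤ F q) :
    order Ξ F s w ≤ order Ξ F' s w' := by
  refine csInf_le_csInf ⟨0, fun q hq => (hΞ hq.1).1⟩ ⟨b, hbΞ, ?_⟩ fun q hq => ⟨hq.1, h q hq.1 hq.2⟩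
  rw [hb]
  have : 0 ≤ w' / s := by positivity
  linarith

theorem order_le_of_mem (hΞ : Ξ ⊆ Set.Icc 0 b) {w q : ℝ} (hq : q ∈ Ξ) (h : 1 - w / s ≤ F q) :
    order Ξ F s w ≤ q :=
  csInf_le ⟨0, fun _ hx => (hΞ hx.1).1⟩ ⟨hq, h⟩

theorem le_order (hs : 0 < s) (hbΞ : b ∈ Ξ) (hb : F b = 1) {w x : ℝ} (h0 : 0 ≤ w)
    (h : ∀ q ∈ Ξ, q < x → F q < 1 - w / s) : x ≤ order Ξ F s w := by
  refine le_csInf ⟨b, hbΞ, ?_⟩ fun q hq => ?_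
  · rw [hb]
    have : 0 ≤ w / s := by positivity
    linarith
  · by_contra hcon
    exact absurd hq.2 (not_le.2 (h q hq.1 (not_le.1 hcon)))

theorem order_nonneg (hΞ : Ξ ⊆ Set.Icc 0 b) (w : ℝ) : 0 ≤ order Ξ F s w :=
  Real.sInf_nonneg fun _ hq => (hΞ hq.1).1

theorem order_le (hs : 0 < s) (hΞ : Ξ ⊆ Set.Icc 0 b) (hbΞ : b ∈ Ξ) (hb : F b = 1) {w : ℝ}
    (h0 : 0 ≤ w) : order Ξ F s w ≤ b := by
  refine order_le_of_mem hΞ hbΞ ?_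
  rw [hb]
  have : 0 ≤ w / s := by positivity
  linarith

theorem order_anti (hs : 0 < s) (hΞ : Ξ ⊆ Set.Icc 0 b) (hbΞ : b ∈ Ξ) (hb : F b = 1) {w w' : ℝ}
    (h0 : 0 ≤ w) (h : w ≤ w') : order Ξ F s w' ≤ order Ξ F s w := by
  refine order_le_order hs hΞ hbΞ hb h0 fun q _ hq => ?_
  have : w / s ≤ w' / s := by gcongr
  linarith

/-- The price enters an order only through the threshold `1 - w / s`, so raising the distribution
function by `v` is compensated by lowering the price by `s * v`. -/
theorem order_shiftBound (hs : 0 < s) (hΞ : Ξ ⊆ Set.Icc 0 b) (hbΞ : b ∈ Ξ) {F : ℕ → ℝ → ℝ}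
    (hb : ∀ t, F t b = 1) {t t' : ℕ} {v : ℝ} (h : ∀ q ∈ Ξ, F t' q ≤ F t q + v) :
    ShiftBound s (fun t w => order Ξ (F t) s w) (s * v) t t' := by
  intro w w' h0 hw _
  refine order_le_order hs hΞ hbΞ (hb t') h0 fun q hq hF => ?_
  have h1 : w' / s ≤ w / s - v := by
    rw [div_le_iff₀ hs, sub_mul, div_mul_cancel₀ _ hs.ne']
    linarith
  linarith [h q hq]

theorem abs_sub_le_sum {F : ℕ → ℝ} {a : ℕ → ℝ} {t t' : ℕ}
    (htt : t ≤ t') (h : ∀ i, i < t' → |F (i + 1) - F i| ≤ a i) : |F t' - F t| ≤ ∑ i ∈ Finset.range t', a i - ∑ i ∈ Finset.range t, a i := by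
  induction t', htt using Nat.le_induction with
  | base => simp
  | succ n hn ih =>
    rw [Finset.sum_range_succ]
    have h1 := h n (Nat.lt_succ_self n)
    have ih := ih fun i hi => h i (by omega)
    have h2 : F (n + 1) - F t = (F (n + 1) - F n) + (F n - F t) := by ring
    rw [h2]
    linarith [abs_add_le (F (n + 1) - F n) (F n - F t)]

end Order


/-! ### Rounding -/

section Round

variable {b : ℝ} {N : ℕ}

theorem level_le (hb : 0 ≤ b) (hN : 2 ≤ N) (n : Fin N) : level b n ≤ b := by
  have h2 : (2 : ℝ) ≤ N := by exact_mod_cast hN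
  have h1 : (n : ℝ) + 1 ≤ N := by exact_mod_cast n.isLt
  unfold level
  rw [div_le_iff₀ (by linarith), mul_comm]
  exact mul_le_mul_of_nonneg_left (by linarith) hb

theorem level_last (hN : 2 ≤ N) : level b (⟨N - 1, by omega⟩ : Fin N) = b := by
  have h2 : (2 : ℝ) ≤ N := by exact_mod_cast hN
  have h3 : (N : ℝ) - 1 ≠ 0 := by linarith
  unfold level
  simp only
  rw [Nat.cast_sub (by omega), Nat.cast_one]
  field_simp

theorem roundUp_set_nonempty (hN : 2 ≤ N) {q : ℝ} (hq : q ≤ b) :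
    {x | x ∈ Set.range (level b : Fin N → ℝ) ∧ q ≤ x}.Nonempty :=
  ⟨b, ⟨⟨_, level_last hN⟩, hq⟩⟩

theorem roundUp_mem_set (hN : 2 ≤ N) {q : ℝ} (hq : q ≤ b) :
    roundUp b N q ∈ {x | x ∈ Set.range (level b : Fin N → ℝ) ∧ q ≤ x} :=
  (roundUp_set_nonempty hN hq).csInf_mem ((Set.finite_range _).subset fun _ hx => hx.1)

theorem roundUp_le_of_mem {q x : ℝ} (hx : x ∈ Set.range (level b : Fin N → ℝ)) (hq : q ≤ x) :
    roundUp b N q ≤ x :=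
  csInf_le ((Set.finite_range _).subset fun _ hx => hx.1 : Set.Finite _).bddBelow ⟨hx, hq⟩

theorem roundUp_mono (hN : 2 ≤ N) {p q : ℝ} (hpq : p ≤ q) (hq : q ≤ b) :
    roundUp b N p ≤ roundUp b N q :=
  roundUp_le_of_mem (roundUp_mem_set hN hq).1 (hpq.trans (roundUp_mem_set hN hq).2)

theorem roundUp_nonneg (hb : 0 ≤ b) (hN : 1 ≤ N) (q : ℝ) : 0 ≤ roundUp b N q := by
  refine Real.sInf_nonneg ?_
  rintro _ ⟨⟨n, rfl⟩, _⟩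
  have : (1 : ℝ) ≤ N := by exact_mod_cast hN
  exact div_nonneg (by positivity) (by linarith)

theorem roundUp_zero (hb : 0 ≤ b) (hN : 1 ≤ N) : roundUp b N 0 = 0 :=
  le_antisymm (roundUp_le_of_mem ⟨⟨0, hN⟩, by simp [level]⟩ le_rfl) (roundUp_nonneg hb hN 0)

/-- Otherwise the preceding level would also be at least `q`. -/
theorem roundUp_le_add (hb : 0 ≤ b) (hN : 2 ≤ N) {q : ℝ} (h0 : 0 ≤ q) (hq : q ≤ b) :
    roundUp b N q ≤ q + b / ((N : ℝ) - 1) := by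
  have h2 : (2 : ℝ) ≤ N := by exact_mod_cast hN
  have h3 : 0 ≤ b / ((N : ℝ) - 1) := div_nonneg hb (by linarith)
  obtain ⟨⟨n, hn⟩, hqn⟩ := roundUp_mem_set hN hq
  by_contra hcon
  push Not at hcon
  rw [← hn] at hcon
  rcases Nat.eq_zero_or_pos (n : ℕ) with h | h
  · have : level b n = 0 := by simp [level, h]
    linarith
  · have h4 : level b (⟨n - 1, by omega⟩ : Fin N) = level b n - b / ((N : ℝ) - 1) := by
      unfold level
      simp only
      rw [Nat.cast_sub (by omega), Nat.cast_one]
      ring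
    have h5 : roundUp b N q ≤ level b (⟨n - 1, by omega⟩ : Fin N) :=
      roundUp_le_of_mem ⟨_, rfl⟩ (by rw [h4]; linarith)
    rw [← hn, h4] at h5
    have h6 : 0 < level b n := by linarith
    have h7 : b / ((N : ℝ) - 1) = 0 := by linarith
    unfold level at h6
    rw [mul_div_assoc, h7, mul_zero] at h6
    exact lt_irrefl _ h6

/-- The lowest level is `0`, so a positive rounded order is at least one step. This bounds `y*` from
below for every demand distribution. -/
theorem le_roundUp_of_pos (hb : 0 ≤ b) (hN : 2 ≤ N) {q : ℝ} (hq : q ≤ b)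
    (hpos : 0 < roundUp b N q) : b / ((N : ℝ) - 1) ≤ roundUp b N q := by
  have h2 : (2 : ℝ) ≤ N := by exact_mod_cast hN
  have h3 : 0 ≤ b / ((N : ℝ) - 1) := div_nonneg hb (by linarith)
  obtain ⟨⟨n, hn⟩, hqn⟩ := roundUp_mem_set hN hq
  rw [← hn] at hpos ⊢
  have h1 : 1 ≤ (n : ℕ) := by
    by_contra h
    have h0 : (n : ℕ) = 0 := by omega
    simp [level, h0] at hpos
  have h4 : (1 : ℝ) ≤ (n : ℝ) := by exact_mod_cast h1
  unfold level
  rw [mul_div_assoc]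
  exact le_mul_of_one_le_left h3 h4

end Round

/-! ### Quantile orders, rounded or on a finite support, as instances of `Observed` -/

section ObservedInstances

variable {c s b : ℝ}

theorem observed_roundUp {N : ℕ} {F : ℕ → ℝ → ℝ} (hs : 0 < s) (hb : 0 ≤ b) (hN : 2 ≤ N)
    (hF : ∀ t, F t b = 1) :
    Observed s b (b / ((N : ℝ) - 1)) (level b : Fin N → ℝ) (roundUp b N)
      (fun t w => order (Set.Icc 0 b) (F t) s w) where
  nonneg _ w _ _ := order_nonneg subset_rfl w
  le t _ h0 _ := order_le hs subset_rfl ⟨hb, le_rfl⟩ (hF t) h0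
  anti t _ _ h0 h _ := order_anti hs subset_rfl ⟨hb, le_rfl⟩ (hF t) h0 h
  mono _ _ _ h hq := roundUp_mono hN h hq
  le_round _ _ h := (roundUp_mem_set hN h).2
  round_le _ h0 h := roundUp_le_add hb hN h0 h
  mem t _ h0 _ := (roundUp_mem_set hN (order_le hs subset_rfl ⟨hb, le_rfl⟩ (hF t) h0)).1
  level_le := level_le hb hN

theorem order_mem_of_finite {Ξ : Set ℝ} {F : ℝ → ℝ} (hs : 0 < s) (hfin : Ξ.Finite) (hbΞ : b ∈ Ξ)
    (hF : F b = 1) {w : ℝ} (h0 : 0 ≤ w) : order Ξ F s w ∈ {q | q ∈ Ξ ∧ 1 - w / s ≤ F q} := by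
  refine Set.Nonempty.csInf_mem ⟨b, hbΞ, ?_⟩ (hfin.subset fun _ hx => hx.1)
  rw [hF]
  have : 0 ≤ w / s := by positivity
  linarith

theorem observed_range {M : ℕ} {y : Fin M → ℝ} {F : ℕ → ℝ → ℝ} (hs : 0 < s)
    (hy : ∀ m, 0 ≤ y m) (hb : IsGreatest (Set.range y) b) (hF : ∀ t, F t b = 1) :
    Observed s b 0 y id (fun t w => order (Set.range y) (F t) s w) := by
  have hΞ : Set.range y ⊆ Set.Icc 0 b := by
    rintro _ ⟨m, rfl⟩
    exact ⟨hy m, hb.2 ⟨m, rfl⟩⟩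
  exact
    { nonneg := fun _ w _ _ => order_nonneg hΞ w
      le := fun t _ h0 _ => order_le hs hΞ hb.1 (hF t) h0
      anti := fun t _ _ h0 h _ => order_anti hs hΞ hb.1 (hF t) h0 h
      mono := fun _ _ _ h _ => h
      le_round := fun _ _ _ => le_rfl
      round_le := fun _ _ _ => (add_zero _).symm.le
      mem := fun t _ h0 _ => (order_mem_of_finite hs (Set.finite_range y) hb.1 (hF t) h0).1
      level_le := fun m => hb.2 ⟨m, rfl⟩ }

end ObservedInstances

/-! ### A trivial bound for the regret -/

/-- The predicate `I` is an invariant of the memory: for LUNA, prices are guaranteed to stay in `[0,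
s]` only if the recorded orders are nonnegative. -/
theorem PricingPolicy.regretFrom_le {S A : Type} [Fintype A] (π : PricingPolicy S A) {c s R : ℝ}
    {r : ℕ → ℝ → ℝ} (I : S → Prop) (hI : ∀ t σ a, I σ → I (π.next σ a (r t (π.price σ a))))
    (hR : ∀ t σ a, I σ → periodRegret c s (r t) (π.price σ a) ≤ R) (n : ℕ) :
    ∀ t σ, I σ → π.regretFrom c s r n t σ ≤ n * R := by
  induction n with
  | zero => intro t σ _; simp [PricingPolicy.regretFrom]
  | succ n ih =>
    intro t σ hσ
    have h : π.regretFrom c s r (n + 1) t σ ≤ ∑ a, π.draw σ a * (R + n * R) := by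
      unfold PricingPolicy.regretFrom
      exact Finset.sum_le_sum fun a _ => mul_le_mul_of_nonneg_left
        (add_le_add (hR t σ a hσ) (ih _ _ (hI t σ a hσ))) (π.draw_nonneg σ a)
    rw [← Finset.sum_mul, π.draw_sum, one_mul] at h
    push_cast
    linarith

theorem lunaRounded_regret_le {c s b : ℝ} {M K T : ℕ} {y : Fin M → ℝ} {sel : (Fin K → ℝ) → Fin K}
    {ρ : ℝ → ℝ} {r : ℕ → ℝ → ℝ} (hc : 0 ≤ c) (hcs : c < s)
    (hr : ∀ t w, 0 ≤ w → w ≤ s → 0 ≤ r t w) (hrb : ∀ t w, 0 ≤ w → w ≤ s → r t w ≤ b)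
    (hρ : ∀ t w, 0 ≤ w → w ≤ s → 0 ≤ ρ (r t w)) :
    (lunaRounded c s y sel ρ).regret c s r T ≤ T * (s * b) := by
  refine PricingPolicy.regretFrom_le _ (fun σ => ∀ k, 0 ≤ σ.obs k) ?_ ?_ T 0 _ fun _ => le_rfl
  · intro t σ a hσ k
    have h := lunaPrice_mem (y := y) (sel := sel) hc hcs σ hσ a
    have h1 : 0 ≤ ρ (r t (lunaPrice c s y sel σ a)) := hρ _ _ h.1 h.2
    change 0 ≤ (lunaNext c s y sel σ a (ρ (r t (lunaPrice c s y sel σ a)))).obs k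
    unfold lunaNext
    split_ifs with h2 h3
    · rcases eq_or_ne k ⟨σ.elapsed, h2⟩ with rfl | hne
      · simpa using h1
      · simpa [Function.update_of_ne hne] using hσ k
    · exact le_rfl
    · exact hσ k
  · intro t σ a hσ
    have h := lunaPrice_mem (y := y) (sel := sel) hc hcs σ hσ a
    exact periodRegret_le hc hcs (hr t) (hrb t) h.1 h.2


/-! ### The parameters of the policies in terms of the horizon -/

section Numerics

theorem ceil_le_two_mul {z : ℝ} (hz : 1 ≤ z) : (⌈z⌉₊ : ℝ) ≤ 2 * z := by
  have := Nat.ceil_lt_add_one (by linarith : 0 ≤ z)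
  linarith

/-- Turns the fractional powers of the horizon into natural powers of `x`. -/
theorem rpow_mul_pow {b x : ℝ} (hb : 0 < b) (hx : 0 < x) (p : ℝ) (n : ℕ) {m : ℕ} {u : ℝ}
    (hu : u * m = n) : b ^ p * (b * x ^ m) ^ u = b ^ (p + u) * x ^ n := by
  rw [Real.mul_rpow hb.le (by positivity), ← mul_assoc, ← Real.rpow_add hb,
    ← Real.rpow_natCast x m, ← Real.rpow_mul hx.le, mul_comm (m : ℝ) u, hu, Real.rpow_natCast]

/-- The exponent `12` clears the denominators `3` and `4` of all rates and grid sizes. -/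
theorem exists_scale {b : ℝ} {T : ℕ} (hb : 0 < b) (hT : b < T) :
    ∃ x : ℝ, 1 < x ∧ (T : ℝ) = b * x ^ 12 := by
  have h1 : 1 < (T : ℝ) / b := by rwa [one_lt_div hb]
  refine ⟨((T : ℝ) / b) ^ (1 / 12 : ℝ), Real.one_lt_rpow h1 (by norm_num), ?_⟩
  rw [← Real.rpow_natCast, ← Real.rpow_mul (by positivity)]
  norm_num
  field_simp

variable {b x : ℝ} {T : ℕ}

theorem gridSize_eq (hb : 0 < b) (hx : 1 < x) (hT : (T : ℝ) = b * x ^ 12) :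
    gridSize b T = ⌈x ^ 4⌉₊ := by
  have hx0 : 0 < x := by linarith
  unfold gridSize
  rw [hT, rpow_mul_pow hb hx0 _ 4 (by norm_num)]
  norm_num

theorem levelCount_eq (hb : 0 < b) (hx : 1 < x) (hT : (T : ℝ) = b * x ^ 12) :
    levelCount b T = ⌈x ^ 3⌉₊ := by
  have hx0 : 0 < x := by linarith
  unfold levelCount
  rw [hT, rpow_mul_pow hb hx0 _ 3 (by norm_num)]
  norm_num

theorem two_le_levelCount (hb : 0 < b) (hT : b < T) : 2 ≤ levelCount b T := by
  obtain ⟨x, hx, hTx⟩ := exists_scale hb hT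
  rw [levelCount_eq hb hx hTx, Nat.succ_le_iff, Nat.lt_ceil]
  exact_mod_cast one_lt_pow₀ hx (by norm_num)

theorem rate_eq (hb : 0 < b) (hx : 1 < x) (hT : (T : ℝ) = b * x ^ 12) :
    b ^ (5 / 4 : ℝ) * (T : ℝ) ^ (3 / 4 : ℝ) = b ^ 2 * x ^ 9 := by
  rw [hT, rpow_mul_pow hb (by linarith) _ 9 (by norm_num)]
  norm_num

theorem luna_rate_eq (hb : 0 < b) (hx : 1 < x) (hT : (T : ℝ) = b * x ^ 12) :
    b ^ (4 / 3 : ℝ) * (T : ℝ) ^ (2 / 3 : ℝ) = b ^ 2 * x ^ 8 := by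
  rw [hT, rpow_mul_pow hb (by linarith) _ 8 (by norm_num)]
  norm_num

/-- For horizons up to `b`, the trivial bound `s b` per period is within the rate. -/
theorem trivial_rate_le {b : ℝ} (hb : 0 < b) (hT : (T : ℝ) ≤ b) :
    (T : ℝ) * b ≤ b ^ (5 / 4 : ℝ) * (T : ℝ) ^ (3 / 4 : ℝ) := by
  have hT0 : (0 : ℝ) ≤ T := Nat.cast_nonneg T
  rcases hT0.eq_or_lt with h | h
  · rw [← h, zero_mul]; positivity
  have h1 : (T : ℝ) = (T : ℝ) ^ (1 / 4 : ℝ) * (T : ℝ) ^ (3 / 4 : ℝ) := by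
    rw [← Real.rpow_add h]; norm_num
  have h2 : b ^ (5 / 4 : ℝ) = b ^ (1 / 4 : ℝ) * b := by
    nth_rewrite 3 [← Real.rpow_one b]
    rw [← Real.rpow_add hb]; norm_num
  have h3 : (T : ℝ) ^ (1 / 4 : ℝ) ≤ b ^ (1 / 4 : ℝ) := Real.rpow_le_rpow h.le hT (by norm_num)
  calc (T : ℝ) * b = (T : ℝ) ^ (1 / 4 : ℝ) * ((T : ℝ) ^ (3 / 4 : ℝ) * b) := by
        nth_rewrite 1 [h1]; ring
    _ ≤ b ^ (1 / 4 : ℝ) * ((T : ℝ) ^ (3 / 4 : ℝ) * b) := by gcongr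
    _ = _ := by rw [h2]; ring

theorem luna_trivial_rate_le {b : ℝ} (hb : 0 < b) {M : ℕ} (hT : (T : ℝ) ≤ b * M) :
    (T : ℝ) * b ≤ b ^ (4 / 3 : ℝ) * (M : ℝ) ^ (1 / 3 : ℝ) * (T : ℝ) ^ (2 / 3 : ℝ) := by
  have hT0 : (0 : ℝ) ≤ T := Nat.cast_nonneg T
  rcases hT0.eq_or_lt with h | h
  · rw [← h, zero_mul]; positivity
  have h1 : (T : ℝ) = (T : ℝ) ^ (1 / 3 : ℝ) * (T : ℝ) ^ (2 / 3 : ℝ) := by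
    rw [← Real.rpow_add h]; norm_num
  have h2 : b ^ (4 / 3 : ℝ) = b ^ (1 / 3 : ℝ) * b := by
    nth_rewrite 3 [← Real.rpow_one b]
    rw [← Real.rpow_add hb]; norm_num
  have h3 : (T : ℝ) ^ (1 / 3 : ℝ) ≤ b ^ (1 / 3 : ℝ) * (M : ℝ) ^ (1 / 3 : ℝ) := by
    rw [← Real.mul_rpow hb.le (Nat.cast_nonneg M)]
    exact Real.rpow_le_rpow h.le hT (by norm_num)
  calc (T : ℝ) * b = (T : ℝ) ^ (1 / 3 : ℝ) * ((T : ℝ) ^ (2 / 3 : ℝ) * b) := by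
        nth_rewrite 1 [h1]; ring
    _ ≤ (b ^ (1 / 3 : ℝ) * (M : ℝ) ^ (1 / 3 : ℝ)) * ((T : ℝ) ^ (2 / 3 : ℝ) * b) := by gcongr
    _ = _ := by rw [h2]; ring

/-- The regret bound of LUNAC, simplified. -/
theorem lunac_rate {s b x q₀ K N L l E G C₃ c₃ D C_G : ℝ} (hs : 0 < s) (hq₀ : 0 < q₀) (hb : q₀ ≤ b)
    (hx : 1 ≤ x) (hK : x ^ 4 ≤ K) (hK2 : K ≤ 2 * x ^ 4) (hN : x ^ 3 ≤ N) (hN2 : N ≤ 2 * x ^ 3)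
    (hN1 : 2 ≤ N) (hl : 0 ≤ l) (hlL : l ≤ L) (hL : 1 ≤ L) (hE : 0 ≤ E)
    (hED : E ≤ D * L * (b * x ^ 3)) (hD : 0 ≤ D) (hG : E * G ≤ C_G * L ^ 2 * (b ^ 2 * x ^ 9))
    (hCG : 0 ≤ C_G) (hC₃ : C₃ ≤ c₃ * b) (hc₃ : 0 ≤ c₃) :
    b * x ^ 12 * (b * s / K + s * (b / (N - 1))) + E * (s * b * K + s * b + G * l) +
      6 * (s * b + (2 + C₃)) * √(N * E * (b * x ^ 12)) ≤
      (3 * s + 3 * s * D + C_G + 6 * (s + 2 / q₀ + c₃) * (1 + 2 * D)) * L ^ 3 *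
        (b ^ 2 * x ^ 9) := by
  have hb0 : 0 < b := by linarith
  have hx0 : 0 < x := by linarith
  have hK0 : 0 < K := lt_of_lt_of_le (by positivity) hK
  set B := b ^ 2 * x ^ 9 with hB
  have hB0 : 0 < B := by positivity
  have hL2 : L ≤ L ^ 3 := le_self_pow₀ hL (by norm_num)
  have hL3 : L ^ 2 ≤ L ^ 3 := pow_le_pow_right₀ hL (by norm_num)
  have hL1 : 1 ≤ L ^ 3 := one_le_pow₀ hL
  have h1 : b * x ^ 12 * (b * s / K) ≤ s * B := by
    have h2 : b * s / K ≤ b * s / x ^ 4 := by gcongr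
    calc b * x ^ 12 * (b * s / K) ≤ b * x ^ 12 * (b * s / x ^ 4) := by gcongr
      _ = s * (b ^ 2 * x ^ 8) := by field_simp
      _ ≤ s * B := by
        rw [hB]; gcongr
        norm_num
  -- The rounding error: this term and the square root below are the ones of full order `x ^ 9`,
  -- balanced by `N` of order `x ^ 3`.
  have h2 : b * x ^ 12 * (s * (b / (N - 1))) ≤ 2 * s * B := by
    have h3 : b / (N - 1) ≤ b / (x ^ 3 / 2) := by
      gcongr; linarith
    calc b * x ^ 12 * (s * (b / (N - 1))) ≤ b * x ^ 12 * (s * (b / (x ^ 3 / 2))) := by gcongr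
      _ = 2 * s * B := by rw [hB]; field_simp
  have h3 : E * (s * b * K + s * b) ≤ 3 * s * D * L * B := by
    have h4 : s * b * K + s * b ≤ 3 * s * b * x ^ 4 := by
      have h5 := mul_le_mul_of_nonneg_left hK2 (by positivity : 0 ≤ s * b)
      have h6 := mul_le_mul_of_nonneg_left (one_le_pow₀ hx : 1 ≤ x ^ 4) (by positivity : 0 ≤ s * b)
      linarith
    calc E * (s * b * K + s * b) ≤ (D * L * (b * x ^ 3)) * (3 * s * b * x ^ 4) := by
          gcongr
      _ = 3 * s * D * L * (b ^ 2 * x ^ 7) := by ring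
      _ ≤ 3 * s * D * L * B := by
        rw [hB]; gcongr
        norm_num
  have h4 : E * (G * l) ≤ C_G * L ^ 3 * B := by
    calc E * (G * l) = E * G * l := by ring
      _ ≤ C_G * L ^ 2 * B * l := by gcongr
      _ ≤ C_G * L ^ 2 * B * L := by gcongr
      _ = _ := by ring
  have h5 : √(N * E * (b * x ^ 12)) ≤ b * x ^ 9 * ((1 + 2 * D) * L) := by
    apply Real.sqrt_le_iff.2
    refine ⟨by positivity, ?_⟩
    have h6 : 2 * D * L ≤ ((1 + 2 * D) * L) ^ 2 := by
      have : 1 ≤ (1 + 2 * D) * L := by nlinarith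
      nlinarith
    calc N * E * (b * x ^ 12) ≤ (2 * x ^ 3) * (D * L * (b * x ^ 3)) * (b * x ^ 12) := by gcongr
      _ = (b * x ^ 9) ^ 2 * (2 * D * L) := by ring
      _ ≤ (b * x ^ 9) ^ 2 * ((1 + 2 * D) * L) ^ 2 := by gcongr
      _ = _ := by ring
  have h6 : s * b + (2 + C₃) ≤ (s + 2 / q₀ + c₃) * b := by
    have : 2 ≤ 2 / q₀ * b := by rw [div_mul_eq_mul_div, le_div_iff₀ hq₀]; linarith
    linarith
  have h7 : 6 * (s * b + (2 + C₃)) * √(N * E * (b * x ^ 12)) ≤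
      6 * (s + 2 / q₀ + c₃) * (1 + 2 * D) * L * B := by
    calc _ ≤ 6 * ((s + 2 / q₀ + c₃) * b) * (b * x ^ 9 * ((1 + 2 * D) * L)) := by gcongr
      _ = _ := by rw [hB]; ring
  have h8 : 3 * s * B ≤ 3 * s * L ^ 3 * B := by
    have := mul_le_mul_of_nonneg_left hL1 (by positivity : 0 ≤ 3 * s * B)
    linarith
  have h9 : 3 * s * D * L * B ≤ 3 * s * D * L ^ 3 * B := by gcongr
  have h10 : 6 * (s + 2 / q₀ + c₃) * (1 + 2 * D) * L * B ≤
      6 * (s + 2 / q₀ + c₃) * (1 + 2 * D) * L ^ 3 * B := by gcongr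
  linarith

/-- The regret bound of LUNA, simplified. -/
theorem luna_rate {s b x η K m L l E D : ℝ} (hs : 0 < s) (hη : 0 < η) (hb : η ≤ b)
    (hx : 1 ≤ x) (hK : x ^ 4 ≤ K) (hK2 : K ≤ 2 * x ^ 4) (hm : 1 ≤ m) (hmx : m ≤ x ^ 4)
    (hL : 1 ≤ L) (hE : E * m = D * L * (b * x ^ 4)) (hD : 0 ≤ D) :
    b * x ^ 12 * (b * s / K + s * 0) + (2 + 2 * E) * (s * b * K + s * b + 0 * l) +
      6 * (s * b + (2 + b / η)) * √(m ^ 3 * (2 + 2 * E) * (b * x ^ 12)) ≤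
      (s + 6 * s / η + 6 * s * D + 6 * (s + 3 / η) * (1 + 2 / η + 2 * D)) * L *
        (b ^ 2 * x ^ 8 * m) := by
  have hb0 : 0 < b := by linarith
  have hx0 : 0 < x := by linarith
  have hm0 : 0 < m := by linarith
  have hK0 : 0 < K := lt_of_lt_of_le (by positivity) hK
  have hE0 : 0 ≤ E := by
    have : 0 ≤ E * m := by rw [hE]; positivity
    exact nonneg_of_mul_nonneg_left this hm0
  set B := b ^ 2 * x ^ 8 * m with hB
  have hB0 : 0 < B := by positivity
  have hbη : 1 ≤ b / η := by rwa [one_le_div hη]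
  have h1 : b * x ^ 12 * (b * s / K) ≤ s * B := by
    have h2 : b * s / K ≤ b * s / x ^ 4 := by gcongr
    calc b * x ^ 12 * (b * s / K) ≤ b * x ^ 12 * (b * s / x ^ 4) := by gcongr
      _ = s * (b ^ 2 * x ^ 8) := by field_simp
      _ ≤ s * B := by
        rw [hB]
        exact mul_le_mul_of_nonneg_left (le_mul_of_one_le_right (by positivity) hm) hs.le
  have hEm : E ≤ D * L * (b * x ^ 4) := by
    rw [← hE]; exact le_mul_of_one_le_right hE0 hm
  have h3 : (2 + 2 * E) * (s * b * K + s * b) ≤ 6 * s / η * B + 6 * s * D * L * B := by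
    have h4 : s * b * K + s * b ≤ 3 * s * b * x ^ 4 := by
      have h5 := mul_le_mul_of_nonneg_left hK2 (by positivity : 0 ≤ s * b)
      have h6 := mul_le_mul_of_nonneg_left (one_le_pow₀ hx : 1 ≤ x ^ 4) (by positivity : 0 ≤ s * b)
      linarith
    have h5 : 3 * s * b * x ^ 4 ≤ 3 * s / η * B := by
      have h6 : x ^ 4 ≤ x ^ 8 := pow_le_pow_right₀ hx (by norm_num)
      calc 3 * s * b * x ^ 4 = 3 * s * b * (1 * x ^ 4 * 1) := by ring
        _ ≤ 3 * s * b * (b / η * x ^ 8 * m) := by gcongr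
        _ = _ := by rw [hB]; ring
    have h6 : E * (3 * s * b * x ^ 4) ≤ 3 * s * D * L * B := by
      calc E * (3 * s * b * x ^ 4) ≤ D * L * (b * x ^ 4) * (3 * s * b * x ^ 4) := by gcongr
        _ = 3 * s * D * L * (b ^ 2 * x ^ 8 * 1) := by ring
        _ ≤ _ := by rw [hB]; gcongr
    have h7 := mul_le_mul_of_nonneg_left h4 (by positivity : 0 ≤ 2 + 2 * E)
    have h8 : 6 * s / η * B = 2 * (3 * s / η * B) := by ring
    linarith
  have h5 : √(m ^ 3 * (2 + 2 * E) * (b * x ^ 12)) ≤ b * x ^ 8 * m * ((1 + 2 / η + 2 * D) * L) := by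
    apply Real.sqrt_le_iff.2
    refine ⟨by positivity, ?_⟩
    have h6 : 2 / η + 2 * D * L ≤ ((1 + 2 / η + 2 * D) * L) ^ 2 := by
      have h0 : 0 ≤ 2 / η := by positivity
      have h7 : 1 ≤ (1 + 2 / η + 2 * D) * L := by nlinarith
      have h8 : 2 / η + 2 * D * L ≤ (1 + 2 / η + 2 * D) * L := by nlinarith
      nlinarith
    -- The epochs that are present without any variation fit the rate only because `m ≤ x ^ 4`, that
    -- is, `b * M ≤ T`.
    have h7 : 2 * m ^ 3 * (b * x ^ 12) ≤ (b * x ^ 8 * m) ^ 2 * (2 / η) := by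
      calc 2 * m ^ 3 * (b * x ^ 12) = 2 * m ^ 2 * (b * x ^ 12) * m * 1 := by ring
        _ ≤ 2 * m ^ 2 * (b * x ^ 12) * x ^ 4 * (b / η) := by gcongr
        _ = _ := by ring
    calc m ^ 3 * (2 + 2 * E) * (b * x ^ 12) =
          2 * m ^ 3 * (b * x ^ 12) + 2 * m ^ 2 * (E * m) * (b * x ^ 12) := by ring
      _ ≤ (b * x ^ 8 * m) ^ 2 * (2 / η) + 2 * m ^ 2 * (D * L * (b * x ^ 4)) * (b * x ^ 12) := by
        rw [hE]; gcongr
      _ = (b * x ^ 8 * m) ^ 2 * (2 / η + 2 * D * L) := by ring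
      _ ≤ (b * x ^ 8 * m) ^ 2 * ((1 + 2 / η + 2 * D) * L) ^ 2 := by gcongr
      _ = _ := by ring
  have h6 : s * b + (2 + b / η) ≤ (s + 3 / η) * b := by
    have : (s + 3 / η) * b = s * b + 3 * (b / η) := by ring
    linarith
  have h7 : 6 * (s * b + (2 + b / η)) * √(m ^ 3 * (2 + 2 * E) * (b * x ^ 12)) ≤
      6 * (s + 3 / η) * (1 + 2 / η + 2 * D) * L * B := by
    calc _ ≤ 6 * ((s + 3 / η) * b) * (b * x ^ 8 * m * ((1 + 2 / η + 2 * D) * L)) := by gcongr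
      _ = _ := by rw [hB]; ring
  have h8 : s * B ≤ s * L * B := by
    have := mul_le_mul_of_nonneg_left hL (by positivity : 0 ≤ s * B)
    linarith
  have h9 : 6 * s / η * B ≤ 6 * s / η * L * B := by
    have := mul_le_mul_of_nonneg_left hL (by positivity : 0 ≤ 6 * s / η * B)
    linarith
  simp only [mul_zero, add_zero, zero_mul]
  linarith

end Numerics


/-! ### Regret of LUNAC -/

section Lunac

variable {s c q₀ : ℝ}

/-- The orders of a retailer who perceives the distribution function `F t` in period `t` and
orders at most `b`. -/
def quantileOrder (s b : ℝ) (F : ℕ → ℝ → ℝ) (t : ℕ) (w : ℝ) : ℝ := order (Set.Icc 0 b) (F t) s w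

/-- A bound in the form in which `regret_le_of_epochs_of_loss` gives it leads to the rate
`b ^ (5 / 4) T ^ (3 / 4)`. -/
theorem lunac_regret_le_of_bound (hc : 0 ≤ c) (hcs : c < s) (hq₀ : 0 < q₀) {κ D C_G c₃ : ℝ}
    (hD : 0 ≤ D) (hCG : 0 ≤ C_G) (hc₃ : 0 ≤ c₃) :
    ∃ C : ℝ, 0 ≤ C ∧ ∀ (b : ℝ) (T : ℕ) (L : ℝ), q₀ ≤ b → 1 ≤ T → 1 + Real.log T ≤ L →
      ∀ (sel : (Fin (gridSize b T) → ℝ) → Fin (gridSize b T)) (F : ℕ → ℝ → ℝ),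
        (∀ t, F t b = 1) →
        (∀ x : ℝ, 1 < x → (T : ℝ) = b * x ^ 12 → κ ≤ (gridSize b T : ℝ) → b < T →
          ∃ E G C₃ : ℝ, 0 ≤ E ∧ E ≤ D * L * (b * x ^ 3) ∧ E * G ≤ C_G * L ^ 2 * (b ^ 2 * x ^ 9) ∧
            C₃ ≤ c₃ * b ∧
            (lunac c s b (levelCount b T) sel).regret c s (quantileOrder s b F) T ≤
              T * (b * s / (gridSize b T : ℕ) + s * (b / ((levelCount b T : ℕ) - 1))) +
              E * (s * b * (gridSize b T : ℕ) + s * b + G * (1 + Real.log T)) +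
              6 * (s * b + (2 + C₃)) * √((levelCount b T : ℕ) * E * T)) →
        (lunac c s b (levelCount b T) sel).regret c s (quantileOrder s b F) T ≤
          C * L ^ 3 * (b ^ (5 / 4 : ℝ) * (T : ℝ) ^ (3 / 4 : ℝ)) := by
  have hs : 0 < s := by linarith
  -- The maximum covers the two cases settled by the trivial bound: `T ≤ b`, and a grid with fewer
  -- than `κ` prices.
  refine ⟨max s (s * κ) + (3 * s + 3 * s * D + C_G + 6 * (s + 2 / q₀ + c₃) * (1 + 2 * D)),
    add_nonneg (le_max_of_le_left hs.le) (by positivity), ?_⟩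
  intro b T L hb hT hL sel F hF h
  set C₁ := 3 * s + 3 * s * D + C_G + 6 * (s + 2 / q₀ + c₃) * (1 + 2 * D) with hC₁
  have hC₁0 : 0 ≤ C₁ := by positivity
  have hb0 : 0 < b := by linarith
  have hT1 : (1 : ℝ) ≤ T := by exact_mod_cast hT
  have hlog : 0 ≤ Real.log T := Real.log_nonneg hT1
  have hL1 : 1 ≤ L := by linarith
  have hL3 : 1 ≤ L ^ 3 := one_le_pow₀ hL1
  have hm : 0 ≤ max s (s * κ) := le_max_of_le_left hs.le
  have htriv : (lunac c s b (levelCount b T) sel).regret c s (quantileOrder s b F) T ≤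
      T * (s * b) := by
    refine lunaRounded_regret_le (ρ := roundUp b (levelCount b T)) hc hcs
      (fun t w _ _ => order_nonneg subset_rfl w)
      (fun t w h0 _ => order_le hs subset_rfl ⟨hb0.le, le_rfl⟩ (hF t) h0)
      fun t w _ _ => roundUp_nonneg hb0.le ?_ _
    exact Nat.ceil_pos.2 (by positivity)
  set B := b ^ (5 / 4 : ℝ) * (T : ℝ) ^ (3 / 4 : ℝ) with hB
  have hB0 : 0 ≤ B := by positivity
  have hfin : ∀ C', 0 ≤ C' → C' ≤ max s (s * κ) + C₁ → C' * B ≤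
      (max s (s * κ) + C₁) * L ^ 3 * B := by
    intro C' h0 h1
    have h2 : C' ≤ (max s (s * κ) + C₁) * L ^ 3 :=
      h1.trans (le_mul_of_one_le_right (by positivity) hL3)
    exact mul_le_mul_of_nonneg_right h2 hB0
  rcases le_or_gt (T : ℝ) b with hTb | hTb
  · have h1 := trivial_rate_le hb0 hTb
    calc _ ≤ (T : ℝ) * (s * b) := htriv
      _ = s * (T * b) := by ring
      _ ≤ s * B := by gcongr
      _ ≤ _ := hfin s hs.le (by linarith [le_max_left s (s * κ)])
  obtain ⟨x, hx, hTx⟩ := exists_scale hb0 hTb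
  have hx0 : 0 < x := by linarith
  have hBx : B = b ^ 2 * x ^ 9 := rate_eq hb0 hx hTx
  have hKx := gridSize_eq hb0 hx hTx
  have hNx := levelCount_eq hb0 hx hTx
  -- A small grid bounds `x`, and the trivial bound is `s * x ^ 3` times the rate.
  rcases lt_or_ge (gridSize b T : ℝ) κ with hκ | hκ
  · have h1 : x ^ 4 ≤ κ := by
      rw [hKx] at hκ
      exact (Nat.le_ceil _).trans hκ.le
    have h2 : x ^ 3 ≤ κ := (pow_le_pow_right₀ hx.le (by norm_num)).trans h1
    calc _ ≤ (T : ℝ) * (s * b) := htriv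
      _ = s * x ^ 3 * B := by rw [hBx, hTx]; ring
      _ ≤ s * κ * B := by gcongr
      _ ≤ _ := hfin _ (mul_nonneg hs.le ((pow_pos hx0 3).le.trans h2))
        (by linarith [le_max_right s (s * κ)])
  · obtain ⟨E, G, C₃, hE, hED, hEG, hC₃, hreg⟩ := h x hx hTx hκ hTb
    have hN2 : (2 : ℝ) ≤ (levelCount b T : ℕ) := by exact_mod_cast two_le_levelCount hb0 hTb
    have h1 := lunac_rate (l := 1 + Real.log T) (K := (gridSize b T : ℝ))
      (N := (levelCount b T : ℝ)) hs hq₀ hb hx.le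
      (by rw [hKx]; exact Nat.le_ceil _)
      (by rw [hKx]; exact ceil_le_two_mul (one_le_pow₀ hx.le))
      (by rw [hNx]; exact Nat.le_ceil _)
      (by rw [hNx]; exact ceil_le_two_mul (one_le_pow₀ hx.le)) hN2
      (by linarith) hL hL1 hE hED hD hEG hCG hC₃ hc₃
    rw [← hTx, ← hBx, ← hC₁] at h1
    refine hreg.trans (h1.trans ?_)
    have h2 : 0 ≤ max s (s * κ) * L ^ 3 * B := by positivity
    linarith

/-- Regret of LUNAC when the total variation of the perceived distribution functions is small. -/
theorem lunac_regret_le_of_variation (hc : 0 ≤ c) (hcs : c < s) (hq₀ : 0 < q₀) {κ V₀ c₃ g : ℝ}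
    (hV₀ : 0 < V₀) (hc₃ : 0 ≤ c₃) (hg : 0 ≤ g) :
    ∃ C : ℝ, 0 ≤ C ∧ ∀ (b : ℝ) (T : ℕ) (L : ℝ), q₀ ≤ b → 1 ≤ T → 1 + Real.log T ≤ L →
      ∀ (sel : (Fin (gridSize b T) → ℝ) → Fin (gridSize b T)) (F : ℕ → ℝ → ℝ) (A : ℕ → ℝ),
        IsArgmaxRule sel → (∀ t, F t b = 1) → Monotone A → A 0 = 0 → A T ≤ V₀ * L →
        (∀ t t', t ≤ t' → t' < T → ∀ q ∈ Set.Icc 0 b, |F t' q - F t q| ≤ A t' - A t) →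
        (∀ t t' w, 1 ≤ t → t ≤ t' → t' < T → 0 ≤ w → w ≤ s →
          quantileOrder s b F t w ≤ quantileOrder s b F t' 0) →
        (κ ≤ (gridSize b T : ℝ) → b < T → ∀ t₀ e, gridSize b T ≤ e → t₀ + e < T →
          (∀ m, ¬ LevelTrigger c s (level b : Fin (levelCount b T) → ℝ) sel
            (roundUp b (levelCount b T)) (quantileOrder s b F) t₀ e m) →
          bestOrder c s sel (exploreObs c s (gridSize b T) (roundUp b (levelCount b T))
            (quantileOrder s b F) t₀) ≠ 0 →
          (c - surrogatePrice c s sel (levelCount b T) (e + 1) (exploreObs c s (gridSize b T)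
            (roundUp b (levelCount b T)) (quantileOrder s b F) t₀)) *
            quantileOrder s b F (t₀ + e) (surrogatePrice c s sel (levelCount b T) (e + 1)
              (exploreObs c s (gridSize b T) (roundUp b (levelCount b T))
                (quantileOrder s b F) t₀)) ≤
          c₃ * b * margin (levelCount b T) (e + 1) + g * L * b / (e + 1)) →
        (lunac c s b (levelCount b T) sel).regret c s (quantileOrder s b F) T ≤
          C * L ^ 3 * (b ^ (5 / 4 : ℝ) * (T : ℝ) ^ (3 / 4 : ℝ)) := by
  have hs : 0 < s := by linarith
  set D := 2 / q₀ + 2 * (1 + V₀) * (1 + s) with hD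
  obtain ⟨C, hC0, hC⟩ := lunac_regret_le_of_bound (κ := κ) (D := D) (C_G := D * g) (c₃ := c₃) hc hcs
    hq₀ (by positivity) (by positivity) hc₃
  refine ⟨C, hC0, fun b T L hb hT hL sel F A hsel hF hA hA0 hAT hFA hzero hloss =>
    hC b T L hb hT hL sel F hF ?_⟩
  intro x hx hTx hκ hTb
  have hb0 : 0 < b := by linarith
  have hx0 : 0 < x := by linarith
  have hT1 : (1 : ℝ) ≤ T := by exact_mod_cast hT
  have hL1 : 1 ≤ L := by linarith [Real.log_nonneg hT1]
  have hN2 := two_le_levelCount hb0 hTb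
  have hNx := levelCount_eq hb0 hx hTx
  -- Since `T * b ^ 2 = (b * x ^ 3) ^ 3 * x ^ 3` and there are at least `x ^ 3` levels, the epoch
  -- condition holds with `E` of order `b * x ^ 3`.
  set E := (1 + V₀ * L) * (1 + s) * (b * x ^ 3) with hE
  have hE0 : 0 < E := by positivity
  have hED : 2 + 2 * E ≤ D * L * (b * x ^ 3) := by
    have h1 : 2 ≤ 2 / q₀ * L * (b * x ^ 3) := by
      have h2 : 1 ≤ x ^ 3 := one_le_pow₀ hx.le
      calc (2 : ℝ) = 2 / q₀ * 1 * (q₀ * 1) := by field_simp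
        _ ≤ _ := by gcongr
    have h3 : E ≤ (1 + V₀) * (1 + s) * L * (b * x ^ 3) := by
      rw [hE]
      have h4 : (1 + V₀ * L) ≤ (1 + V₀) * L := by linarith
      calc (1 + V₀ * L) * (1 + s) * (b * x ^ 3) ≤ ((1 + V₀) * L) * (1 + s) * (b * x ^ 3) := by
            gcongr
        _ = _ := by ring
    rw [hD]
    linarith
  have hNge : x ^ 3 ≤ (levelCount b T : ℝ) := by rw [hNx]; exact Nat.le_ceil _
  refine ⟨2 + 2 * E, g * L * b, c₃ * b, by positivity, hED, ?_, le_rfl, ?_⟩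
  · calc (2 + 2 * E) * (g * L * b) ≤ D * L * (b * x ^ 3) * (g * L * b) := by gcongr
      _ = D * g * L ^ 2 * (b ^ 2 * x ^ 3) := by ring
      _ ≤ _ := by
        gcongr
        · exact hx.le
        · norm_num
  · have hO := observed_roundUp (F := F) hs hb0.le hN2 hF
    refine regret_le_of_variation (A := A) (V := V₀ * L) hc hcs
      (div_nonneg hb0.le ?_) (by omega) hT hsel hO (by positivity) (by positivity) hA hA0
      (by positivity) hAT hE0 ?_ ?_ hzero ?_
    · have : (2 : ℝ) ≤ (levelCount b T : ℕ) := by exact_mod_cast hN2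
      linarith
    · calc (V₀ * L) ^ 2 * T * (s * b) ^ 2 = (V₀ * L) ^ 2 * s ^ 2 * (b * x ^ 3) ^ 3 * x ^ 3 := by
            rw [hTx]; ring
        _ ≤ (1 + V₀ * L) ^ 3 * (1 + s) ^ 3 * (b * x ^ 3) ^ 3 * (levelCount b T : ℝ) := by
          have h1 : (V₀ * L) ^ 2 ≤ (1 + V₀ * L) ^ 3 := by
            have h0 : 0 ≤ V₀ * L := by positivity
            calc (V₀ * L) ^ 2 ≤ (1 + V₀ * L) ^ 2 := by gcongr; linarith
              _ ≤ _ := pow_le_pow_right₀ (by linarith) (by norm_num)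
          have h2 : s ^ 2 ≤ (1 + s) ^ 3 := by
            calc s ^ 2 ≤ (1 + s) ^ 2 := by gcongr; linarith
              _ ≤ _ := pow_le_pow_right₀ (by linarith) (by norm_num)
          gcongr
        _ = _ := by rw [hE]; ring
    · intro t t' htt ht'
      have hb1 : b ∈ Set.Icc 0 b := ⟨hb0.le, le_rfl⟩
      constructor
      · exact order_shiftBound hs subset_rfl hb1 hF fun q hq => by
          linarith [(abs_le.1 (hFA t t' htt ht' q hq)).2]
      · exact order_shiftBound hs subset_rfl hb1 hF fun q hq => by
          linarith [(abs_le.1 (hFA t t' htt ht' q hq)).1]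
    · intro t₀ e he heT hL hy _
      exact hloss hκ hTb t₀ e he heT hL hy

/-- The case that all positive orders are at least `η`. -/
theorem lunac_regret_le_of_order_ge (hc : 0 ≤ c) (hcs : c < s) (hq₀ : 0 < q₀) {V₀ η : ℝ}
    (hV₀ : 0 < V₀) (hη : 0 < η) :
    ∃ C : ℝ, 0 ≤ C ∧ ∀ (b : ℝ) (T : ℕ) (L : ℝ), q₀ ≤ b → 1 ≤ T → 1 + Real.log T ≤ L →
      ∀ (sel : (Fin (gridSize b T) → ℝ) → Fin (gridSize b T)) (F : ℕ → ℝ → ℝ) (A : ℕ → ℝ),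
        IsArgmaxRule sel → (∀ t, F t b = 1) → Monotone A → A 0 = 0 → A T ≤ V₀ * L →
        (∀ t t', t ≤ t' → t' < T → ∀ q ∈ Set.Icc 0 b, |F t' q - F t q| ≤ A t' - A t) →
        (∀ t t' w, 1 ≤ t → t ≤ t' → t' < T → 0 ≤ w → w ≤ s →
          quantileOrder s b F t w ≤ quantileOrder s b F t' 0) →
        (b < T → ∀ t w, 0 ≤ w → w ≤ s → roundUp b (levelCount b T) (quantileOrder s b F t w) = 0 ∨
          η ≤ roundUp b (levelCount b T) (quantileOrder s b F t w)) →
        (lunac c s b (levelCount b T) sel).regret c s (quantileOrder s b F) T ≤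
          C * L ^ 3 * (b ^ (5 / 4 : ℝ) * (T : ℝ) ^ (3 / 4 : ℝ)) := by
  have hs : 0 < s := by linarith
  obtain ⟨C, hC0, hC⟩ := lunac_regret_le_of_variation (κ := 0) (V₀ := V₀) (c₃ := 1 / η) (g := 0)
    hc hcs hq₀ hV₀ (by positivity) le_rfl
  refine ⟨C, hC0, fun b T L hb hT hL sel F A hsel hF hA hA0 hAT hFA hzero hη' =>
    hC b T L hb hT hL sel F A hsel hF hA hA0 hAT hFA hzero ?_⟩
  intro _ hTb t₀ e he heT hL hy
  have hb0 : 0 < b := by linarith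
  have hO := observed_roundUp (F := F) hs hb0.le (two_le_levelCount hb0 hTb) hF
  have h1 := surrogate_loss_le_of_order_ge (M := levelCount b T) (sel := sel) (e := e) hc hcs hO hη
    ((hη' hTb _ _ (hc.trans (le_explorePrice hcs _)) (explorePrice_lt hcs _).le).resolve_left hy)
  refine h1.trans (le_of_eq ?_)
  ring

/-- The case that, after a short initial phase, the order at some price above the unit cost is
bounded away from `0`. -/
theorem lunac_regret_le_of_profitable (hc : 0 ≤ c) (hcs : c < s) (hq₀ : 0 < q₀)
    {V₀ w₁ q₁ τ : ℝ} (hV₀ : 0 < V₀) (hw₁ : c < w₁) (hw₁s : w₁ ≤ s) (hq₁ : 0 < q₁) (hτ : 0 ≤ τ) :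
    ∃ C : ℝ, 0 ≤ C ∧ ∀ (b : ℝ) (T : ℕ) (L : ℝ), q₀ ≤ b → 1 ≤ T → 1 + Real.log T ≤ L →
      ∀ (sel : (Fin (gridSize b T) → ℝ) → Fin (gridSize b T)) (F : ℕ → ℝ → ℝ) (A : ℕ → ℝ),
        IsArgmaxRule sel → (∀ t, F t b = 1) → Monotone A → A 0 = 0 → A T ≤ V₀ * L →
        (∀ t t', t ≤ t' → t' < T → ∀ q ∈ Set.Icc 0 b, |F t' q - F t q| ≤ A t' - A t) →
        (∀ t t' w, 1 ≤ t → t ≤ t' → t' < T → 0 ≤ w → w ≤ s →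
          quantileOrder s b F t w ≤ quantileOrder s b F t' 0) →
        (∀ t : ℕ, τ * L ≤ t → t < T → q₁ ≤ quantileOrder s b F t w₁) →
        (lunac c s b (levelCount b T) sel).regret c s (quantileOrder s b F) T ≤
          C * L ^ 3 * (b ^ (5 / 4 : ℝ) * (T : ℝ) ^ (3 / 4 : ℝ)) := by
  have hs : 0 < s := by linarith
  have hd : 0 < w₁ - c := by linarith
  obtain ⟨C, hC0, hC⟩ := lunac_regret_le_of_variation (κ := 2 * s / (w₁ - c)) (V₀ := V₀)
    (c₃ := 4 * s / (q₁ * (w₁ - c))) (g := s * (τ + 1)) hc hcs hq₀ hV₀ (by positivity)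
    (by positivity)
  refine ⟨C, hC0, fun b T L hb hT hL sel F A hsel hF hA hA0 hAT hFA hzero hprof =>
    hC b T L hb hT hL sel F A hsel hF hA hA0 hAT hFA hzero ?_⟩
  intro hκ hTb t₀ e he heT hLt hy
  have hb0 : 0 < b := by linarith
  have hT1 : (1 : ℝ) ≤ T := by exact_mod_cast hT
  have hL1 : 1 ≤ L := by linarith [Real.log_nonneg hT1]
  have hO := observed_roundUp (F := F) hs hb0.le (two_le_levelCount hb0 hTb) hF
  have hm := margin_nonneg (levelCount b T) (e + 1)
  -- In the initial phase the loss is at most `s b`, while `e + 1 ≤ (τ + 1) L`; so it can be charged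
  -- to the term `G / (e + 1)`, whose sum over an epoch is logarithmic.
  rcases le_or_gt (τ * L) ((t₀ + e : ℕ) : ℝ) with h | h
  · have h1 := surrogate_loss_le_of_profit hc hcs hO hLt hw₁ hw₁s hq₁ (hprof _ h heT) hκ
    have h2 : 0 ≤ s * (τ + 1) * L * b / ((e : ℝ) + 1) := by positivity
    have h3 : 4 * s * b / (q₁ * (w₁ - c)) = 4 * s / (q₁ * (w₁ - c)) * b := by ring
    rw [h3] at h1
    exact h1.trans (le_add_of_nonneg_right h2)
  · set obs := exploreObs c s (gridSize b T) (roundUp b (levelCount b T)) (quantileOrder s b F) t₀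
    set w₀ := surrogatePrice c s sel (levelCount b T) (e + 1) obs
    have h0 := exploreObs_nonneg (K := gridSize b T) hc hcs hO t₀
    have hw0 : 0 ≤ w₀ := surrogatePrice_nonneg _ _
    have hws : w₀ ≤ s := surrogatePrice_le hc hcs h0 _
    have h1 := hO.nonneg (t₀ + e) w₀ hw0 hws
    have h2 := hO.le (t₀ + e) w₀ hw0 hws
    have h3 : (c - w₀) * quantileOrder s b F (t₀ + e) w₀ ≤ s * b := by
      change (c - w₀) * order (Set.Icc 0 b) (F (t₀ + e)) s w₀ ≤ s * b
      nlinarith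
    have h4 : s * b ≤ s * (τ + 1) * L * b / ((e : ℝ) + 1) := by
      rw [le_div_iff₀ (by positivity)]
      have h5 : (e : ℝ) + 1 ≤ (τ + 1) * L := by
        push_cast at h
        linarith [(Nat.cast_nonneg t₀ : (0 : ℝ) ≤ t₀)]
      calc s * b * ((e : ℝ) + 1) ≤ s * b * ((τ + 1) * L) := by gcongr
        _ = _ := by ring
    have h5 : 0 ≤ 4 * s / (q₁ * (w₁ - c)) * b * margin (levelCount b T) (e + 1) := by positivity
    linarith

end Lunac


/-! ### LUNA against the empirical distribution -/

section Categorical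

theorem sum_pmf_toReal {D : Type} [Fintype D] (p : PMF D) : ∑ m, (p m).toReal = 1 := by
  rw [← ENNReal.toReal_sum fun m _ => p.apply_ne_top m, ← tsum_fintype (L := .unconditional _),
    p.tsum_coe, ENNReal.toReal_one]

variable {D : Type} [DecidableEq D]

/-- The number of occurrences of `m` in the sample `x`. -/
def occurrences {t : ℕ} (x : Fin t → D) (m : D) : ℕ := (Finset.univ.filter fun i => x i = m).card

theorem sum_occurrences [Fintype D] {t : ℕ} (x : Fin t → D) : ∑ m, occurrences x m = t := by
  have := Finset.card_eq_sum_card_fiberwise (f := x) (s := Finset.univ) (t := Finset.univ)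
    (fun _ _ => Finset.mem_univ _)
  simpa [occurrences] using this.symm

theorem occurrences_pos {t : ℕ} (x : Fin t → D) (i : Fin t) : 0 < occurrences x (x i) :=
  Finset.card_pos.2 ⟨i, by simp⟩

/-- The empirical distribution of a nonempty sample. -/
def empirical [Fintype D] {t : ℕ} (ht : 0 < t) (x : Fin t → D) : PMF D :=
  PMF.ofFintype (fun m => (occurrences x m : ℝ≥0∞) / t) (by
    simp only [div_eq_mul_inv]
    rw [← Finset.sum_mul, ← Nat.cast_sum, sum_occurrences]
    exact ENNReal.mul_inv_cancel (by simpa using ht.ne') (ENNReal.natCast_ne_top t))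

theorem empirical_toReal [Fintype D] {t : ℕ} (ht : 0 < t) (x : Fin t → D) (m : D) :
    (empirical ht x m).toReal = occurrences x m / t := by
  simp [empirical, ENNReal.toReal_div]

/-- The maximum likelihood estimator for the family of all distributions is the empirical
distribution. -/
theorem IsMLE.categorical [Fintype D] {est : (t : ℕ) → (Fin t → D) → PMF D}
    (h : IsMLE (fun (p : PMF D) (m : D) => (p m).toReal) Set.univ est) {t : ℕ} (ht : 0 < t)
    (x : Fin t → D) (m : D) : (est t x m).toReal = occurrences x m / t := by
  set p := est t x with hp
  have ht' : (0 : ℝ) < t := by exact_mod_cast ht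
  have hn : ∀ i, (0 : ℝ) < occurrences x (x i) := fun i => by exact_mod_cast occurrences_pos x i
  have h1 := h t x (fun _ => Set.mem_univ _) (empirical ht x)
  simp only [empirical_toReal] at h1
  have hq : 0 < ∏ i, (occurrences x (x i) : ℝ) / t :=
    Finset.prod_pos fun i _ => div_pos (hn i) ht'
  have hppos : ∀ i, 0 < (p (x i)).toReal := by
    intro i
    refine lt_of_le_of_ne ENNReal.toReal_nonneg fun h0 => ?_
    have h2 : ∏ i, (est t x (x i)).toReal = 0 :=
      Finset.prod_eq_zero (Finset.mem_univ i) h0.symm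
    linarith
  -- Likelihood ratios of the estimate to the empirical distribution. Maximality gives `∑ log u ≥
  -- 0`, total mass gives `∑ (u - 1) ≤ 0`, and `log u < u - 1` unless `u = 1`.
  set u : Fin t → ℝ := fun i => (p (x i)).toReal / ((occurrences x (x i) : ℝ) / t) with hu
  have hupos : ∀ i, 0 < u i := fun i => div_pos (hppos i) (div_pos (hn i) ht')
  have hprod : 1 ≤ ∏ i, u i := by
    rw [hu, Finset.prod_div_distrib, one_le_div hq]
    exact h1
  have hlog : 0 ≤ ∑ i, Real.log (u i) := by
    rw [← Real.log_prod fun i _ => (hupos i).ne']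
    exact Real.log_nonneg hprod
  have hsum : ∑ i, u i ≤ t := by
    have h2 : ∑ i, u i = ∑ m ∈ Finset.univ.image x, (t : ℝ) * (p m).toReal := by
      rw [hu, Finset.sum_comp (fun m => (p m).toReal / ((occurrences x m : ℝ) / t)) x]
      refine Finset.sum_congr rfl fun m hm => ?_
      obtain ⟨i, _, rfl⟩ := Finset.mem_image.1 hm
      rw [nsmul_eq_mul]
      change (occurrences x (x i) : ℝ) * _ = _
      have := (hn i).ne'
      field_simp
    have h3 : ∑ m ∈ Finset.univ.image x, (t : ℝ) * (p m).toReal ≤ ∑ m, (t : ℝ) * (p m).toReal :=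
      Finset.sum_le_sum_of_subset_of_nonneg (Finset.subset_univ _) fun m _ _ =>
        mul_nonneg ht'.le ENNReal.toReal_nonneg
    have h4 : ∑ m, (t : ℝ) * (p m).toReal = t := by
      rw [← Finset.mul_sum, sum_pmf_toReal, mul_one]
    rw [h2]
    exact h3.trans h4.le
  have hu1 : ∀ i, u i = 1 := by
    by_contra hcon
    push Not at hcon
    obtain ⟨i, hi⟩ := hcon
    have h2 : ∑ i, Real.log (u i) < ∑ i, (u i - 1) :=
      Finset.sum_lt_sum (fun j _ => Real.log_le_sub_one_of_pos (hupos j))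
        ⟨i, Finset.mem_univ i, Real.log_lt_sub_one_of_pos (hupos i) hi⟩
    rw [Finset.sum_sub_distrib, Finset.sum_const, Finset.card_univ, Fintype.card_fin, nsmul_eq_mul,
      mul_one] at h2
    linarith
  -- The estimate dominates the empirical distribution pointwise and has the same mass, so it puts
  -- nothing on unobserved points.
  have hle : ∀ m ∈ Finset.univ, (occurrences x m : ℝ) / t ≤ (p m).toReal := by
    intro m _
    by_cases hm : ∃ i, x i = m
    · obtain ⟨i, rfl⟩ := hm
      have h2 := hu1 i
      rw [hu, div_eq_one_iff_eq (div_pos (hn i) ht').ne'] at h2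
      exact h2.symm.le
    · have h0 : occurrences x m = 0 := by
        refine Finset.card_eq_zero.2 (Finset.filter_eq_empty_iff.2 fun i _ hi => hm ⟨i, hi⟩)
      rw [h0]
      simp
  have hsum1 : ∑ m, (occurrences x m : ℝ) / t = ∑ m, (p m).toReal := by
    rw [sum_pmf_toReal, ← Finset.sum_div, ← Nat.cast_sum, sum_occurrences, div_self ht'.ne']
  exact ((Finset.sum_eq_sum_iff_of_le hle).1 hsum1 m (Finset.mem_univ m)).symm

end Categorical

theorem cdf_map_pmf {M : ℕ} (p : PMF (Fin M)) (y : Fin M → ℝ) (x : ℝ) :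
    cdf (p.toMeasure.map y) x = ∑ m, if y m ≤ x then (p m).toReal else 0 := by
  have hy : Measurable y := measurable_of_finite y
  have : IsProbabilityMeasure (p.toMeasure.map y) :=
    Measure.isProbabilityMeasure_map hy.aemeasurable
  rw [cdf_eq_real, Measure.real, Measure.map_apply hy measurableSet_Iic,
    PMF.toMeasure_apply_fintype, ENNReal.toReal_sum]
  · refine Finset.sum_congr rfl fun m _ => ?_
    by_cases h : y m ≤ x <;> simp [h]
  · intro m _
    by_cases h : y m ≤ x <;> simp [h, p.apply_ne_top]

/-- The perceived distribution function is the empirical one. -/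
theorem perceived_categorical {M : ℕ} {y : Fin M → ℝ} {b : ℝ} (hb : ∀ m, y m ≤ b)
    {est : (t : ℕ) → (Fin t → Fin M) → PMF (Fin M)}
    (h : IsMLE (fun (p : PMF (Fin M)) (m : Fin M) => (p m).toReal) Set.univ est)
    (ξ : ℕ → Fin M) {t : ℕ} (ht : 0 < t) (x : ℝ) :
    perceived b ((est t fun i => ξ i).toMeasure.map y) x =
      (∑ i ∈ Finset.range t, if y (ξ i) ≤ x then (1 : ℝ) else 0) / t := by
  have ht' : (0 : ℝ) < t := by exact_mod_cast ht
  unfold perceived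
  split_ifs with hx
  · rw [cdf_map_pmf]
    have h1 : ∀ m, (if y m ≤ x then (est t (fun i : Fin t => ξ i) m).toReal else 0) =
        (occurrences (fun i : Fin t => ξ i) m * if y m ≤ x then (1 : ℝ) else 0) / t := by
      intro m
      rw [h.categorical ht]
      split_ifs <;> simp
    simp only [h1]
    rw [← Finset.sum_div, Finset.sum_range
      (f := fun i => if y (ξ i) ≤ x then (1 : ℝ) else 0),
      Finset.sum_comp (fun m => if y m ≤ x then (1 : ℝ) else 0) (fun i : Fin t => ξ i)]
    congr 1
    rw [eq_comm]
    refine Finset.sum_subset_zero_on_sdiff (Finset.subset_univ _) (fun m hm => ?_) fun m _ => ?_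
    · have h0 : occurrences (fun i : Fin t => ξ i) m = 0 := by
        refine Finset.card_eq_zero.2 (Finset.filter_eq_empty_iff.2 fun i _ hi => ?_)
        simp only [Finset.mem_sdiff, Finset.mem_image, not_exists, not_and] at hm
        exact hm.2 i (Finset.mem_univ _) hi
      rw [h0]
      simp
    · rw [nsmul_eq_mul]
      rfl
  · have h1 : ∀ i, y (ξ i) ≤ x := fun i => (hb _).trans (not_lt.1 hx)
    simp [h1, ht'.ne']

theorem perceived_nonneg (b : ℝ) (μ : Measure ℝ) (x : ℝ) : 0 ≤ perceived b μ x := by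
  unfold perceived
  split_ifs
  · exact cdf_nonneg μ x
  · exact zero_le_one

theorem perceived_le_one (b : ℝ) (μ : Measure ℝ) (x : ℝ) : perceived b μ x ≤ 1 := by
  unfold perceived
  split_ifs
  · exact cdf_le_one μ x
  · exact le_rfl

theorem abs_perceived_sub_le_one (b : ℝ) (μ ν : Measure ℝ) (x : ℝ) :
    |perceived b μ x - perceived b ν x| ≤ 1 := by
  rw [abs_le]
  constructor <;>
    linarith [perceived_nonneg b μ x, perceived_nonneg b ν x, perceived_le_one b μ x,
      perceived_le_one b ν x]

theorem perceived_self (b : ℝ) (μ : Measure ℝ) : perceived b μ b = 1 := by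
  simp [perceived]

theorem harm_monotone : Monotone harm := fun _ _ h => harm_mono h

/-! ### Regret of LUNA for categorical demand -/

section Luna

variable {s c : ℝ}

/-- Regret of LUNA against the maximum likelihood estimator for categorical demand. -/
theorem lunaRegret_le (hc : 0 ≤ c) (hcs : c < s) {η : ℝ} (hη : 0 < η) : ∃ C : ℝ, 0 ≤ C ∧
    ∀ (M : ℕ) (y : Fin M → ℝ) (b : ℝ) (T : ℕ), (∀ m, 0 ≤ y m) → (∀ m, 0 < y m → η ≤ y m) →
      IsGreatest (Set.range y) b → 0 < b → 1 ≤ T →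
      ∀ sel : (Fin (gridSize b T) → ℝ) → Fin (gridSize b T), IsArgmaxRule sel →
      ∀ est : (t : ℕ) → (Fin t → Fin M) → PMF (Fin M),
        IsMLE (fun (p : PMF (Fin M)) (m : Fin M) => (p m).toReal) Set.univ est → ∀ ξ : ℕ → Fin M,
      lunaRegret c s b y T sel (fun p : PMF (Fin M) => p.toMeasure.map y) est ξ ≤
        C * (1 + Real.log T) *
          (b ^ (4 / 3 : ℝ) * (M : ℝ) ^ (1 / 3 : ℝ) * (T : ℝ) ^ (2 / 3 : ℝ)) := by
  have hs : 0 < s := by linarith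
  set C₁ := s + 6 * s / η + 6 * s * (1 + s) + 6 * (s + 3 / η) * (1 + 2 / η + 2 * (1 + s)) with hC₁
  have hC₁s : s ≤ C₁ := by
    have : 0 ≤ 6 * s / η + 6 * s * (1 + s) + 6 * (s + 3 / η) * (1 + 2 / η + 2 * (1 + s)) := by
      positivity
    linarith
  refine ⟨C₁, by positivity, ?_⟩
  intro M y b T hy0 hyη hyb hb0 hT sel hsel est hest ξ
  have hT1 : (1 : ℝ) ≤ T := by exact_mod_cast hT
  have hL : 1 ≤ 1 + Real.log T := by linarith [Real.log_nonneg hT1]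
  have hbη : η ≤ b := by
    obtain ⟨m, hm⟩ := hyb.1
    rw [← hm] at hb0 ⊢
    exact hyη m hb0
  have hM : 0 < M := by
    obtain ⟨m, _⟩ := hyb.1
    exact m.pos
  have hM' : (1 : ℝ) ≤ M := by exact_mod_cast hM
  set F : ℕ → ℝ → ℝ := fun t => perceived b ((est t fun i => ξ i).toMeasure.map y) with hF
  have hFb : ∀ t, F t b = 1 := fun t => perceived_self b _
  set r : ℕ → ℝ → ℝ := fun t w => order (Set.range y) (F t) s w with hr
  have hO : Observed s b 0 y id r := observed_range hs hy0 hyb hFb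
  have hyb' : ∀ m, y m ≤ b := fun m => hyb.2 ⟨m, rfl⟩
  change (lunaRounded c s y sel id).regret c s r T ≤ _
  rcases le_or_gt (T : ℝ) (b * M) with hTM | hTM
  · have h1 := luna_trivial_rate_le hb0 hTM
    have h2 := lunaRounded_regret_le (T := T) (sel := sel) (y := y) hc hcs hO.nonneg hO.le
      fun t w h0 hw => hO.round_nonneg t h0 hw
    set B := b ^ (4 / 3 : ℝ) * (M : ℝ) ^ (1 / 3 : ℝ) * (T : ℝ) ^ (2 / 3 : ℝ) with hB
    have hB0 : 0 ≤ B := by positivity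
    calc _ ≤ (T : ℝ) * (s * b) := h2
      _ = s * 1 * (T * b) := by ring
      _ ≤ C₁ * (1 + Real.log T) * B := by gcongr
  have hTb : b < T := lt_of_le_of_lt (le_mul_of_one_le_right hb0.le hM') hTM
  obtain ⟨x, hx, hTx⟩ := exists_scale hb0 hTb
  have hx0 : 0 < x := by linarith
  set m := (M : ℝ) ^ (1 / 3 : ℝ) with hm
  have hm3 : m ^ 3 = M := by
    rw [hm, ← Real.rpow_natCast, ← Real.rpow_mul (by positivity)]
    norm_num
  have hm1 : 1 ≤ m := Real.one_le_rpow hM' (by norm_num)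
  have hmx : m ≤ x ^ 4 := by
    have h1 : m ^ 3 ≤ (x ^ 4) ^ 3 := by
      rw [hm3, ← pow_mul]
      rw [hTx] at hTM
      exact (lt_of_mul_lt_mul_left hTM hb0.le).le
    exact le_of_pow_le_pow_left₀ (by norm_num) (by positivity) h1
  have hm0 : 0 < m := by linarith
  set L := 1 + Real.log T with hLd
  -- The cube of `E * m` dominates `L ^ 2 * T * (s * b) ^ 2`, because `T * b ^ 2 = (b * x ^ 4) ^ 3`.
  set E := (1 + s) * L * (b * x ^ 4) / m with hE
  have hEm : E * m = (1 + s) * L * (b * x ^ 4) := by rw [hE]; field_simp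
  have hE0 : 0 < E := by positivity
  -- The empirical distribution function is a running mean of indicators. For `i = 0` the earlier
  -- fit is arbitrary, and the trivial bound `1` has the same form.
  have hvar : ∀ q i, |F (i + 1) q - F i q| ≤ 1 / ((i : ℝ) + 1) := by
    intro q i
    rcases Nat.eq_zero_or_pos i with rfl | hi
    · simpa using abs_perceived_sub_le_one b _ _ q
    · have hi' : (0 : ℝ) < i := by exact_mod_cast hi
      have h1 : F (i + 1) q = _ := perceived_categorical hyb' hest ξ (Nat.succ_pos i) q
      have h2 : F i q = _ := perceived_categorical hyb' hest ξ hi q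
      rw [h1, h2, Nat.succ_eq_add_one, Finset.sum_range_succ]
      set S := ∑ j ∈ Finset.range i, if y (ξ j) ≤ q then (1 : ℝ) else 0 with hS
      have hS0 : 0 ≤ S := Finset.sum_nonneg fun j _ => by split_ifs <;> norm_num
      have hSi : S ≤ i := by
        have : S ≤ ∑ j ∈ Finset.range i, (1 : ℝ) :=
          Finset.sum_le_sum fun j _ => by split_ifs <;> norm_num
        simpa using this
      set d : ℝ := if y (ξ i) ≤ q then (1 : ℝ) else 0 with hd
      have hd0 : 0 ≤ d := by rw [hd]; split_ifs <;> norm_num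
      have hd1 : d ≤ 1 := by rw [hd]; split_ifs <;> norm_num
      have h3 : (S + d) / ((i + 1 : ℕ) : ℝ) - S / i = (d - S / i) / ((i : ℝ) + 1) := by
        push_cast; field_simp; ring
      have h4 : 0 ≤ S / i := by positivity
      have h5 : S / i ≤ 1 := by rw [div_le_one hi']; exact hSi
      rw [h3, abs_div, abs_of_pos (by positivity : (0 : ℝ) < (i : ℝ) + 1)]
      gcongr
      rw [abs_le]
      constructor <;> linarith
  have hmain := regret_le_of_variation (sel := sel) (C₃ := b / η) (G := 0) (A := harm) (V := L)
    (E := E) hc hcs le_rfl hM hT hsel hO (by positivity) le_rfl harm_monotone (by simp [harm])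
    (by linarith) (harm_le T) hE0 ?_ ?_ ?_ ?_
  · refine hmain.trans ?_
    have h1 := luna_rate (D := 1 + s) (l := L) (η := η) (K := (gridSize b T : ℝ)) (L := L) hs hη hbη
      hx.le (by rw [gridSize_eq hb0 hx hTx]; exact Nat.le_ceil _)
      (by rw [gridSize_eq hb0 hx hTx]; exact ceil_le_two_mul (one_le_pow₀ hx.le))
      hm1 hmx hL hEm (by linarith)
    have h2 : b ^ (4 / 3 : ℝ) * m * (T : ℝ) ^ (2 / 3 : ℝ) = b ^ 2 * x ^ 8 * m := by
      rw [← luna_rate_eq hb0 hx hTx]; ring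
    rw [← hTx, hm3] at h1
    rw [h2]
    exact h1
  · calc L ^ 2 * T * (s * b) ^ 2 = L ^ 2 * s ^ 2 * (b * x ^ 4) ^ 3 := by rw [hTx]; ring
      _ ≤ L ^ 3 * (1 + s) ^ 3 * (b * x ^ 4) ^ 3 := by
        have h1 : L ^ 2 ≤ L ^ 3 := pow_le_pow_right₀ hL (by norm_num)
        have h2 : s ^ 2 ≤ (1 + s) ^ 3 := by
          calc s ^ 2 ≤ (1 + s) ^ 2 := by gcongr; linarith
            _ ≤ _ := pow_le_pow_right₀ (by linarith) (by norm_num)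
        gcongr
      _ = (E * m) ^ 3 := by rw [hEm]; ring
      _ = E ^ 3 * M := by rw [mul_pow, hm3]
  · intro t t' htt _
    have hΞ : Set.range y ⊆ Set.Icc 0 b := by
      rintro _ ⟨m, rfl⟩
      exact ⟨hy0 m, hyb' m⟩
    constructor
    · exact order_shiftBound hs hΞ hyb.1 hFb fun q _ => by
        have := (abs_le.1 (abs_sub_le_sum (F := fun t => F t q) htt fun i _ => hvar q i)).2
        unfold harm
        linarith
    · exact order_shiftBound hs hΞ hyb.1 hFb fun q _ => by
        have := (abs_le.1 (abs_sub_le_sum (F := fun t => F t q) htt fun i _ => hvar q i)).1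
        unfold harm
        linarith
  -- At price `0` the order in period `t'` is at least every demand seen so far, in particular those
  -- seen before period `t`, so the earlier orders cannot be larger.
  · intro t t' w ht htt _ hw _
    have hΞ : Set.range y ⊆ Set.Icc 0 b := by
      rintro _ ⟨m, rfl⟩
      exact ⟨hy0 m, hyb' m⟩
    refine order_le_order hs hΞ hyb.1 (hFb t') le_rfl fun q _ hq => ?_
    have ht0 : (0 : ℝ) < t := by exact_mod_cast ht
    have ht0' : (0 : ℝ) < t' := by exact_mod_cast (show 0 < t' by omega)
    have h1 : F t' q = _ := perceived_categorical hyb' hest ξ (by omega) q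
    have h2 : F t q = _ := perceived_categorical hyb' hest ξ ht q
    rw [zero_div, sub_zero, h1, one_le_div ht0'] at hq
    have hall : ∀ i, i < t' → y (ξ i) ≤ q := by
      by_contra hcon
      push Not at hcon
      obtain ⟨i, hi, hiq⟩ := hcon
      have h3 : (∑ i ∈ Finset.range t', if y (ξ i) ≤ q then (1 : ℝ) else 0) <
          ∑ i ∈ Finset.range t', (1 : ℝ) :=
        Finset.sum_lt_sum (fun j _ => by split_ifs <;> norm_num)
          ⟨i, Finset.mem_range.2 hi, by rw [if_neg (not_le.2 hiq)]; norm_num⟩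
      simp only [Finset.sum_const, Finset.card_range, nsmul_eq_mul, mul_one] at h3
      linarith
    have h4 : (∑ i ∈ Finset.range t, if y (ξ i) ≤ q then (1 : ℝ) else 0) = t := by
      rw [Finset.sum_congr rfl fun i hi => if_pos (hall i (by
        have := Finset.mem_range.1 hi; omega))]
      simp
    rw [h2, h4, div_self ht0.ne']
    have : 0 ≤ w / s := by positivity
    linarith
  · intro t₀ e he heT _ hne _
    have h1 : η ≤ bestOrder c s sel (exploreObs c s (gridSize b T) id r t₀) := by
      obtain ⟨k, hk⟩ := hO.mem (t₀ + bestIndex c s sel (exploreObs c s (gridSize b T) id r t₀))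
        (explorePrice c s (bestIndex c s sel (exploreObs c s (gridSize b T) id r t₀)))
        (hc.trans (le_explorePrice hcs _)) (explorePrice_lt hcs _).le
      change y k = bestOrder c s sel (exploreObs c s (gridSize b T) id r t₀) at hk
      rw [← hk] at hne ⊢
      exact hyη k (lt_of_le_of_ne (hy0 k) (Ne.symm hne))
    have h2 := surrogate_loss_le_of_order_ge (M := M) (sel := sel) (e := e) hc hcs hO hη h1
    simpa using h2

end Luna

/-! ### Integrability of the regret for categorical demand -/

/-- Only the responses up to the horizon matter; this makes the regret a function of finitely many
demands. -/
theorem PricingPolicy.regretFrom_congr {S A : Type} [Fintype A] (π : PricingPolicy S A) {c s : ℝ}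
    {r r' : ℕ → ℝ → ℝ} (n : ℕ) : ∀ t σ, (∀ i, i < t + n → r i = r' i) →
      π.regretFrom c s r n t σ = π.regretFrom c s r' n t σ := by
  induction n with
  | zero => intro t σ _; rfl
  | succ n ih =>
    intro t σ h
    unfold PricingPolicy.regretFrom
    rw [h t (by omega)]
    refine Finset.sum_congr rfl fun a _ => ?_
    rw [ih (t + 1) _ fun i hi => h i (by omega)]

/-- The regret factors through the first `T` demands, which take values in a finite type; the later
demands are replaced by a default point. Hence it is bounded and measurable without any regularity
of `sel` or `est`. -/
theorem integrable_lunaRegret {Ω : Type*} [MeasurableSpace Ω] {P : Measure Ω}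
    [IsProbabilityMeasure P] {c s b : ℝ} {M T : ℕ} (y : Fin M → ℝ)
    (sel : (Fin (gridSize b T) → ℝ) → Fin (gridSize b T)) {Θ : Type} (F : Θ → Measure ℝ)
    (est : (t : ℕ) → (Fin t → Fin M) → Θ) {ξ : ℕ → Ω → Fin M} (hξ : ∀ i, AEMeasurable (ξ i) P)
    (hM : 0 < M) : Integrable (fun ω => lunaRegret c s b y T sel F est fun i => ξ i ω) P := by
  set g : (Fin T → Fin M) → ℝ := fun z => lunaRegret c s b y T sel F est
    fun i => if h : i < T then z ⟨i, h⟩ else ⟨0, hM⟩ with hg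
  have h1 : (fun ω => lunaRegret c s b y T sel F est fun i => ξ i ω) =
      fun ω => g fun i : Fin T => ξ i ω := by
    funext ω
    simp only [hg, lunaRegret, PricingPolicy.regret]
    refine PricingPolicy.regretFrom_congr _ T 0 _ fun i hi => ?_
    have h2 : (fun j : Fin i => ξ j ω) =
        fun j : Fin i => if h : (j : ℕ) < T then ξ (⟨j, h⟩ : Fin T) ω else ⟨0, hM⟩ := by
      funext j
      rw [dif_pos (by have := j.isLt; omega)]
    funext w
    unfold fittedOrder
    rw [h2]
  rw [h1]
  clear_value g
  have hmeas : AEMeasurable (fun ω => fun i : Fin T => ξ i ω) P :=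
    aemeasurable_pi_lambda _ fun i => hξ i
  obtain ⟨B, hB⟩ := (Set.finite_range fun z => ‖g z‖).bddAbove
  refine Integrable.of_bound
    ((measurable_of_finite g).comp_aemeasurable hmeas).aestronglyMeasurable B ?_
  exact Filter.Eventually.of_forall fun ω => hB ⟨fun i : Fin T => ξ i ω, rfl⟩


/-! ### Tools for maximum likelihood estimators -/

theorem abs_perceived_sub_le (b : ℝ) (μ ν : Measure ℝ) (x : ℝ) {d : ℝ} (hd : 0 ≤ d)
    (h : |cdf μ x - cdf ν x| ≤ d) : |perceived b μ x - perceived b ν x| ≤ d := by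
  unfold perceived
  split_ifs
  · exact h
  · simpa using hd

/-- Total variation of the perceived distribution functions, when the change after period `i` is
at most `X / (i + 1)`. -/
theorem abs_perceived_sub_le_harm {b X : ℝ} {μ : ℕ → Measure ℝ} {T : ℕ} (hX : 1 ≤ X)
    (h : ∀ i, 1 ≤ i → i + 1 < T → ∀ q, 0 ≤ q →
      |cdf (μ (i + 1)) q - cdf (μ i) q| ≤ X / ((i : ℝ) + 1)) :
    ∀ t t', t ≤ t' → t' < T → ∀ q ∈ Set.Icc 0 b,
      |perceived b (μ t') q - perceived b (μ t) q| ≤ X * harm t' - X * harm t := by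
  intro t t' htt ht' q hq
  have h1 := abs_sub_le_sum (F := fun t => perceived b (μ t) q) (a := fun i => X * (1 / ((i : ℝ) + 1)))
    htt fun i hi => ?_
  · rwa [← Finset.mul_sum, ← Finset.mul_sum] at h1
  -- The fit without data is arbitrary; its change is at most `1 ≤ X`.
  · rcases Nat.eq_zero_or_pos i with rfl | hi0
    · refine (abs_perceived_sub_le_one _ _ _ _).trans ?_
      simpa using hX
    · refine abs_perceived_sub_le _ _ _ _ (by positivity) ?_
      rw [mul_one_div]
      exact h i hi0 (by omega) q hq.1

/-- Change of the sample mean by one more observation. -/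
theorem mean_succ_sub (S d : ℝ) {i : ℕ} (hi : 0 < i) :
    (S + d) / ((i + 1 : ℕ) : ℝ) - S / i = (d - S / i) / ((i : ℝ) + 1) := by
  have hi' : (0 : ℝ) < i := by exact_mod_cast hi
  push_cast
  field_simp
  ring

theorem sum_div_mem_Icc {f : ℕ → ℝ} {l u : ℝ} {t : ℕ} (ht : 0 < t)
    (h : ∀ i, i < t → l ≤ f i ∧ f i ≤ u) :
    l ≤ (∑ i ∈ Finset.range t, f i) / t ∧ (∑ i ∈ Finset.range t, f i) / t ≤ u := by
  have ht' : (0 : ℝ) < t := by exact_mod_cast ht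
  rw [le_div_iff₀ ht', div_le_iff₀ ht']
  have h1 : ∑ i ∈ Finset.range t, l ≤ ∑ i ∈ Finset.range t, f i :=
    Finset.sum_le_sum fun i hi => (h i (Finset.mem_range.1 hi)).1
  have h2 : ∑ i ∈ Finset.range t, f i ≤ ∑ i ∈ Finset.range t, u :=
    Finset.sum_le_sum fun i hi => (h i (Finset.mem_range.1 hi)).2
  simp only [Finset.sum_const, Finset.card_range, nsmul_eq_mul] at h1 h2
  constructor <;> linarith

/-- The function `S log l - t l` has a unique maximum, at `l = S / t`. -/
theorem eq_div_of_log_le {S t l : ℝ} (hS : 0 < S) (ht : 0 < t) (hl : 0 < l)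
    (h : S * Real.log (S / t) - S ≤ S * Real.log l - t * l) : l = S / t := by
  set u := l / (S / t) with hu
  have hu0 : 0 < u := by positivity
  have hlog : Real.log u = Real.log l - Real.log (S / t) :=
    Real.log_div hl.ne' (by positivity)
  have htl : t * l = S * u := by rw [hu]; field_simp
  by_contra hne
  have hu1 : u ≠ 1 := by
    intro h1
    rw [hu, div_eq_one_iff_eq (by positivity)] at h1
    exact hne h1
  have h1 := Real.log_lt_sub_one_of_pos hu0 hu1
  have h2 := mul_lt_mul_of_pos_left h1 hS
  rw [hlog] at h2
  linarith

/-- The left side is `e⁻² T⁻²`, and `e² ≥ 3`. A union over `T` events then costs `1 / (3 T)`, which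
leaves room for several unions within `1 / T`. -/
theorem ofReal_exp_neg_le {T : ℕ} (hT : 1 ≤ T) :
    Real.exp (-(2 * (1 + Real.log T))) ≤ 1 / (3 * (T : ℝ) * T) := by
  have hT' : (0 : ℝ) < T := by exact_mod_cast hT
  have h1 : Real.exp (2 * (1 + Real.log T)) = Real.exp 2 * (T * T) := by
    rw [mul_add, Real.exp_add, mul_one, two_mul (Real.log T), Real.exp_add, Real.exp_log hT']
  have h2 : (3 : ℝ) ≤ Real.exp 2 := by
    have := Real.add_one_le_exp (2 : ℝ)
    linarith
  rw [Real.exp_neg, h1, ← one_div]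
  apply one_div_le_one_div_of_le (by positivity)
  have := mul_le_mul_of_nonneg_right h2 (by positivity : (0 : ℝ) ≤ T * T)
  linarith

/-- Union bound for `T` events of small probability. -/
theorem measure_exists_lt_le {Ω : Type*} [MeasurableSpace Ω] {P : Measure Ω} {T : ℕ} (hT : 1 ≤ T)
    {B : ℕ → Set Ω}
    (h : ∀ i, i < T → P (B i) ≤ ENNReal.ofReal (Real.exp (-(2 * (1 + Real.log T))))) :
    P {ω | ∃ i, i < T ∧ ω ∈ B i} ≤ (3 * T : ℝ≥0∞)⁻¹ := by
  have hT' : (0 : ℝ) < T := by exact_mod_cast hT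
  have h1 : {ω | ∃ i, i < T ∧ ω ∈ B i} = ⋃ i ∈ Finset.range T, B i := by
    ext ω; simp
  rw [h1]
  calc P (⋃ i ∈ Finset.range T, B i) ≤ ∑ i ∈ Finset.range T, P (B i) :=
        measure_biUnion_finset_le _ _
    _ ≤ ∑ i ∈ Finset.range T, ENNReal.ofReal (1 / (3 * (T : ℝ) * T)) :=
        Finset.sum_le_sum fun i hi => (h i (Finset.mem_range.1 hi)).trans
          (ENNReal.ofReal_le_ofReal (ofReal_exp_neg_le hT))
    _ = ENNReal.ofReal (1 / (3 * T)) := by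
        rw [Finset.sum_const, Finset.card_range, nsmul_eq_mul, ← ENNReal.ofReal_natCast,
          ← ENNReal.ofReal_mul hT'.le]
        congr 1
        field_simp
    _ = (3 * T : ℝ≥0∞)⁻¹ := by
        rw [one_div, ENNReal.ofReal_inv_of_pos (by positivity),
          ENNReal.ofReal_mul (by norm_num), ENNReal.ofReal_natCast]
        norm_num

theorem inv_three_mul_le (T : ℕ) : (3 * T : ℝ≥0∞)⁻¹ ≤ (T : ℝ≥0∞)⁻¹ := by
  rw [ENNReal.inv_le_inv]
  exact le_mul_of_one_le_left zero_le (by norm_num)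

theorem inv_three_mul_add (T : ℕ) :
    (3 * T : ℝ≥0∞)⁻¹ + (3 * T : ℝ≥0∞)⁻¹ + (3 * T : ℝ≥0∞)⁻¹ = (T : ℝ≥0∞)⁻¹ := by
  rw [ENNReal.mul_inv (Or.inl (by norm_num)) (Or.inl (by norm_num)), ← add_mul, ← add_mul]
  have h : (3 : ℝ≥0∞)⁻¹ + 3⁻¹ + 3⁻¹ = 1 := by
    rw [← two_mul, ← add_one_mul]
    norm_num
    exact ENNReal.mul_inv_cancel (by norm_num) (by norm_num)
  rw [h, one_mul]

theorem rate_le_rate_add {C₁ C₂ ℓ B B' : ℝ} {k : ℕ} (hC : 0 ≤ C₁) (hC₂ : C₁ ≤ C₂) (hℓ : 0 ≤ ℓ) (hB : 0 ≤ B)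
    (hB' : 0 ≤ B') : C₁ * ℓ ^ k * B ≤ C₂ * ℓ ^ k * (B + B') := by
  have : 0 ≤ C₂ := hC.trans hC₂
  gcongr
  linarith

/-! ### Poisson demand -/

section Poisson

open scoped Nat

/-- Distribution function of the Poisson distribution with mean `l`. -/
def poissonSum (k : ℕ) (l : ℝ) : ℝ := ∑ n ∈ Finset.range k, Real.exp (-l) * l ^ n / n !

theorem cdf_poisson (l : ℝ≥0) {x : ℝ} (hx : 0 ≤ x) :
    cdf ((poissonMeasure l).map (fun n : ℕ => (n : ℝ))) x = poissonSum (⌊x⌋₊ + 1) l := by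
  have hmeas : Measurable (fun n : ℕ => (n : ℝ)) := measurable_from_top
  have : IsProbabilityMeasure ((poissonMeasure l).map (fun n : ℕ => (n : ℝ))) :=
    Measure.isProbabilityMeasure_map hmeas.aemeasurable
  rw [cdf_eq_real, Measure.real, Measure.map_apply hmeas measurableSet_Iic]
  have h1 : (fun n : ℕ => (n : ℝ)) ⁻¹' Set.Iic x = (Finset.range (⌊x⌋₊ + 1) : Set ℕ) := by
    ext n
    simp [Nat.le_floor_iff hx]
  rw [h1, ← Measure.real, ← sum_measureReal_singleton]
  exact Finset.sum_congr rfl fun n _ => poissonMeasure_real_singleton l n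

/-- The derivative of each summand is the difference of two consecutive Poisson weights, so the sum
telescopes. -/
theorem hasDerivAt_poissonSum (k : ℕ) (l : ℝ) :
    HasDerivAt (poissonSum (k + 1)) (-(Real.exp (-l) * l ^ k / k !)) l := by
  have hexp : HasDerivAt (fun x : ℝ => Real.exp (-x)) (-Real.exp (-l)) l := by
    simpa using (hasDerivAt_neg l).exp
  induction k with
  | zero =>
    have h : poissonSum (0 + 1) = fun x : ℝ => Real.exp (-x) := by
      funext x; simp [poissonSum]
    rw [h]
    simpa using hexp
  | succ k ih =>
    have h : poissonSum (k + 1 + 1) = fun x => poissonSum (k + 1) x +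
        Real.exp (-x) * x ^ (k + 1) / (k + 1)! := by
      funext x; exact Finset.sum_range_succ _ _
    rw [h]
    refine (ih.add ((hexp.mul (hasDerivAt_pow (k + 1) l)).div_const _)).congr_deriv ?_
    have h2 : ((k + 1)! : ℝ) = (k + 1) * k ! := by push_cast [Nat.factorial_succ]; ring
    have h3 : (k ! : ℝ) ≠ 0 := by positivity
    have h4 : ((k : ℝ) + 1) ≠ 0 := by positivity
    rw [h2]
    push_cast
    field_simp
    ring

/-- The derivative is minus a Poisson weight, hence at most `1` in absolute value, uniformly in `k`.
-/
theorem abs_poissonSum_sub_le (k : ℕ) {l l' : ℝ} (hl : 0 ≤ l) (hl' : 0 ≤ l') :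
    |poissonSum (k + 1) l - poissonSum (k + 1) l'| ≤ |l - l'| := by
  have h := (convex_Ici (0 : ℝ)).norm_image_sub_le_of_norm_hasDerivWithin_le
    (f := poissonSum (k + 1)) (C := 1)
    (fun x _ => (hasDerivAt_poissonSum k x).hasDerivWithinAt) (fun x hx => ?_) hl' hl
  · simpa [Real.norm_eq_abs] using h
  · have hx' : 0 ≤ x := hx
    rw [norm_neg, Real.norm_eq_abs, abs_of_nonneg (by positivity), mul_div_assoc]
    calc Real.exp (-x) * (x ^ k / k !) ≤ Real.exp (-x) * Real.exp x := by
          gcongr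
          exact Real.pow_div_factorial_le_exp _ hx' k
      _ = 1 := by rw [← Real.exp_add]; simp

theorem poissonSum_le_one (k : ℕ) (l : ℝ≥0) : poissonSum k l ≤ 1 :=
  sum_le_hasSum _ (fun _ _ => by positivity) (hasSum_one_poissonMeasure l)

theorem poissonSum_lt_one (k : ℕ) {l : ℝ≥0} (hl : 0 < l) : poissonSum k l < 1 := by
  refine lt_of_lt_of_le ?_ (poissonSum_le_one (k + 1) l)
  have hl' : (0 : ℝ) < l := by exact_mod_cast hl
  have h : poissonSum (k + 1) l = poissonSum k l + Real.exp (-l) * (l : ℝ) ^ k / k ! :=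
    Finset.sum_range_succ _ _
  rw [h]
  have : 0 < Real.exp (-l) * (l : ℝ) ^ k / k ! := by positivity
  linarith

theorem poissonSum_zero (k : ℕ) : poissonSum (k + 1) 0 = 1 := by
  unfold poissonSum
  rw [Finset.sum_eq_single 0]
  · simp
  · intro n _ hn
    simp [hn]
  · simp

/-- The maximum likelihood estimator of the mean of a Poisson distribution is the sample mean. -/
theorem IsMLE.poisson {est : (t : ℕ) → (Fin t → ℕ) → ℝ≥0}
    (h : IsMLE (fun (l : ℝ≥0) (n : ℕ) => (poissonMeasure l).real {n}) Set.univ est)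
    (ξ : ℕ → ℕ) {t : ℕ} (ht : 0 < t) :
    ((est t fun i => ξ i : ℝ≥0) : ℝ) = (∑ i ∈ Finset.range t, (ξ i : ℝ)) / t := by
  have ht' : (0 : ℝ) < t := by exact_mod_cast ht
  set S := ∑ i : Fin t, ξ i with hS
  have hSR : ∑ i ∈ Finset.range t, (ξ i : ℝ) = S := by
    rw [hS, Finset.sum_range (f := fun i => (ξ i : ℝ))]; push_cast; rfl
  set P := ∏ i : Fin t, ((ξ i)! : ℝ) with hP
  have hP0 : 0 < P := Finset.prod_pos fun i _ => by positivity
  have hlik : ∀ l : ℝ≥0, ∏ i : Fin t, (poissonMeasure l).real {ξ i} =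
      Real.exp (-(t * l)) * (l : ℝ) ^ S / P := by
    intro l
    simp only [poissonMeasure_real_singleton]
    rw [Finset.prod_div_distrib, Finset.prod_mul_distrib, Finset.prod_const, Finset.card_univ,
      Fintype.card_fin, Finset.prod_pow_eq_pow_sum, ← Real.exp_nat_mul]
    congr 3
    ring
  set l := est t (fun i => ξ i) with hl
  have hopt : ∀ θ : ℝ≥0, Real.exp (-(t * θ)) * (θ : ℝ) ^ S ≤ Real.exp (-(t * l)) * (l : ℝ) ^ S := by
    intro θ
    have h1 := h t (fun i => ξ i) (fun _ => Set.mem_univ _) θ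
    simp only [hlik] at h1
    rwa [div_le_div_iff_of_pos_right hP0] at h1
  rw [hSR]
  -- If all observations are `0`, the maximum is at the boundary; comparison with mean `0` replaces
  -- the logarithmic argument.
  rcases Nat.eq_zero_or_pos S with hS0 | hS0
  · have h1 := hopt 0
    simp only [hS0, pow_zero, mul_one, NNReal.coe_zero, mul_zero, neg_zero, Real.exp_zero] at h1
    have h2 : 0 ≤ -(t * (l : ℝ)) := by
      by_contra hcon
      have := Real.exp_lt_one_iff.2 (not_le.1 hcon)
      linarith
    have h3 : 0 ≤ (t : ℝ) * l := by positivity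
    have h4 : (t : ℝ) * l = 0 := by linarith
    rw [hS0]
    rcases mul_eq_zero.1 h4 with h5 | h5
    · exact absurd h5 ht'.ne'
    · simp [h5]
  · have hS' : (0 : ℝ) < S := by exact_mod_cast hS0
    have h1 := hopt ⟨S / t, by positivity⟩
    change Real.exp (-(t * (S / t : ℝ))) * ((S : ℝ) / t) ^ S ≤ _ at h1
    have h0 : 0 < Real.exp (-(t * (S / t : ℝ))) * ((S : ℝ) / t) ^ S := by positivity
    have hl0 : (0 : ℝ) < l := by
      refine lt_of_le_of_ne l.2 fun hl0 => ?_
      rw [← hl0, zero_pow hS0.ne', mul_zero] at h1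
      linarith
    have h2 := Real.log_le_log h0 h1
    rw [Real.log_mul (by positivity) (by positivity), Real.log_mul (by positivity) (by positivity),
      Real.log_exp, Real.log_exp, Real.log_pow, Real.log_pow] at h2
    refine eq_div_of_log_le hS' ht' hl0 ?_
    have h3 : (t : ℝ) * (S / t) = S := by field_simp
    rw [h3] at h2
    linarith

/-- Chernoff bound with exponent `1`. -/
theorem poissonMeasure_tail_le (l : ℝ≥0) (X : ℝ) :
    poissonMeasure l {n | X < (n : ℝ)} ≤
      ENNReal.ofReal (Real.exp (l * (Real.exp 1 - 1) - X)) := by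
  have hsum : HasSum (fun n : ℕ => Real.exp (-l) * (l : ℝ) ^ n / n ! * Real.exp n)
      (Real.exp (l * (Real.exp 1 - 1))) := by
    have h1 := (NormedSpace.expSeries_div_hasSum_exp ((l : ℝ) * Real.exp 1)).mul_left (Real.exp (-l))
    rw [← Real.exp_eq_exp_ℝ, ← Real.exp_add] at h1
    convert! h1 using 1
    · funext n
      rw [mul_pow, ← Real.exp_nat_mul, mul_one]
      ring
    · congr 1; ring
  have hint : Integrable (fun n : ℕ => Real.exp (n - X)) (poissonMeasure l) := by
    rw [integrable_poissonMeasure_iff]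
    have h2 := (hsum.mul_right (Real.exp (-X))).summable
    refine h2.congr fun n => ?_
    rw [Real.norm_eq_abs, abs_of_pos (Real.exp_pos _), sub_eq_add_neg, Real.exp_add]
    ring
  have hval : ∫ n : ℕ, Real.exp (n - X) ∂(poissonMeasure l) =
      Real.exp (l * (Real.exp 1 - 1) - X) := by
    rw [integral_poissonMeasure' hint, sub_eq_add_neg _ X, Real.exp_add, ← hsum.tsum_eq,
      ← tsum_mul_right]
    refine tsum_congr fun n => ?_
    rw [smul_eq_mul, sub_eq_add_neg, Real.exp_add]
    ring
  have h := mul_meas_ge_le_integral_of_nonneg (μ := poissonMeasure l)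
    (f := fun n : ℕ => Real.exp (n - X))
    (Filter.Eventually.of_forall fun n => (Real.exp_pos _).le) hint 1
  rw [hval, one_mul] at h
  calc poissonMeasure l {n | X < (n : ℝ)} ≤ poissonMeasure l {n : ℕ | 1 ≤ Real.exp (n - X)} := by
        refine measure_mono fun n (hn : X < (n : ℝ)) => ?_
        exact Real.one_le_exp (by linarith)
    _ = ENNReal.ofReal ((poissonMeasure l).real {n : ℕ | 1 ≤ Real.exp (n - X)}) := by
        rw [Measure.real, ENNReal.ofReal_toReal (measure_ne_top _ _)]
    _ ≤ _ := ENNReal.ofReal_le_ofReal h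

variable {s c : ℝ}

/-- Regret of LUNAC against the maximum likelihood estimator for Poisson demand. -/
theorem lunacRegret_poisson_le (hc : 0 ≤ c) (hcs : c < s) {q₀ κ : ℝ} (hq₀ : 0 < q₀) (hκ : 1 ≤ κ) :
    ∃ C : ℝ, 0 ≤ C ∧ ∀ (b : ℝ) (T : ℕ), q₀ ≤ b → 1 ≤ T →
      ∀ sel : (Fin (gridSize b T) → ℝ) → Fin (gridSize b T), IsArgmaxRule sel →
      ∀ est : (t : ℕ) → (Fin t → ℕ) → ℝ≥0,
        IsMLE (fun (l : ℝ≥0) (n : ℕ) => (poissonMeasure l).real {n}) Set.univ est →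
      ∀ ξ : ℕ → ℕ, (∀ i, i < T → (ξ i : ℝ) ≤ κ * (1 + Real.log T)) →
        lunacRegret c s b T sel (fun l : ℝ≥0 => (poissonMeasure l).map (fun n : ℕ => (n : ℝ))) est ξ
          ≤ C * (1 + Real.log T) ^ 6 * (b ^ (5 / 4 : ℝ) * (T : ℝ) ^ (3 / 4 : ℝ)) := by
  have hs : 0 < s := by linarith
  have hη : 0 < min 1 q₀ := lt_min one_pos hq₀
  obtain ⟨C, hC0, hC⟩ := lunac_regret_le_of_order_ge (V₀ := κ) hc hcs hq₀ (by linarith) hη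
  refine ⟨C, hC0, fun b T hb hT sel hsel est hest ξ hξ => ?_⟩
  have hb0 : 0 < b := by linarith
  have hT1 : (1 : ℝ) ≤ T := by exact_mod_cast hT
  set ℓ := 1 + Real.log T with hℓ
  have hℓ1 : 1 ≤ ℓ := by linarith [Real.log_nonneg hT1]
  set θ : ℕ → ℝ≥0 := fun t => est t fun i => ξ i with hθ
  set μ : ℕ → Measure ℝ := fun t => (poissonMeasure (θ t)).map (fun n : ℕ => (n : ℝ)) with hμ
  set F : ℕ → ℝ → ℝ := fun t => perceived b (μ t) with hF
  have hFb : ∀ t, F t b = 1 := fun t => perceived_self b _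
  have hθeq : ∀ t, 1 ≤ t → (θ t : ℝ) = (∑ i ∈ Finset.range t, (ξ i : ℝ)) / t := fun t ht =>
    hest.poisson ξ ht
  have hX : 1 ≤ κ * ℓ := by nlinarith
  have hκℓ : 0 ≤ κ * ℓ := by linarith
  -- One logarithm bounds the demands, a second one the harmonic sum; hence `ℓ ^ 2` in the role of
  -- `L`.
  have hmain := hC b T (ℓ ^ 2) hb hT (by nlinarith) sel F (fun t => κ * ℓ * harm t) hsel hFb
    (fun m n hmn => mul_le_mul_of_nonneg_left (harm_mono hmn) hκℓ) (by simp [harm]) ?_ ?_ ?_ ?_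
  · rw [← pow_mul] at hmain
    exact hmain
  · have := mul_le_mul_of_nonneg_left (harm_le T) hκℓ
    calc κ * ℓ * harm T ≤ κ * ℓ * ℓ := this
      _ = κ * ℓ ^ 2 := by ring
  · refine abs_perceived_sub_le_harm hX fun i hi hiT q hq => ?_
    simp only [hμ]
    rw [cdf_poisson _ hq, cdf_poisson _ hq]
    refine (abs_poissonSum_sub_le _ (NNReal.coe_nonneg _) (NNReal.coe_nonneg _)).trans ?_
    rw [hθeq _ (by omega), hθeq i hi, Finset.sum_range_succ, mean_succ_sub _ _ hi, abs_div,
      abs_of_pos (by positivity : (0 : ℝ) < (i : ℝ) + 1)]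
    have h1 := sum_div_mem_Icc (f := fun i => (ξ i : ℝ)) (l := 0) (u := κ * ℓ) hi
      fun j hj => ⟨Nat.cast_nonneg _, hξ j (by omega)⟩
    have h2 := hξ i (by omega)
    have h3 : (0 : ℝ) ≤ ξ i := Nat.cast_nonneg _
    gcongr
    rw [abs_le]
    constructor <;> linarith [h1.1, h1.2]
  · intro t t' w ht htt _ hw _
    -- A fitted mean `0` leads to the order `0`. A positive one stays positive, as the sum of the
    -- demands does not decrease, and then the order at price `0` is the cap `b`.
    rcases eq_or_ne (θ t) 0 with h0 | h0
    · refine le_trans (order_le_of_mem (b := b) subset_rfl (Set.left_mem_Icc.2 hb0.le) ?_)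
        (order_nonneg subset_rfl 0)
      have h1 : F t 0 = 1 := by
        simp only [hF, perceived, hb0, if_true, hμ, h0]
        rw [cdf_poisson _ le_rfl, NNReal.coe_zero, poissonSum_zero]
      rw [h1]
      have : 0 ≤ w / s := by positivity
      linarith
    · have hle : quantileOrder s b F t w ≤ b := order_le hs subset_rfl ⟨hb0.le, le_rfl⟩ (hFb t) hw
      refine hle.trans (le_order hs (Set.right_mem_Icc.2 hb0.le) (hFb t') le_rfl fun q hq hqb => ?_)
      have hθ' : 0 < θ t' := by
        have h1 : (0 : ℝ) < θ t := by
          exact_mod_cast lt_of_le_of_ne zero_le (Ne.symm h0)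
        rw [hθeq t ht] at h1
        have h2 : 0 < ∑ i ∈ Finset.range t, (ξ i : ℝ) := by
          by_contra hcon
          exact absurd h1 (not_lt.2 (div_nonpos_of_nonpos_of_nonneg (not_lt.1 hcon)
            (Nat.cast_nonneg _)))
        have h3 : ∑ i ∈ Finset.range t, (ξ i : ℝ) ≤ ∑ i ∈ Finset.range t', (ξ i : ℝ) :=
          Finset.sum_le_sum_of_subset_of_nonneg (Finset.range_mono htt)
            fun _ _ _ => Nat.cast_nonneg _
        have h4 : (0 : ℝ) < θ t' := by
          rw [hθeq t' (by omega)]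
          exact div_pos (by linarith) (by exact_mod_cast (show 0 < t' by omega))
        exact_mod_cast h4
      simp only [hF, perceived, hqb, if_true, hμ, zero_div, sub_zero]
      rw [cdf_poisson _ hq.1]
      exact poissonSum_lt_one _ hθ'
  · intro hTb t w hw _
    have hN := two_le_levelCount hb0 hTb
    have hle : quantileOrder s b F t w ≤ b := order_le hs subset_rfl ⟨hb0.le, le_rfl⟩ (hFb t) hw
    -- The fitted distribution function is constant on `[0, 1)` below the cap, so an order that is
    -- not `0` is at least `min 1 q₀`.
    by_cases h0 : 1 - w / s ≤ F t 0
    · left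
      have h1 : quantileOrder s b F t w = 0 :=
        le_antisymm (order_le_of_mem (b := b) subset_rfl (Set.left_mem_Icc.2 hb0.le) h0)
          (order_nonneg subset_rfl w)
      rw [h1, roundUp_zero hb0.le (by omega)]
    · right
      refine le_trans ?_ (roundUp_mem_set hN hle).2
      refine le_order hs (Set.right_mem_Icc.2 hb0.le) (hFb t) hw fun q hq hq1 => ?_
      have h1 : q < 1 := hq1.trans_le (min_le_left _ _)
      have h2 : q < b := hq1.trans_le ((min_le_right _ _).trans hb)
      have h3 : F t q = F t 0 := by
        simp only [hF, perceived, h2, hb0, if_true, hμ]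
        rw [cdf_poisson _ hq.1, cdf_poisson _ le_rfl, Nat.floor_eq_zero.2 h1, Nat.floor_zero]
      rw [h3]
      exact not_le.1 h0

/-- Regret of LUNAC for Poisson demand, with high probability. -/
theorem lunac_poisson (hc : 0 ≤ c) (hcs : c < s) (lam : ℝ≥0) {q₀ : ℝ} (hq₀ : 0 < q₀) :
    ∃ (C : ℝ) (k : ℕ),
      ∀ (b : ℝ) (T : ℕ), q₀ ≤ b → 1 ≤ T →
      ∀ sel : (Fin (gridSize b T) → ℝ) → Fin (gridSize b T), IsArgmaxRule sel →
      ∀ est : (t : ℕ) → (Fin t → ℕ) → ℝ≥0,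
        IsMLE (fun (l : ℝ≥0) (n : ℕ) => (poissonMeasure l).real {n}) Set.univ est →
      ∀ (Ω : Type*) [MeasurableSpace Ω] (P : Measure Ω) [IsProbabilityMeasure P] (ξ : ℕ → Ω → ℕ),
        (∀ i, HasLaw (ξ i) (poissonMeasure lam) P) →
        P {ω | C * (1 + Real.log T) ^ k *
              (b ^ (5 / 4 : ℝ) * (T : ℝ) ^ (3 / 4 : ℝ) + b ^ (17 / 12 : ℝ) * (T : ℝ) ^ (7 / 12 : ℝ))
            < lunacRegret c s b T sel
                (fun l : ℝ≥0 => (poissonMeasure l).map (fun n : ℕ => (n : ℝ))) est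
                (fun i => ξ i ω)} ≤ (T : ℝ≥0∞)⁻¹ := by
  have he : 0 ≤ Real.exp 1 - 1 := by
    have := Real.one_le_exp (zero_le_one (α := ℝ))
    linarith
  -- With this `κ` the exponent in the tail bound is at most `-2 (1 + log T)`.
  set κ := (lam : ℝ) * (Real.exp 1 - 1) + 2 with hκ
  have hκ2 : 0 ≤ (lam : ℝ) * (Real.exp 1 - 1) := mul_nonneg lam.2 he
  obtain ⟨C, hC0, hC⟩ := lunacRegret_poisson_le hc hcs hq₀ (show 1 ≤ κ by linarith)
  refine ⟨C, 6, fun b T hb hT sel hsel est hest Ω _ P _ ξ hlaw => ?_⟩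
  have hT1 : (1 : ℝ) ≤ T := by exact_mod_cast hT
  have hℓ1 : 1 ≤ 1 + Real.log T := by linarith [Real.log_nonneg hT1]
  have hb0 : 0 < b := by linarith
  have hprob : P {ω | ∃ i, i < T ∧ ω ∈ {ω | κ * (1 + Real.log T) < (ξ i ω : ℝ)}} ≤
      (3 * T : ℝ≥0∞)⁻¹ := by
    refine measure_exists_lt_le hT fun i _ => ?_
    rw [(hlaw i).measure_eq (p := fun n : ℕ => κ * (1 + Real.log T) < (n : ℝ))
      (MeasurableSet.of_discrete)]
    refine (poissonMeasure_tail_le lam _).trans (ENNReal.ofReal_le_ofReal (Real.exp_le_exp.2 ?_))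
    nlinarith
  refine (measure_mono fun ω hω => ?_).trans (hprob.trans (inv_three_mul_le T))
  by_contra hcon
  simp only [Set.mem_ofPred_eq, not_exists, not_and, not_lt] at hcon
  have h1 := hC b T hb hT sel hsel est hest (fun i => ξ i ω) hcon
  have h2 : (0 : ℝ) ≤ b ^ (17 / 12 : ℝ) * (T : ℝ) ^ (7 / 12 : ℝ) := by positivity
  exact absurd (h1.trans (rate_le_rate_add hC0 le_rfl (by linarith) (by positivity) h2))
    (not_le.2 hω)

end Poisson

/-! ### Categorical demand -/

theorem luna_categorical {s c : ℝ} (hc : 0 ≤ c) (hcs : c < s) {η : ℝ} (hη : 0 < η) :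
    ∃ (C : ℝ) (k : ℕ),
      ∀ (M : ℕ) (y : Fin M → ℝ) (b : ℝ) (T : ℕ), (∀ m, 0 ≤ y m) →
        (∀ m, 0 < y m → η ≤ y m) → IsGreatest (Set.range y) b → 0 < b → 1 ≤ T →
      ∀ sel : (Fin (gridSize b T) → ℝ) → Fin (gridSize b T), IsArgmaxRule sel →
      ∀ est : (t : ℕ) → (Fin t → Fin M) → PMF (Fin M),
        IsMLE (fun (p : PMF (Fin M)) (m : Fin M) => (p m).toReal) Set.univ est →
      ∀ (p₀ : PMF (Fin M)) (Ω : Type*) [MeasurableSpace Ω] (P : Measure Ω) [IsProbabilityMeasure P]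
        (ξ : ℕ → Ω → Fin M), (∀ i, HasLaw (ξ i) p₀.toMeasure P) →
        (∀ᵐ ω ∂P, lunaRegret c s b y T sel (fun p : PMF (Fin M) => p.toMeasure.map y) est
              (fun i => ξ i ω)
            ≤ C * (1 + Real.log T) ^ k *
                (b ^ (4 / 3 : ℝ) * (M : ℝ) ^ (1 / 3 : ℝ) * (T : ℝ) ^ (2 / 3 : ℝ))) ∧
        Integrable (fun ω => lunaRegret c s b y T sel (fun p : PMF (Fin M) => p.toMeasure.map y) est
              (fun i => ξ i ω)) P ∧
        ∫ ω, lunaRegret c s b y T sel (fun p : PMF (Fin M) => p.toMeasure.map y) est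
              (fun i => ξ i ω) ∂P
            ≤ C * (1 + Real.log T) ^ k *
                (b ^ (4 / 3 : ℝ) * (M : ℝ) ^ (1 / 3 : ℝ) * (T : ℝ) ^ (2 / 3 : ℝ)) := by
  obtain ⟨C, _, hC⟩ := lunaRegret_le hc hcs hη
  refine ⟨C, 1, fun M y b T hy0 hyη hyb hb hT sel hsel est hest p₀ Ω _ P _ ξ hlaw => ?_⟩
  have hM : 0 < M := by
    obtain ⟨m, _⟩ := hyb.1
    exact m.pos
  have hbound : ∀ ω, lunaRegret c s b y T sel (fun p : PMF (Fin M) => p.toMeasure.map y) est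
      (fun i => ξ i ω) ≤ C * (1 + Real.log T) ^ 1 *
        (b ^ (4 / 3 : ℝ) * (M : ℝ) ^ (1 / 3 : ℝ) * (T : ℝ) ^ (2 / 3 : ℝ)) := fun ω => by
    rw [pow_one]
    exact hC M y b T hy0 hyη hyb hb hT sel hsel est hest _
  have hint := integrable_lunaRegret (c := c) (s := s) y sel
    (fun p : PMF (Fin M) => p.toMeasure.map y) est (fun i => (hlaw i).aemeasurable) hM
  refine ⟨Filter.Eventually.of_forall hbound, hint, ?_⟩
  refine (integral_mono hint (integrable_const _) hbound).trans ?_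
  simp


/-! ### Exponential demand -/

section Exponential

theorem exponentialPDFReal_of_pos {l x : ℝ} (hx : 0 < x) :
    exponentialPDFReal l x = l * Real.exp (-(l * x)) := by
  simp [exponentialPDFReal, gammaPDFReal, hx.le]

/-- The maximum likelihood estimator of the rate of an exponential distribution is the inverse of
the sample mean. -/
theorem IsMLE.exponential {est : (t : ℕ) → (Fin t → ℝ) → Set.Ioi (0 : ℝ)}
    (h : IsMLE (fun (l : Set.Ioi (0 : ℝ)) (x : ℝ) => exponentialPDFReal l x) (Set.Ioi 0) est)
    (ξ : ℕ → ℝ) {t : ℕ} (ht : 0 < t) (hξ : ∀ i, i < t → 0 < ξ i) :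
    ((est t fun i => ξ i : Set.Ioi (0 : ℝ)) : ℝ) = t / ∑ i ∈ Finset.range t, ξ i := by
  have ht' : (0 : ℝ) < t := by exact_mod_cast ht
  set S := ∑ i ∈ Finset.range t, ξ i with hS
  have hS0 : 0 < S := Finset.sum_pos (fun i hi => hξ i (Finset.mem_range.1 hi)) ⟨0, by simpa⟩
  have hlik : ∀ l : ℝ, ∏ i : Fin t, exponentialPDFReal l (ξ i) =
      l ^ t * Real.exp (-(S * l)) := by
    intro l
    rw [Finset.prod_congr rfl fun (i : Fin t) _ => exponentialPDFReal_of_pos (l := l) (hξ i.1 i.2),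
      Finset.prod_mul_distrib, Finset.prod_const, Finset.card_univ, Fintype.card_fin,
      ← Real.exp_sum, hS, Finset.sum_range, Finset.sum_neg_distrib, ← Finset.mul_sum, mul_comm l]
  set l := est t (fun i => ξ i) with hl
  have hl0 : (0 : ℝ) < l := l.2
  have h1 := h t (fun i => ξ i) (fun i => hξ i i.2) ⟨t / S, div_pos ht' hS0⟩
  simp only [hlik] at h1
  have h2 := Real.log_le_log (by positivity) h1
  rw [Real.log_mul (by positivity) (by positivity), Real.log_mul (by positivity) (by positivity),
    Real.log_exp, Real.log_exp, Real.log_pow, Real.log_pow] at h2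
  refine eq_div_of_log_le ht' hS0 hl0 ?_
  have h3 : S * (t / S) = t := by field_simp
  rw [h3] at h2
  linarith

/-- The bound is uniform in `q` since `x e⁻ˣ ≤ 1`: by scaling, only the ratio of the rates counts.
-/
theorem exp_neg_mul_sub_le {l l' q : ℝ} (hl : 0 < l) (hll : l ≤ l') :
    Real.exp (-(l * q)) - Real.exp (-(l' * q)) ≤ l' / l - 1 := by
  have h1 : 1 - Real.exp (-((l' - l) * q)) ≤ (l' - l) * q := by
    linarith [Real.add_one_le_exp (-((l' - l) * q))]
  have h2 : Real.exp (-(l * q)) * (l * q) ≤ 1 := by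
    have h := Real.add_one_le_exp (l * q)
    calc Real.exp (-(l * q)) * (l * q) ≤ Real.exp (-(l * q)) * Real.exp (l * q) := by
          gcongr; linarith
      _ = 1 := by rw [← Real.exp_add]; simp
  have h3 : Real.exp (-(l' * q)) = Real.exp (-(l * q)) * Real.exp (-((l' - l) * q)) := by
    rw [← Real.exp_add]; congr 1; ring
  have h4 : 0 ≤ l' / l - 1 := by
    rw [sub_nonneg, one_le_div hl]; exact hll
  calc Real.exp (-(l * q)) - Real.exp (-(l' * q))
      = Real.exp (-(l * q)) * (1 - Real.exp (-((l' - l) * q))) := by rw [h3]; ring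
    _ ≤ Real.exp (-(l * q)) * ((l' - l) * q) := by gcongr
    _ = Real.exp (-(l * q)) * (l * q) * (l' / l - 1) := by field_simp
    _ ≤ 1 * (l' / l - 1) := by gcongr
    _ = _ := one_mul _

/-- Change of the fitted distribution function by one more observation. -/
theorem abs_exp_neg_div_sub_le {a X S x q : ℝ} {i : ℕ} (ha : 0 < a) (hi : 1 ≤ i) (hS : a * i ≤ S)
    (hx : 0 < x) (hxX : x ≤ X) (hq : 0 ≤ q) :
    |Real.exp (-(((i + 1 : ℕ) : ℝ) / (S + x) * q)) - Real.exp (-(i / S * q))| ≤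
      2 / ((i : ℝ) + 1) + 2 * X / (a * ((i : ℝ) + 1)) := by
  have hi1 : (1 : ℝ) ≤ i := by exact_mod_cast hi
  have hi0 : (0 : ℝ) < i := by linarith
  have hS0 : 0 < S := lt_of_lt_of_le (by positivity) hS
  have hX : 0 < X := hx.trans_le hxX
  have hn1 : 0 ≤ 2 / ((i : ℝ) + 1) := by positivity
  have hn2 : 0 ≤ 2 * X / (a * ((i : ℝ) + 1)) := by positivity
  set l := (i : ℝ) / S with hl
  set l' := ((i + 1 : ℕ) : ℝ) / (S + x) with hl'
  have hl0 : 0 < l := by positivity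
  have hl0' : 0 < l' := by positivity
  have hup : l' / l - 1 ≤ 2 / ((i : ℝ) + 1) := by
    have h1 : l' / l ≤ ((i : ℝ) + 1) / i := by
      rw [hl, hl', div_div_div_eq, div_le_div_iff₀ (by positivity) hi0]
      push_cast
      have : ((i : ℝ) + 1) * S * i ≤ ((i : ℝ) + 1) * (S + x) * i := by gcongr; linarith
      linarith
    have h2 : ((i : ℝ) + 1) / i - 1 = 1 / i := by field_simp; ring
    have h3 : 1 / (i : ℝ) ≤ 2 / ((i : ℝ) + 1) := by
      rw [div_le_div_iff₀ hi0 (by positivity)]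
      linarith
    linarith
  have hdown : l / l' - 1 ≤ 2 * X / (a * ((i : ℝ) + 1)) := by
    have h1 : l / l' ≤ (S + x) / S := by
      rw [hl, hl', div_div_div_eq, div_le_div_iff₀ (by positivity) hS0]
      push_cast
      have : (i : ℝ) * (S + x) * S ≤ (i + 1) * (S + x) * S := by gcongr; linarith
      linarith
    have h2 : (S + x) / S - 1 = x / S := by field_simp; ring
    have h3 : x / S ≤ X / (a * i) := by gcongr
    have h4 : X / (a * i) ≤ 2 * X / (a * ((i : ℝ) + 1)) := by
      rw [div_le_div_iff₀ (by positivity) (by positivity)]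
      have : X * a * ((i : ℝ) + 1) ≤ X * a * (2 * i) := by gcongr; linarith
      linarith
    linarith
  rcases le_total l l' with hle | hle
  · have h1 := exp_neg_mul_sub_le hl0 hle (q := q)
    have h2 : Real.exp (-(l' * q)) ≤ Real.exp (-(l * q)) := by
      rw [Real.exp_le_exp]
      have := mul_le_mul_of_nonneg_right hle hq
      linarith
    rw [abs_le]
    constructor <;> linarith
  · have h1 := exp_neg_mul_sub_le hl0' hle (q := q)
    have h2 : Real.exp (-(l * q)) ≤ Real.exp (-(l' * q)) := by
      rw [Real.exp_le_exp]
      have := mul_le_mul_of_nonneg_right hle hq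
      linarith
    rw [abs_le]
    constructor <;> linarith

theorem cdf_exponential {l q : ℝ} (hl : 0 < l) (hq : 0 ≤ q) :
    cdf (expMeasure l) q = 1 - Real.exp (-(l * q)) := by
  rw [cdf_expMeasure_eq hl, if_pos hq]

/-- Multiplying the density of rate `l` by `exp (-l x)` gives half the density of rate `2 l`. -/
theorem mgf_exponential {l : ℝ} (hl : 0 < l) : mgf id (expMeasure l) (-l) = 1 / 2 := by
  have h2 : 0 < 2 * l := by positivity
  rw [mgf, integral_eq_lintegral_of_nonneg_ae (Filter.Eventually.of_forall fun x => by positivity)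
    (by fun_prop)]
  have h1 : ∫⁻ x, ENNReal.ofReal (Real.exp (-l * id x)) ∂(expMeasure l) =
      ENNReal.ofReal (1 / 2) := by
    rw [expMeasure, gammaMeasure, lintegral_withDensity_eq_lintegral_mul _ (by
      exact (measurable_gammaPDFReal 1 l).ennreal_ofReal) (by fun_prop)]
    calc _ = ∫⁻ x, ENNReal.ofReal (1 / 2) * exponentialPDF (2 * l) x := by
          refine lintegral_congr fun x => ?_
          change exponentialPDF l x * _ = _
          rw [exponentialPDF_eq, exponentialPDF_eq, ← ENNReal.ofReal_mul (by positivity),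
            ← ENNReal.ofReal_mul (by positivity)]
          congr 1
          split_ifs
          · rw [mul_assoc, ← Real.exp_add, ← mul_assoc]
            congr 1
            · ring
            · congr 1; simp only [id]; ring
          · simp
      _ = ENNReal.ofReal (1 / 2) := by
          rw [lintegral_const_mul _ (by
            exact (measurable_exponentialPDFReal _).ennreal_ofReal),
            lintegral_exponentialPDF_eq_one h2, mul_one]
  rw [h1, ENNReal.toReal_ofReal (by norm_num)]

/-- Lower deviations of the sum of independent exponential random variables. -/
theorem measure_sum_exponential_lt_le {Ω : Type*} [MeasurableSpace Ω] {P : Measure Ω}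
    [IsProbabilityMeasure P] {ξ : ℕ → Ω → ℝ} {l : ℝ} (hl : 0 < l) (hind : iIndepFun ξ P)
    (hlaw : ∀ i, HasLaw (ξ i) (expMeasure l) P) (t : ℕ) :
    P {ω | ∑ i ∈ Finset.range t, ξ i ω < 1 / (4 * l) * t} ≤
      ENNReal.ofReal (Real.exp (-(2 / 5 * t))) := by
  have hm : ∀ i, mgf (ξ i) P (-l) = 1 / 2 := fun i => by
    rw [← mgf_id_map (hlaw i).aemeasurable, (hlaw i).map_eq, mgf_exponential hl]
  have hsum : mgf (∑ i ∈ Finset.range t, ξ i) P (-l) = (1 / 2) ^ t := by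
    rw [hind.mgf_sum₀ (fun i => (hlaw i).aemeasurable)]
    simp [hm]
  -- The integral of a function that is not integrable is `0` by convention, but the moment
  -- generating function is not `0` here.
  have hint : Integrable (fun ω => Real.exp (-l * (∑ i ∈ Finset.range t, ξ i) ω)) P := by
    by_contra hcon
    have := integral_undef hcon
    change mgf (∑ i ∈ Finset.range t, ξ i) P (-l) = 0 at this
    rw [hsum] at this
    exact (pow_ne_zero t (by norm_num)) this
  have h := measure_le_le_exp_mul_mgf (1 / (4 * l) * t) (neg_nonpos.2 hl.le) hint
  rw [hsum] at h
  -- The exponent per observation is `1 / 4 - log 2`, which is less than `-2 / 5`.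
  have hexp : Real.exp (- -l * (1 / (4 * l) * t)) * (1 / 2) ^ t ≤ Real.exp (-(2 / 5 * t)) := by
    have h1 : ((1 : ℝ) / 2) ^ t = Real.exp (-(t * Real.log 2)) := by
      rw [Real.exp_neg, Real.exp_nat_mul, Real.exp_log (by norm_num), one_div, inv_pow]
    rw [h1, ← Real.exp_add, Real.exp_le_exp]
    have h2 : - -l * (1 / (4 * l) * (t : ℝ)) = t / 4 := by field_simp
    rw [h2]
    have h3 := Real.log_two_gt_d9
    have h4 : (0 : ℝ) ≤ t := Nat.cast_nonneg t
    nlinarith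
  calc P {ω | ∑ i ∈ Finset.range t, ξ i ω < 1 / (4 * l) * t}
      ≤ P {ω | (∑ i ∈ Finset.range t, ξ i) ω ≤ 1 / (4 * l) * t} := by
        refine measure_mono (Set.ofPred_subset_ofPred.2 fun ω hω => ?_)
        rw [Finset.sum_apply]
        exact hω.le
    _ = ENNReal.ofReal (P.real {ω | (∑ i ∈ Finset.range t, ξ i) ω ≤ 1 / (4 * l) * t}) := by
        rw [Measure.real, ENNReal.ofReal_toReal (measure_ne_top _ _)]
    _ ≤ _ := ENNReal.ofReal_le_ofReal (h.trans hexp)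

theorem expMeasure_tail_le {l : ℝ} (hl : 0 < l) {X : ℝ} (hX : 0 ≤ X) :
    expMeasure l {x | X < x} ≤ ENNReal.ofReal (Real.exp (-(l * X))) := by
  have := isProbabilityMeasure_expMeasure hl
  have h1 : {x : ℝ | X < x} = (Set.Iic X)ᶜ := by ext; simp
  rw [h1, prob_compl_eq_one_sub measurableSet_Iic, ← ofReal_cdf, cdf_exponential hl hX]
  rw [ENNReal.ofReal_sub _ (Real.exp_pos _).le, ENNReal.ofReal_one, ENNReal.sub_sub_cancel]
  · simp
  · rw [ENNReal.ofReal_le_one, Real.exp_le_one_iff]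
    simp only [Left.neg_nonpos_iff]; positivity

theorem expMeasure_pos {l : ℝ} (hl : 0 < l) : ∀ᵐ x ∂(expMeasure l), 0 < x := by
  have := isProbabilityMeasure_expMeasure hl
  rw [ae_iff]
  have h1 : {x : ℝ | ¬ 0 < x} = Set.Iic 0 := by ext; simp
  rw [h1, ← ofReal_cdf, cdf_exponential hl le_rfl]
  simp

variable {s c : ℝ}

/-- Regret of LUNAC against the maximum likelihood estimator for exponential demand. -/
theorem lunacRegret_exponential_le (hc : 0 ≤ c) (hcs : c < s) {q₀ κ a τ : ℝ} (hq₀ : 0 < q₀)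
    (hκ : 0 < κ) (ha : 0 < a) (hτ : 1 ≤ τ) :
    ∃ C : ℝ, 0 ≤ C ∧ ∀ (b : ℝ) (T : ℕ), q₀ ≤ b → 1 ≤ T →
      ∀ sel : (Fin (gridSize b T) → ℝ) → Fin (gridSize b T), IsArgmaxRule sel →
      ∀ est : (t : ℕ) → (Fin t → ℝ) → Set.Ioi (0 : ℝ),
        IsMLE (fun (l : Set.Ioi (0 : ℝ)) (x : ℝ) => exponentialPDFReal l x) (Set.Ioi 0) est →
      ∀ ξ : ℕ → ℝ, (∀ i, 0 < ξ i) → (∀ i, i < T → ξ i ≤ κ * (1 + Real.log T)) →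
        (∀ t : ℕ, t < T → τ * (1 + Real.log T) ≤ t → a * t ≤ ∑ i ∈ Finset.range t, ξ i) →
        lunacRegret c s b T sel (fun l : Set.Ioi (0 : ℝ) => expMeasure l) est ξ
          ≤ C * (1 + Real.log T) ^ 6 * (b ^ (5 / 4 : ℝ) * (T : ℝ) ^ (3 / 4 : ℝ)) := by
  have hs : 0 < s := by linarith
  -- Any price strictly between `c` and `s` would do: at a fitted rate of at most `1 / a`, the order
  -- at `w₁` is at least `a log (s / w₁)`, up to the cap.
  set w₁ := (c + s) / 2 with hw₁
  have hw₁0 : 0 < w₁ := by rw [hw₁]; linarith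
  have hw₁s : w₁ < s := by rw [hw₁]; linarith
  have hlog : 0 < Real.log (s / w₁) := Real.log_pos ((one_lt_div hw₁0).2 hw₁s)
  set q₁ := min q₀ (a * Real.log (s / w₁)) with hq₁
  have hq₁0 : 0 < q₁ := lt_min hq₀ (by positivity)
  set V := τ + 3 + 2 * κ / a with hV
  have hV1 : 1 ≤ V := by
    have : 0 < 2 * κ / a := by positivity
    linarith
  obtain ⟨C, hC0, hC⟩ := lunac_regret_le_of_profitable (V₀ := V) (w₁ := w₁) (q₁ := q₁) (τ := τ)
    hc hcs hq₀ (by linarith) (by rw [hw₁]; linarith) hw₁s.le hq₁0 (by linarith)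
  refine ⟨C, hC0, fun b T hb hT sel hsel est hest ξ hpos hξ hsum => ?_⟩
  have hb0 : 0 < b := by linarith
  have hT1 : (1 : ℝ) ≤ T := by exact_mod_cast hT
  set ℓ := 1 + Real.log T with hℓ
  have hℓ1 : 1 ≤ ℓ := by linarith [Real.log_nonneg hT1]
  set θ : ℕ → Set.Ioi (0 : ℝ) := fun t => est t fun i => ξ i with hθ
  have hθ0 : ∀ t, (0 : ℝ) < θ t := fun t => (θ t).2
  set μ : ℕ → Measure ℝ := fun t => expMeasure (θ t) with hμ
  set F : ℕ → ℝ → ℝ := fun t => perceived b (μ t) with hF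
  have hFb : ∀ t, F t b = 1 := fun t => perceived_self b _
  have hFq : ∀ t q, 0 ≤ q → q < b → F t q = 1 - Real.exp (-(θ t * q)) := fun t q hq hqb => by
    simp only [hF, perceived, hqb, if_true, hμ]
    exact cdf_exponential (hθ0 t) hq
  set S : ℕ → ℝ := fun t => ∑ i ∈ Finset.range t, ξ i with hS
  have hθeq : ∀ t, 1 ≤ t → (θ t : ℝ) = t / S t := fun t ht =>
    hest.exponential ξ ht fun i _ => hpos i
  have hX : 1 ≤ V * ℓ := by nlinarith
  have hVℓ : 0 ≤ V * ℓ := by linarith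
  have hmain := hC b T (ℓ ^ 2) hb hT (by nlinarith) sel F (fun t => V * ℓ * harm t) hsel hFb
    (fun m n hmn => mul_le_mul_of_nonneg_left (harm_mono hmn) hVℓ) (by simp [harm]) ?_ ?_ ?_ ?_
  · rw [← pow_mul] at hmain
    exact hmain
  · have := mul_le_mul_of_nonneg_left (harm_le T) hVℓ
    calc V * ℓ * harm T ≤ V * ℓ * ℓ := this
      _ = V * ℓ ^ 2 := by ring
  · refine abs_perceived_sub_le_harm hX fun i hi hiT q hq => ?_
    have hi0 : (0 : ℝ) < i := by exact_mod_cast hi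
    have hi1 : (1 : ℝ) ≤ i := by exact_mod_cast hi
    simp only [hμ]
    rw [cdf_exponential (hθ0 _) hq, cdf_exponential (hθ0 _) hq]
    -- Before time `τ ℓ` the sample mean may be tiny; there the change is at most `1`, which `V`
    -- absorbs through its summand `τ + 3`.
    rcases lt_or_ge (i : ℝ) (τ * ℓ) with hiτ | hiτ
    · have h1 : ∀ t, 0 ≤ Real.exp (-(θ t * q)) ∧ Real.exp (-(θ t * q)) ≤ 1 := fun t => by
        refine ⟨(Real.exp_pos _).le, Real.exp_le_one_iff.2 ?_⟩
        have := mul_nonneg (hθ0 t).le hq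
        linarith
      have h2 : 1 ≤ V * ℓ / ((i : ℝ) + 1) := by
        rw [le_div_iff₀ (by positivity)]
        have : (τ + 1) * ℓ ≤ V * ℓ := by
          gcongr
          have : 0 < 2 * κ / a := by positivity
          linarith
        linarith
      refine le_trans ?_ h2
      rw [abs_le]
      constructor <;> linarith [(h1 i).1, (h1 i).2, (h1 (i + 1)).1, (h1 (i + 1)).2]
    · have hSs : S (i + 1) = S i + ξ i := Finset.sum_range_succ _ _
      have h1 := abs_exp_neg_div_sub_le ha hi (hsum i (by omega) hiτ) (hpos i) (hξ i (by omega)) hq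
      have h2 : |(1 - Real.exp (-(θ (i + 1) * q))) - (1 - Real.exp (-(θ i * q)))| =
          |Real.exp (-(((i + 1 : ℕ) : ℝ) / (S i + ξ i) * q)) - Real.exp (-(i / S i * q))| := by
        rw [hθeq i hi, hθeq (i + 1) (by omega), hSs, sub_sub_sub_cancel_left, abs_sub_comm]
      rw [h2]
      refine h1.trans ?_
      have h3 : 2 / ((i : ℝ) + 1) + 2 * (κ * ℓ) / (a * ((i : ℝ) + 1)) =
          (2 + 2 * κ / a * ℓ) / ((i : ℝ) + 1) := by field_simp
      rw [h3]
      gcongr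
      have h4 : 0 < 2 * κ / a * ℓ := by positivity
      have h5 : 2 ≤ (τ + 3) * ℓ := by nlinarith
      calc 2 + 2 * κ / a * ℓ ≤ (τ + 3) * ℓ + 2 * κ / a * ℓ := by linarith
        _ = V * ℓ := by rw [hV]; ring
  · intro t t' w ht htt _ hw _
    have hle : quantileOrder s b F t w ≤ b := order_le hs subset_rfl ⟨hb0.le, le_rfl⟩ (hFb t) hw
    refine hle.trans (le_order hs (Set.right_mem_Icc.2 hb0.le) (hFb t') le_rfl fun q hq hqb => ?_)
    rw [hFq _ _ hq.1 hqb, zero_div, sub_zero]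
    linarith [Real.exp_pos (-(θ t' * q))]
  · intro t ht htT
    have ht1 : τ * ℓ ≤ t := le_trans (by gcongr; nlinarith) ht
    have ht0 : (1 : ℝ) ≤ t := by nlinarith
    have ht0' : 1 ≤ t := by exact_mod_cast ht0
    refine le_order hs (Set.right_mem_Icc.2 hb0.le) (hFb t) hw₁0.le fun q hq hqq => ?_
    have hqb : q < b := hqq.trans_le ((min_le_left _ _).trans hb)
    rw [hFq _ _ hq.1 hqb]
    have h1 : q < a * Real.log (s / w₁) := hqq.trans_le (min_le_right _ _)
    have hSt := hsum t htT ht1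
    have h2 : (θ t : ℝ) ≤ 1 / a := by
      rw [hθeq t ht0', div_le_div_iff₀ (lt_of_lt_of_le (by positivity) hSt) ha]
      linarith
    have h3 : θ t * q < Real.log (s / w₁) := by
      calc θ t * q ≤ 1 / a * q := by gcongr; exact hq.1
        _ < 1 / a * (a * Real.log (s / w₁)) := by gcongr
        _ = _ := by field_simp
    have h4 : w₁ / s < Real.exp (-(θ t * q)) := by
      rw [← Real.log_lt_iff_lt_exp (by positivity)]
      rw [Real.log_div hs.ne' hw₁0.ne'] at h3
      rw [Real.log_div hw₁0.ne' hs.ne']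
      linarith
    linarith

/-- Regret of LUNAC for exponential demand, with high probability. -/
theorem lunac_exponential (hc : 0 ≤ c) (hcs : c < s) {lam : ℝ} (hlam : 0 < lam) {q₀ : ℝ}
    (hq₀ : 0 < q₀) :
    ∃ (C : ℝ) (k : ℕ),
      ∀ (b : ℝ) (T : ℕ), q₀ ≤ b → 1 ≤ T →
      ∀ sel : (Fin (gridSize b T) → ℝ) → Fin (gridSize b T), IsArgmaxRule sel →
      ∀ est : (t : ℕ) → (Fin t → ℝ) → Set.Ioi (0 : ℝ),
        IsMLE (fun (l : Set.Ioi (0 : ℝ)) (x : ℝ) => exponentialPDFReal l x) (Set.Ioi 0) est →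
      ∀ (Ω : Type*) [MeasurableSpace Ω] (P : Measure Ω) [IsProbabilityMeasure P] (ξ : ℕ → Ω → ℝ),
        iIndepFun ξ P → (∀ i, HasLaw (ξ i) (expMeasure lam) P) →
        P {ω | C * (1 + Real.log T) ^ k *
              (b ^ (5 / 4 : ℝ) * (T : ℝ) ^ (3 / 4 : ℝ) + b ^ (17 / 12 : ℝ) * (T : ℝ) ^ (7 / 12 : ℝ))
            < lunacRegret c s b T sel (fun l : Set.Ioi (0 : ℝ) => expMeasure l) est
                (fun i => ξ i ω)} ≤ (T : ℝ≥0∞)⁻¹ := by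
  -- Both `κ` and `τ` make the failure probability of each event at most `exp (-2 (1 + log T))`:
  -- `lam * κ = 2`, and `2 / 5 * τ = 2`.
  obtain ⟨C, hC0, hC⟩ := lunacRegret_exponential_le (κ := 2 / lam) (a := 1 / (4 * lam)) (τ := 5)
    hc hcs hq₀ (by positivity) (by positivity) (by norm_num)
  refine ⟨C, 6, fun b T hb hT sel hsel est hest Ω _ P _ ξ hind hlaw => ?_⟩
  have hT1 : (1 : ℝ) ≤ T := by exact_mod_cast hT
  have hℓ1 : 1 ≤ 1 + Real.log T := by linarith [Real.log_nonneg hT1]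
  have hb0 : 0 < b := by linarith
  have hp₁ : P {ω | ∃ i, i < T ∧ ω ∈ {ω | 2 / lam * (1 + Real.log T) < ξ i ω}} ≤
      (3 * T : ℝ≥0∞)⁻¹ := by
    refine measure_exists_lt_le hT fun i _ => ?_
    rw [(hlaw i).measure_eq (p := fun x : ℝ => 2 / lam * (1 + Real.log T) < x) measurableSet_Ioi]
    refine (expMeasure_tail_le hlam (by positivity)).trans (le_of_eq ?_)
    congr 3
    field_simp
  have hp₂ : P {ω | ∃ t, t < T ∧ ω ∈ {ω | 5 * (1 + Real.log T) ≤ (t : ℝ) ∧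
      ∑ i ∈ Finset.range t, ξ i ω < 1 / (4 * lam) * t}} ≤ (3 * T : ℝ≥0∞)⁻¹ := by
    refine measure_exists_lt_le hT fun t _ => ?_
    by_cases h : 5 * (1 + Real.log T) ≤ (t : ℝ)
    · simp only [h, true_and]
      refine (measure_sum_exponential_lt_le hlam hind hlaw t).trans
        (ENNReal.ofReal_le_ofReal (Real.exp_le_exp.2 ?_))
      linarith
    · simp [h]
  have hp₀ : ∀ᵐ ω ∂P, ∀ i, 0 < ξ i ω := by
    rw [ae_all_iff]
    intro i
    exact ((hlaw i).ae_iff (p := fun x : ℝ => 0 < x) (by fun_prop)).2 (expMeasure_pos hlam)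
  set B₁ := {ω | ∃ i, i < T ∧ ω ∈ {ω | 2 / lam * (1 + Real.log T) < ξ i ω}}
  set B₂ := {ω | ∃ t, t < T ∧ ω ∈ {ω | 5 * (1 + Real.log T) ≤ (t : ℝ) ∧
      ∑ i ∈ Finset.range t, ξ i ω < 1 / (4 * lam) * t}}
  calc P _ ≤ P (B₁ ∪ B₂) := by
        refine measure_mono_ae ?_
        filter_upwards [hp₀] with ω hω hbad
        by_contra hcon
        obtain ⟨hn₁, hn₂⟩ := not_or.1 hcon
        simp only [B₁, B₂, Set.mem_ofPred_eq, not_exists, not_and, not_lt] at hn₁ hn₂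
        have h1 := hC b T hb hT sel hsel est hest (fun i => ξ i ω) hω hn₁ hn₂
        have h2 : (0 : ℝ) ≤ b ^ (17 / 12 : ℝ) * (T : ℝ) ^ (7 / 12 : ℝ) := by positivity
        exact absurd (h1.trans (rate_le_rate_add hC0 le_rfl (by linarith) (by positivity) h2))
          (not_le.2 hbad)
    _ ≤ P B₁ + P B₂ := measure_union_le _ _
    _ ≤ (3 * T : ℝ≥0∞)⁻¹ + (3 * T : ℝ≥0∞)⁻¹ := add_le_add hp₁ hp₂
    _ ≤ (T : ℝ≥0∞)⁻¹ := by
        rw [← inv_three_mul_add T]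
        exact le_self_add

end Exponential

/-! ### Normal demand: distribution functions and estimator -/

section Gaussian

variable {v : ℝ≥0}

theorem cdf_gaussian_eq (a q : ℝ) :
    cdf (gaussianReal a v) q = cdf (gaussianReal 0 v) (q - a) := by
  have h := gaussianReal_map_add_const (μ := 0) (v := v) a
  rw [zero_add] at h
  rw [cdf_eq_real, cdf_eq_real, ← h, Measure.real, Measure.real,
    Measure.map_apply (by fun_prop) measurableSet_Iic]
  congr 2
  ext x
  simp [le_sub_iff_add_le]

theorem cdf_sub_cdf (μ : Measure ℝ) [IsProbabilityMeasure μ] {x y : ℝ} (h : x ≤ y) :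
    cdf μ y - cdf μ x = μ.real (Set.Ioc x y) := by
  rw [cdf_eq_real, cdf_eq_real, ← Set.Iic_union_Ioc_eq_Iic h,
    measureReal_union (Set.Iic_disjoint_Ioc le_rfl) measurableSet_Ioc]
  ring

theorem gaussianPDFReal_zero_le (v : ℝ≥0) (x : ℝ) :
    gaussianPDFReal 0 v x ≤ gaussianPDFReal 0 v 0 := by
  simp only [gaussianPDFReal_def]
  gcongr ?_ * Real.exp (?_ / _)
  have := sq_nonneg x
  simpa using this

theorem cdf_gaussian_sub_le (hv : v ≠ 0) {x y : ℝ} (h : x ≤ y) :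
    cdf (gaussianReal 0 v) y - cdf (gaussianReal 0 v) x ≤ gaussianPDFReal 0 v 0 * (y - x) := by
  have hp := gaussianPDFReal_nonneg 0 v 0
  rw [cdf_sub_cdf _ h, Measure.real, gaussianReal_apply _ hv]
  refine ENNReal.toReal_le_of_le_ofReal (mul_nonneg hp (by linarith)) ?_
  calc ∫⁻ u in Set.Ioc x y, gaussianPDF 0 v u
      ≤ ∫⁻ _ in Set.Ioc x y, ENNReal.ofReal (gaussianPDFReal 0 v 0) :=
        lintegral_mono fun u => ENNReal.ofReal_le_ofReal (gaussianPDFReal_zero_le v u)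
    _ = _ := by
        rw [setLIntegral_const, Real.volume_Ioc, ← ENNReal.ofReal_mul hp]

theorem abs_cdf_gaussian_sub_le (hv : v ≠ 0) (x y : ℝ) :
    |cdf (gaussianReal 0 v) y - cdf (gaussianReal 0 v) x| ≤ gaussianPDFReal 0 v 0 * |y - x| := by
  rcases le_total x y with h | h
  · rw [abs_of_nonneg (sub_nonneg.2 (monotone_cdf _ h)), abs_of_nonneg (sub_nonneg.2 h)]
    exact cdf_gaussian_sub_le hv h
  · rw [abs_sub_comm, abs_sub_comm y x, abs_of_nonneg (sub_nonneg.2 (monotone_cdf _ h)),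
      abs_of_nonneg (sub_nonneg.2 h)]
    exact cdf_gaussian_sub_le hv h

/-- On `[-R, R]` the density is at least its value at the endpoint `R`. -/
theorem exists_le_cdf_gaussian_sub (hv : v ≠ 0) (R : ℝ) :
    ∃ p : ℝ, 0 < p ∧ ∀ x y, -R ≤ x → x ≤ y → y ≤ R →
      p * (y - x) ≤ cdf (gaussianReal 0 v) y - cdf (gaussianReal 0 v) x := by
  refine ⟨gaussianPDFReal 0 v R, gaussianPDFReal_pos _ _ _ hv, fun x y hx hxy hy => ?_⟩
  have hp := gaussianPDFReal_nonneg 0 v R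
  rw [cdf_sub_cdf _ hxy, Measure.real, gaussianReal_apply _ hv,
    ← ENNReal.ofReal_le_iff_le_toReal (by
      rw [← gaussianReal_apply _ hv]; exact measure_ne_top _ _)]
  calc ENNReal.ofReal (gaussianPDFReal 0 v R * (y - x))
      = ∫⁻ _ in Set.Ioc x y, ENNReal.ofReal (gaussianPDFReal 0 v R) := by
        rw [setLIntegral_const, Real.volume_Ioc, ← ENNReal.ofReal_mul hp]
    _ ≤ _ := by
        refine setLIntegral_mono (measurable_gaussianPDF _ _) fun u hu => ?_
        refine ENNReal.ofReal_le_ofReal ?_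
        simp only [gaussianPDFReal_def]
        have h1 : u ^ 2 ≤ R ^ 2 := sq_le_sq' (by linarith [hu.1]) (by linarith [hu.2])
        gcongr ?_ * Real.exp (?_ / _)
        simpa using h1

theorem cdf_gaussian_lt_one (hv : v ≠ 0) (x : ℝ) : cdf (gaussianReal 0 v) x < 1 := by
  obtain ⟨p, hp, h⟩ := exists_le_cdf_gaussian_sub hv (|x| + 1)
  have h1 := h x (x + 1) (by linarith [neg_abs_le x]) (by linarith) (by linarith [le_abs_self x])
  have h2 := cdf_le_one (gaussianReal 0 v) (x + 1)
  linarith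

/-- The maximum likelihood estimator of the mean of a normal distribution is the sample mean. -/
theorem IsMLE.gaussian (hv : 0 < v) {est : (t : ℕ) → (Fin t → ℝ) → ℝ}
    (h : IsMLE (fun (a x : ℝ) => gaussianPDFReal a v x) Set.univ est)
    (ξ : ℕ → ℝ) {t : ℕ} (ht : 0 < t) :
    est t (fun i => ξ i) = (∑ i ∈ Finset.range t, ξ i) / t := by
  have ht' : (0 : ℝ) < t := by exact_mod_cast ht
  have hv' : (0 : ℝ) < v := by exact_mod_cast hv
  set a := est t (fun i => ξ i) with ha
  set μ := (∑ i ∈ Finset.range t, ξ i) / t with hμ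
  have hsum : ∑ i : Fin t, ξ i = t * μ := by
    rw [hμ, ← Finset.sum_range (f := ξ)]; field_simp
  have hsq : ∀ x : ℝ, ∑ i : Fin t, (ξ i - x) ^ 2 =
      ∑ i : Fin t, (ξ i) ^ 2 - 2 * x * (t * μ) + t * x ^ 2 := by
    intro x
    rw [← hsum, Finset.mul_sum, ← Finset.sum_sub_distrib]
    have : (t : ℝ) * x ^ 2 = ∑ i : Fin t, x ^ 2 := by simp
    rw [this, ← Finset.sum_add_distrib]
    exact Finset.sum_congr rfl fun i _ => by ring
  have hlik : ∀ x : ℝ, ∏ i : Fin t, gaussianPDFReal x v (ξ i) =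
      ((√(2 * Real.pi * v))⁻¹) ^ t * Real.exp (-(∑ i : Fin t, (ξ i - x) ^ 2) / (2 * v)) := by
    intro x
    simp only [gaussianPDFReal_def]
    rw [Finset.prod_mul_distrib, Finset.prod_const, Finset.card_univ, Fintype.card_fin,
      ← Real.exp_sum, ← Finset.sum_div, Finset.sum_neg_distrib]
  have h1 := h t (fun i => ξ i) (fun _ => Set.mem_univ _) μ
  simp only [hlik] at h1
  rw [mul_le_mul_iff_right₀ (by positivity), Real.exp_le_exp,
    div_le_div_iff_of_pos_right (by positivity), hsq, hsq] at h1
  have h2 : (t : ℝ) * (a - μ) ^ 2 ≤ 0 := by linarith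
  have h3 : (a - μ) ^ 2 = 0 := le_antisymm (nonpos_of_mul_nonpos_right h2 ht') (sq_nonneg _)
  have h4 := pow_eq_zero_iff (two_ne_zero) |>.1 h3
  linarith

variable {Ω : Type*} [MeasurableSpace Ω] {P : Measure Ω}

theorem hasSubgaussianMGF_gaussian {X : Ω → ℝ} (h : HasLaw X (gaussianReal 0 v) P) :
    HasSubgaussianMGF X v P where
  integrable_exp_mul t := by
    have h1 := integrable_exp_mul_gaussianReal (μ := 0) (v := v) t
    rw [← h.map_eq] at h1
    exact h1.comp_aemeasurable h.aemeasurable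
  mgf_le t := by
    rw [mgf_gaussianReal h.map_eq]
    simp

/-- Deviations of the sum of independent centred normal random variables. -/
theorem measure_lt_abs_sum_le [IsProbabilityMeasure P] {X : ℕ → Ω → ℝ} (hind : iIndepFun X P)
    (h : ∀ i, HasSubgaussianMGF (X i) v P) (n : ℕ) {ε : ℝ} (hε : 0 ≤ ε) :
    P {ω | ε < |∑ i ∈ Finset.range n, X i ω|} ≤
      2 * ENNReal.ofReal (Real.exp (-ε ^ 2 / (2 * n * v))) := by
  have hside : ∀ {Y : ℕ → Ω → ℝ}, iIndepFun Y P → (∀ i, HasSubgaussianMGF (Y i) v P) →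
      P {ω | ε ≤ ∑ i ∈ Finset.range n, Y i ω} ≤
        ENNReal.ofReal (Real.exp (-ε ^ 2 / (2 * n * v))) := fun hY hsub => by
    have h1 := HasSubgaussianMGF.measure_sum_range_ge_le_of_iIndepFun hY (n := n)
      (fun i _ => hsub i) hε
    rw [Measure.real] at h1
    rw [← ENNReal.ofReal_toReal (measure_ne_top P _)]
    exact ENNReal.ofReal_le_ofReal h1
  have h1 := hside hind h
  have h2 := hside (Y := fun i ω => -X i ω) (hind.comp (fun _ x => -x) fun _ => measurable_neg)
    fun i => (h i).neg
  rw [two_mul]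
  refine le_trans (measure_mono ?_) ((measure_union_le _ _).trans (add_le_add h1 h2))
  intro ω hω
  rcases lt_abs.1 (show ε < |∑ i ∈ Finset.range n, X i ω| from hω) with h3 | h3
  · exact Or.inl h3.le
  · refine Or.inr ?_
    change ε ≤ ∑ i ∈ Finset.range n, -X i ω
    rw [Finset.sum_neg_distrib]
    exact h3.le

end Gaussian

/-! ### Orders that vanish, in the limit, at all prices above the unit cost -/

section SmallOrders

variable {s c q₀ : ℝ}

/-- Here `√(ℓ / t)` bounds the drift of the fit after time `t`, and `√ℓ` the size of the orders.
Squaring shows that an epoch starting at `t` lasts for a time proportional to `t`, up to logarithms.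
-/
theorem le_of_margin_le {M j t : ℕ} {a ℓ : ℝ} (hM : 0 < M) (hj : 0 < j) (ht : 0 < t) (hℓ : 0 ≤ ℓ)
    (h : margin M j ≤ a * (√(ℓ / t) * √ℓ)) : (t : ℝ) ≤ a ^ 2 * ℓ ^ 2 * j := by
  have hM' : (1 : ℝ) ≤ M := by exact_mod_cast hM
  have hj' : (0 : ℝ) < j := by exact_mod_cast hj
  have ht' : (0 : ℝ) < t := by exact_mod_cast ht
  have h1 : (M : ℝ) / j ≤ (a * (√(ℓ / t) * √ℓ)) ^ 2 := (Real.sqrt_le_iff.1 h).2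
  have h2 : (a * (√(ℓ / t) * √ℓ)) ^ 2 = a ^ 2 * ℓ ^ 2 / t := by
    rw [mul_pow, mul_pow, Real.sq_sqrt (by positivity), Real.sq_sqrt hℓ]
    ring
  rw [h2, div_le_div_iff₀ hj' ht'] at h1
  nlinarith

theorem log_add_one_le {T : ℕ} (hT : 1 ≤ T) : Real.log ((T : ℝ) + 1) ≤ 1 + Real.log T := by
  have hT1 : (1 : ℝ) ≤ T := by exact_mod_cast hT
  have h1 : Real.log ((T : ℝ) + 1) ≤ Real.log (2 * T) :=
    Real.log_le_log (by linarith) (by linarith)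
  rw [Real.log_mul (by norm_num) (by linarith)] at h1
  have := Real.log_two_lt_d9
  linarith

/-- If every epoch multiplies the elapsed time by a fixed factor, its end can be charged to the
growth of `log`; this makes the number of epochs logarithmic, up to the factor `H + 1`. -/
theorem one_le_mul_log_sub {H t j : ℝ} (ht : 0 ≤ t) (hj : 1 ≤ j) (h : t + j ≤ H * j) :
    1 ≤ (H + 1) * (Real.log (t + j + 1) - Real.log (t + 1)) := by
  have h1 := Real.one_sub_inv_le_log_of_pos (show 0 < (t + j + 1) / (t + 1) by positivity)
  rw [Real.log_div (by positivity) (by positivity), inv_div] at h1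
  have h2 : 1 - (t + 1) / (t + j + 1) = j / (t + j + 1) := by field_simp; ring
  rw [h2] at h1
  have h3 : t + j + 1 ≤ (H + 1) * j := by linarith
  have hH : 0 < H + 1 := by
    by_contra hcon
    have := mul_nonpos_of_nonpos_of_nonneg (not_lt.1 hcon) (by linarith : 0 ≤ j)
    linarith
  have h4 : 1 ≤ (H + 1) * (j / (t + j + 1)) := by
    rw [← mul_div_assoc, le_div_iff₀ (by positivity)]
    linarith
  exact h4.trans (mul_le_mul_of_nonneg_left h1 hH.le)

/-- Bound for the loss at a price `w` below the unit cost, at which the order is small. -/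
theorem loss_le_of_small_order {w q b d g x : ℝ} (hs : 0 < s) (hc : 0 < c) (hcs : c < s)
    (hb : 0 ≤ b) (hw0 : 0 ≤ w) (hw : w < c) (hx : c - w ≤ x) (hg : 0 ≤ g) (hd : 0 ≤ d)
    (hqb : q ≤ b) (hq : c / 2 ≤ w → q ≤ d + g * (c - w)) :
    (c - w) * q ≤ (1 + g + 4 * s / c ^ 2) * (1 + b) * x ^ 2 + d ^ 2 := by
  have hx0 : 0 < x := by linarith
  have hd2 := sq_nonneg d
  have hx2 := sq_nonneg x
  rcases le_or_gt (c / 2) w with h | h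
  · have h1 := hq h
    have h2 : (c - w) * q ≤ (c - w) * (d + g * (c - w)) :=
      mul_le_mul_of_nonneg_left h1 (by linarith)
    have h3 : (c - w) * d ≤ x * d := mul_le_mul_of_nonneg_right hx hd
    have h4 : (c - w) ^ 2 ≤ x ^ 2 := pow_le_pow_left₀ (by linarith) hx 2
    have h5 : g * (c - w) ^ 2 ≤ g * x ^ 2 := mul_le_mul_of_nonneg_left h4 hg
    have h6 : 0 ≤ 4 * s / c ^ 2 * x ^ 2 := by positivity
    have h7 : 0 ≤ (1 + g + 4 * s / c ^ 2) * b * x ^ 2 := by positivity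
    nlinarith [sq_nonneg (x - d)]
  · have h1 : (c - w) * q ≤ s * b := by
      calc (c - w) * q ≤ (c - w) * b := mul_le_mul_of_nonneg_left hqb (by linarith)
        _ ≤ s * b := mul_le_mul_of_nonneg_right (by linarith) hb
    have h2 : c ^ 2 ≤ 4 * x ^ 2 := by nlinarith
    have h3 : s * b ≤ 4 * s / c ^ 2 * b * x ^ 2 := by
      have : 4 * s / c ^ 2 * b * x ^ 2 = s * b * (4 * x ^ 2) / c ^ 2 := by ring
      rw [this, le_div_iff₀ (by positivity)]
      exact mul_le_mul_of_nonneg_left h2 (by positivity)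
    have h4 : 0 ≤ (1 + g) * (1 + b) * x ^ 2 := by positivity
    have h5 : 0 ≤ 4 * s / c ^ 2 * x ^ 2 := by positivity
    nlinarith

section Epochs

variable {b ε V B g ℓ : ℝ} {M K T : ℕ} {y : Fin M → ℝ} {sel : (Fin K → ℝ) → Fin K} {ρ : ℝ → ℝ}
  {r : ℕ → ℝ → ℝ}

theorem sqrt_div_le_sqrt_div (hℓ : 0 ≤ ℓ) {t t' : ℕ} (ht : 1 ≤ t) (h : t ≤ t') :
    √(ℓ / t') ≤ √(ℓ / t) := by
  have h3 : (0 : ℝ) < t := by exact_mod_cast ht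
  gcongr

/-- An epoch ends only after a length proportional to the elapsed time. -/
theorem time_le_of_trigger (hc : 0 ≤ c) (hcs : c < s) (hsel : IsArgmaxRule sel)
    (O : Observed s b ε y ρ r) (hε : ε ≤ 1) (hℓ : 1 ≤ ℓ) (hV : 0 ≤ V) (hB : 0 ≤ B)
    (hshift : ∀ t₀ t t', 1 ≤ t₀ → t₀ ≤ t → t₀ ≤ t' → t < T → t' < T →
      ShiftBound s r (s * (V * √(ℓ / t₀))) t t')
    (hzero : ∀ t t' w, 1 ≤ t → t ≤ t' → t' < T → 0 ≤ w → w ≤ s → r t w ≤ r t' 0)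
    (hord : ∀ t w, 1 ≤ t → t < T → c ≤ w → w ≤ s → r t w ≤ B * √(ℓ / t))
    {t₀ e : ℕ} (he : K ≤ e) (heT : t₀ + e < T) (htr : SurrogateTrigger c s M sel ρ r t₀ e ∨
      ∃ m, LevelTrigger c s y sel ρ r t₀ e m) :
    (t₀ : ℝ) + ((e : ℝ) + 1) ≤ ((s * V * (B + 1)) ^ 2 * ℓ ^ 2 + 1) * ((e : ℝ) + 1) := by
  have hs : 0 < s := by linarith
  have hℓ0 : 0 ≤ ℓ := by linarith
  set a := s * V * (B + 1) with ha
  have he1 : (1 : ℝ) ≤ (e : ℝ) + 1 := by linarith [(Nat.cast_nonneg e : (0 : ℝ) ≤ e)]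
  rcases Nat.eq_zero_or_pos t₀ with h0 | h0
  · rw [h0, Nat.cast_zero, zero_add]
    have : 0 ≤ a ^ 2 * ℓ ^ 2 * ((e : ℝ) + 1) := by positivity
    linarith
  -- With `ε ≤ 1`, rounded orders above the unit cost are `O(√ℓ)` instead of `b`; this is what makes
  -- the triggers so rare.
  · have hround : ∀ t w, t₀ ≤ t → t < T → c ≤ w → w ≤ s → ρ (r t w) ≤ (B + 1) * √ℓ := by
      intro t w h2 h3 hw hws
      have h4 := O.round_le _ (O.nonneg t w (hc.trans hw) hws) (O.le t w (hc.trans hw) hws)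
      have h5 := hord t w (h0.trans_le h2) h3 hw hws
      have ht : (1 : ℝ) ≤ t := by exact_mod_cast h0.trans_le h2
      have h6 : √(ℓ / t) ≤ √ℓ := Real.sqrt_le_sqrt (div_le_self hℓ0 ht)
      have h7 : 1 ≤ √ℓ := Real.one_le_sqrt.2 hℓ
      have h8 := mul_le_mul_of_nonneg_left h6 hB
      linarith
    have hδ0 : 0 ≤ s * (V * √(ℓ / t₀)) := by positivity
    have hfin : ∀ z, z ≤ (B + 1) * √ℓ → margin M (e + 1) ≤ s * (V * √(ℓ / t₀)) * z → 0 < M →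
        (t₀ : ℝ) + ((e : ℝ) + 1) ≤ (a ^ 2 * ℓ ^ 2 + 1) * ((e : ℝ) + 1) := fun z hz h hM => by
      have h2 : margin M (e + 1) ≤ a * (√(ℓ / t₀) * √ℓ) := by
        refine (h.trans (mul_le_mul_of_nonneg_left hz hδ0)).trans (le_of_eq ?_)
        rw [ha]; ring
      have h1 := le_of_margin_le hM (Nat.succ_pos e) h0 hℓ0 h2
      push_cast at h1
      rw [add_mul, one_mul]
      linarith
    rcases htr with h | ⟨m, h⟩
    · have hM : 0 < M := by
        obtain ⟨m, _⟩ := O.mem 0 c hc hcs.le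
        exact m.pos
      refine hfin _ ?_ (h.margin_le hc hcs O
        (fun k => hshift t₀ _ _ h0 (by omega) (by omega) (by omega) heT)
        fun k w hw hws => hzero _ _ w (by omega) (by omega) heT hw hws) hM
      exact hround _ _ (by omega) (by omega) (le_explorePrice hcs _) (explorePrice_lt hcs _).le
    · have h1 := h.margin_le hc hcs hsel O
        fun k => hshift t₀ _ _ h0 (by omega) (by omega) heT (by omega)
      refine hfin _ ?_ h1 m.pos
      obtain ⟨⟨hy, hws⟩, hm⟩ := h
      refine hm.trans (hround _ _ (by omega) heT ?_ hws)
      refine le_trans ?_ (le_testPrice hc hcs _ _ hy)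
      have h2 := bestProfit_nonneg (sel := sel) hcs (exploreObs_nonneg (K := K) hc hcs O t₀)
      have h3 := margin_nonneg M (e + 1)
      exact le_add_of_nonneg_right (by positivity)

/-- Loss at the surrogate price when the orders at prices above the unit cost are small, and the
levels are `z` apart. -/
theorem surrogate_loss_le_of_small_orders (hc : 0 < c) (hcs : c < s) (O : Observed s b ε y ρ r)
    (hℓ : 0 ≤ ℓ) (hB : 0 ≤ B) (hg : 0 ≤ g) {t₀ e : ℕ} (he1 : 1 ≤ e) (heT : t₀ + e < T) {z : ℝ}
    (hz : 0 < z) (hy : z ≤ bestOrder c s sel (exploreObs c s K ρ r t₀))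
    (hlow : ∀ t w, 1 ≤ t → t < T → c / 2 ≤ w → w ≤ c → r t w ≤ B * √(ℓ / t) + g * (c - w))
    (hw : surrogatePrice c s sel M (e + 1) (exploreObs c s K ρ r t₀) < c) :
    (c - surrogatePrice c s sel M (e + 1) (exploreObs c s K ρ r t₀)) *
        r (t₀ + e) (surrogatePrice c s sel M (e + 1) (exploreObs c s K ρ r t₀)) ≤
      ((1 + g + 4 * s / c ^ 2) * (1 + b) * (M / z ^ 2) + 2 * B ^ 2 * ℓ) / (e + 1) := by
  have hs : 0 < s := by linarith
  have hgap := surrogate_gap_le (M := M) (sel := sel) hcs (obs := exploreObs c s K ρ r t₀) (e + 1)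
  have hw0 : 0 ≤ surrogatePrice c s sel M (e + 1) (exploreObs c s K ρ r t₀) :=
    surrogatePrice_nonneg _ _
  revert hgap hw0 hw hy
  generalize surrogatePrice c s sel M (e + 1) (exploreObs c s K ρ r t₀) = w
  generalize bestOrder c s sel (exploreObs c s K ρ r t₀) = y'
  intro hy hw hgap hw0
  have hws : w ≤ s := by linarith
  have he1' : (1 : ℝ) ≤ e := by exact_mod_cast he1
  have ht1 : 1 ≤ t₀ + e := by omega
  have hb : 0 ≤ b := (O.nonneg 0 c hc.le hcs.le).trans (O.le 0 c hc.le hcs.le)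
  have hgap' : c - w ≤ margin M (e + 1) / z :=
    hgap.trans (div_le_div_of_nonneg_left (margin_nonneg _ _) hz hy)
  have hl := loss_le_of_small_order (q := r (t₀ + e) w) (b := b)
    (d := B * √(ℓ / ((t₀ + e : ℕ) : ℝ))) (g := g) hs hc hcs hb hw0 hw hgap' hg (by positivity)
    (O.le _ _ hw0 hws) (fun h => hlow _ _ ht1 heT h hw.le)
  refine hl.trans ?_
  rw [add_div]
  refine add_le_add (le_of_eq ?_) ?_
  · rw [div_pow, margin, Real.sq_sqrt (by positivity)]
    push_cast
    field_simp
  -- Since `1 ≤ e`, the calendar time `t₀ + e` is at least `(e + 1) / 2`.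
  · rw [mul_pow, Real.sq_sqrt (by positivity), mul_div_assoc, mul_comm 2, mul_assoc]
    refine mul_le_mul_of_nonneg_left ?_ (sq_nonneg B)
    rw [← mul_div_assoc, div_le_div_iff₀ (by exact_mod_cast ht1) (by linarith)]
    push_cast
    have h0 : (0 : ℝ) ≤ t₀ := Nat.cast_nonneg _
    calc ℓ * ((e : ℝ) + 1) ≤ ℓ * (2 * ((t₀ : ℝ) + e)) := by gcongr; linarith
      _ = _ := by ring

/-- Regret of LUNA when the orders at prices above the unit cost are small, and the levels are `z`
apart. -/
theorem regret_le_of_small_orders (hc : 0 < c) (hcs : c < s) (hsel : IsArgmaxRule sel)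
    (O : Observed s b ε y ρ r) (hε0 : 0 ≤ ε) (hε : ε ≤ 1) (hK : 1 ≤ K) (hT : 1 ≤ T) (hV : 0 ≤ V)
    (hB : 0 ≤ B) (hg : 0 ≤ g) (hℓ : ℓ = 1 + Real.log T) {z : ℝ} (hz : 0 < z)
    (hy : ∀ t w, 0 ≤ w → w ≤ s → 0 < ρ (r t w) → z ≤ ρ (r t w))
    (hshift : ∀ t₀ t t', 1 ≤ t₀ → t₀ ≤ t → t₀ ≤ t' → t < T → t' < T →
      ShiftBound s r (s * (V * √(ℓ / t₀))) t t')
    (hzero : ∀ t t' w, 1 ≤ t → t ≤ t' → t' < T → 0 ≤ w → w ≤ s → r t w ≤ r t' 0)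
    (hord : ∀ t w, 1 ≤ t → t < T → c ≤ w → w ≤ s → r t w ≤ B * √(ℓ / t))
    (hlow : ∀ t w, 1 ≤ t → t < T → c / 2 ≤ w → w ≤ c → r t w ≤ B * √(ℓ / t) + g * (c - w)) :
    ∃ E, 0 ≤ E ∧ E ≤ ((s * V * (B + 1)) ^ 2 + 3) * ℓ ^ 3 ∧
      (lunaRounded c s y sel ρ).regret c s r T ≤ T * (b * s / K + s * ε) +
        E * (s * b * K + s * b + ((1 + g + 4 * s / c ^ 2) * (1 + b) * (M / z ^ 2) + 2 * B ^ 2 * ℓ) *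
          (1 + Real.log T)) + 6 * (s * b + (2 + 0)) * √(M * E * T) := by
  have hs : 0 < s := by linarith
  have hb : 0 ≤ b := (O.nonneg 0 c hc.le hcs.le).trans (O.le 0 c hc.le hcs.le)
  have hM : 0 < M := by
    obtain ⟨m, _⟩ := O.mem 0 c hc.le hcs.le
    exact m.pos
  have hT1 : (1 : ℝ) ≤ T := by exact_mod_cast hT
  have hℓ1 : 1 ≤ ℓ := by linarith [Real.log_nonneg hT1]
  set a := s * V * (B + 1) with ha
  set H := a ^ 2 * ℓ ^ 2 + 1 with hH
  have hH0 : 0 < H := by positivity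
  -- Logarithmic time replaces the total variation as the budget for epochs.
  set Ψ : ℕ → ℝ := fun t => (H + 1) * (Real.log ((T : ℝ) + 1) - Real.log ((t : ℝ) + 1)) with hΨ
  have hE : 1 + Ψ 0 ≤ (a ^ 2 + 3) * ℓ ^ 3 := by
    have h1 : Ψ 0 ≤ (H + 1) * ℓ := by
      simp only [hΨ, Nat.cast_zero, zero_add, Real.log_one, sub_zero]
      rw [hℓ]
      exact mul_le_mul_of_nonneg_left (log_add_one_le hT) (by positivity)
    have h2 : ℓ ≤ ℓ ^ 3 := le_self_pow₀ hℓ1 (by norm_num)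
    have h3 : (1 : ℝ) ≤ ℓ ^ 3 := one_le_pow₀ hℓ1
    calc 1 + Ψ 0 ≤ 1 + (a ^ 2 * ℓ ^ 2 + 1 + 1) * ℓ := by linarith
      _ = 1 + 2 * ℓ + a ^ 2 * ℓ ^ 3 := by ring
      _ ≤ _ := by linarith
  have hΨ0 : ∀ t, t ≤ T → 0 ≤ Ψ t := fun t ht => by
    have h1 : (t : ℝ) ≤ T := by exact_mod_cast ht
    refine mul_nonneg (by positivity) (sub_nonneg.2 (Real.log_le_log (by positivity) ?_))
    linarith
  refine ⟨1 + Ψ 0, by linarith [hΨ0 0 (Nat.zero_le T)], hE, ?_⟩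
  refine regret_le_of_epochs_of_loss hc.le hcs hε0 hM hT O le_rfl (by positivity) hΨ0
    (fun t₀ e he heT htr => ?_) fun t₀ e he heT _ hy0 hwc => ?_
  · have h0 := time_le_of_trigger hc.le hcs hsel O hε hℓ1 hV hB hshift hzero hord he heT htr
    have h1 := one_le_mul_log_sub (Nat.cast_nonneg t₀)
      (by linarith [(Nat.cast_nonneg e : (0 : ℝ) ≤ e)]) h0
    have h2 : ((t₀ + e + 1 : ℕ) : ℝ) + 1 = (t₀ : ℝ) + ((e : ℝ) + 1) + 1 := by push_cast; ring
    simp only [hΨ]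
    rw [h2]
    linarith
  · rw [zero_mul, zero_add]
    refine surrogate_loss_le_of_small_orders hc hcs O (by linarith) hB hg (hK.trans he) heT hz ?_
      hlow hwc
    exact hy _ _ (hc.le.trans (le_explorePrice hcs _)) (explorePrice_lt hcs _).le
      (lt_of_le_of_ne (exploreObs_nonneg (K := K) hc.le hcs O t₀ _) (Ne.symm hy0))

end Epochs

/-- With levels `b / (N - 1)` apart, the accumulated squared gaps are of order `N³ / b²`, that is
`x⁹ / b²`; so the spacing of LUNAC just meets the rate. -/
theorem small_orders_rate {b x N ℓ g₁ B : ℝ} (hq₀ : 0 < q₀) (hb : q₀ ≤ b) (hx : 1 ≤ x)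
    (hN1 : 1 < N) (hN : N ≤ 2 * x ^ 3) (hℓ : 1 ≤ ℓ) (hg₁ : 0 ≤ g₁) :
    g₁ * (1 + b) * (N / (b / (N - 1)) ^ 2) + 2 * B ^ 2 * ℓ ≤
      (8 * g₁ * (1 / q₀ ^ 4 + 1 / q₀ ^ 3) + 2 * B ^ 2 / q₀ ^ 2) * ℓ ^ 3 * (b ^ 2 * x ^ 9) := by
  have hb0 : 0 < b := by linarith
  have hx0 : 0 < x := by linarith
  have h1 : 1 ≤ x ^ 9 := one_le_pow₀ hx
  have hℓ3 : ℓ ≤ ℓ ^ 3 := le_self_pow₀ hℓ (by norm_num)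
  have hℓ31 : 1 ≤ ℓ ^ 3 := one_le_pow₀ hℓ
  have e1 : (1 + b) / b ^ 2 ≤ (1 / q₀ ^ 4 + 1 / q₀ ^ 3) * b ^ 2 := by
    have i1 : (1 + b) / b ^ 2 = (1 / b ^ 4 + 1 / b ^ 3) * b ^ 2 := by field_simp
    rw [i1]
    gcongr
  have e2 : N * (N - 1) ^ 2 ≤ 8 * x ^ 9 := by
    calc N * (N - 1) ^ 2 ≤ N * N ^ 2 := by
          refine mul_le_mul_of_nonneg_left (pow_le_pow_left₀ ?_ ?_ 2) ?_ <;> linarith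
      _ = N ^ 3 := by ring
      _ ≤ (2 * x ^ 3) ^ 3 := by gcongr
      _ = _ := by ring
  have e3 : g₁ * (1 + b) * (N / (b / (N - 1)) ^ 2) ≤
      8 * g₁ * (1 / q₀ ^ 4 + 1 / q₀ ^ 3) * ℓ ^ 3 * (b ^ 2 * x ^ 9) := by
    have hN0 : N - 1 ≠ 0 := by linarith
    calc g₁ * (1 + b) * (N / (b / (N - 1)) ^ 2)
        = g₁ * ((1 + b) / b ^ 2) * (N * (N - 1) ^ 2) := by field_simp
      _ ≤ g₁ * ((1 / q₀ ^ 4 + 1 / q₀ ^ 3) * b ^ 2) * (8 * x ^ 9) := by gcongr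
      _ = 8 * g₁ * (1 / q₀ ^ 4 + 1 / q₀ ^ 3) * 1 * (b ^ 2 * x ^ 9) := by ring
      _ ≤ _ := by gcongr
  have e4 : 2 * B ^ 2 * ℓ ≤ 2 * B ^ 2 / q₀ ^ 2 * ℓ ^ 3 * (b ^ 2 * x ^ 9) := by
    have i1 : q₀ ^ 2 ≤ b ^ 2 * x ^ 9 :=
      (pow_le_pow_left₀ hq₀.le hb 2).trans (le_mul_of_one_le_right (by positivity) h1)
    calc 2 * B ^ 2 * ℓ ≤ 2 * B ^ 2 * ℓ ^ 3 := by gcongr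
      _ = 2 * B ^ 2 / q₀ ^ 2 * ℓ ^ 3 * q₀ ^ 2 := by field_simp
      _ ≤ _ := by gcongr
  calc _ ≤ _ := add_le_add e3 e4
    _ = _ := by ring

/-- Regret of LUNAC when the orders at prices above the unit cost decay at the rate
`√(log T / t)`. -/
theorem lunac_regret_le_of_small_orders (hc : 0 < c) (hcs : c < s) (hq₀ : 0 < q₀) {V B g : ℝ}
    (hV : 0 ≤ V) (hB : 0 ≤ B) (hg : 0 ≤ g) :
    ∃ C : ℝ, 0 ≤ C ∧ ∀ (b : ℝ) (T : ℕ), q₀ ≤ b → 1 ≤ T →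
      ∀ (sel : (Fin (gridSize b T) → ℝ) → Fin (gridSize b T)) (F : ℕ → ℝ → ℝ),
        IsArgmaxRule sel → (∀ t, F t b = 1) → b / ((levelCount b T : ℕ) - 1 : ℝ) ≤ 1 →
        (∀ t t', 1 ≤ t → t ≤ t' → t' < T → ∀ q ∈ Set.Icc 0 b,
          |F t' q - F t q| ≤ V * √((1 + Real.log T) / t)) →
        (∀ t t' w, 1 ≤ t → t ≤ t' → t' < T → 0 ≤ w → w ≤ s →
          quantileOrder s b F t w ≤ quantileOrder s b F t' 0) →
        (∀ t w, 1 ≤ t → t < T → c ≤ w → w ≤ s →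
          quantileOrder s b F t w ≤ B * √((1 + Real.log T) / t)) →
        (∀ t w, 1 ≤ t → t < T → c / 2 ≤ w → w ≤ c →
          quantileOrder s b F t w ≤ B * √((1 + Real.log T) / t) + g * (c - w)) →
        (lunac c s b (levelCount b T) sel).regret c s (quantileOrder s b F) T ≤
          C * ((1 + Real.log T) ^ 3) ^ 3 * (b ^ (5 / 4 : ℝ) * (T : ℝ) ^ (3 / 4 : ℝ)) := by
  have hs : 0 < s := by linarith
  set a := s * V * (B + 1) with ha
  set g₁ := 1 + g + 4 * s / c ^ 2 with hg₁
  have hg₁0 : 0 ≤ g₁ := by positivity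
  set G₀ := 8 * g₁ * (1 / q₀ ^ 4 + 1 / q₀ ^ 3) + 2 * B ^ 2 / q₀ ^ 2 with hG₀
  obtain ⟨C, hC0, hC⟩ := lunac_regret_le_of_bound (κ := 0) (D := (a ^ 2 + 3) / q₀)
    (C_G := (a ^ 2 + 3) * G₀) (c₃ := 0) hc.le hcs hq₀ (by positivity) (by positivity) le_rfl
  refine ⟨C, hC0, fun b T hb hT sel F hsel hF hε hvar hzero hord hlow => ?_⟩
  have hb0 : 0 < b := by linarith
  have hT1 : (1 : ℝ) ≤ T := by exact_mod_cast hT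
  have hℓ1 : 1 ≤ 1 + Real.log T := by linarith [Real.log_nonneg hT1]
  refine hC b T ((1 + Real.log T) ^ 3) hb hT (le_self_pow₀ hℓ1 (by norm_num)) sel F hF ?_
  intro x hx hTx _ hTb
  have hx0 : 0 < x := by linarith
  have hN2 := two_le_levelCount hb0 hTb
  have hO := observed_roundUp (F := F) hs hb0.le hN2 hF
  have hNx : (levelCount b T : ℝ) ≤ 2 * x ^ 3 := by
    rw [levelCount_eq hb0 hx hTx]
    exact ceil_le_two_mul (one_le_pow₀ hx.le)
  have hN2' : (2 : ℝ) ≤ (levelCount b T : ℕ) := by exact_mod_cast hN2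
  have hN0 : (0 : ℝ) < (levelCount b T : ℕ) - 1 := by linarith
  have hb1 : b ∈ Set.Icc 0 b := ⟨hb0.le, le_rfl⟩
  have hsh : ∀ t₀ t t', 1 ≤ t₀ → t₀ ≤ t → t₀ ≤ t' → t < T → t' < T → ∀ q ∈ Set.Icc 0 b,
      F t' q ≤ F t q + V * √((1 + Real.log T) / t₀) := by
    intro t₀ t t' h0 ht ht' htT htT' q hq
    have hsq : ∀ u, t₀ ≤ u → V * √((1 + Real.log T) / u) ≤ V * √((1 + Real.log T) / t₀) :=
      fun u hu => mul_le_mul_of_nonneg_left (sqrt_div_le_sqrt_div (by linarith) h0 hu) hV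
    rcases le_total t t' with h | h
    · have h1 := hvar t t' (h0.trans ht) h htT' q hq
      linarith [(abs_le.1 h1).2, hsq t ht]
    · have h1 := hvar t' t (h0.trans ht') h htT q hq
      linarith [(abs_le.1 h1).1, hsq t' ht']
  obtain ⟨E, hE0, hE, hreg⟩ := regret_le_of_small_orders (sel := sel) (T := T) hc hcs hsel hO
    (div_nonneg hb0.le hN0.le) hε (Nat.ceil_pos.2 (by positivity)) hT hV hB hg rfl
    (div_pos hb0 hN0)
    (fun t w h0 hws hpos => le_roundUp_of_pos hb0.le hN2 (hO.le t w h0 hws) hpos)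
    (fun t₀ t t' h0 ht ht' htT htT' => order_shiftBound hs subset_rfl hb1 hF
      (hsh t₀ t t' h0 ht ht' htT htT')) hzero hord hlow
  refine ⟨E, _, 0, hE0, ?_, ?_, by simp, hreg⟩
  · have h1 : 1 ≤ x ^ 3 := one_le_pow₀ hx.le
    calc E ≤ (a ^ 2 + 3) * (1 + Real.log T) ^ 3 * 1 := by linarith
      _ ≤ (a ^ 2 + 3) * (1 + Real.log T) ^ 3 * (b / q₀ * x ^ 3) := by
          gcongr
          exact one_le_mul_of_one_le_of_one_le ((one_le_div hq₀).2 hb) h1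
      _ = _ := by ring
  · have h2 := small_orders_rate (B := B) hq₀ hb hx.le (by linarith) hNx hℓ1 hg₁0
    calc E * _ ≤ (a ^ 2 + 3) * (1 + Real.log T) ^ 3 *
            (G₀ * (1 + Real.log T) ^ 3 * (b ^ 2 * x ^ 9)) :=
          mul_le_mul hE h2 (by positivity) (by positivity)
      _ = _ := by ring

end SmallOrders

/-! ### Normal demand: regret -/

section Normal

variable {s c q₀ : ℝ} {v : ℝ≥0}

theorem perceived_gaussian {b a q : ℝ} (h : q < b) :
    perceived b (gaussianReal a v) q = cdf (gaussianReal 0 v) (q - a) := by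
  rw [perceived, if_pos h, cdf_gaussian_eq]

theorem abs_cdf_gaussian_mean_sub_le (hv : v ≠ 0) (a a' q : ℝ) :
    |cdf (gaussianReal a' v) q - cdf (gaussianReal a v) q| ≤
      gaussianPDFReal 0 v 0 * |a' - a| := by
  rw [cdf_gaussian_eq, cdf_gaussian_eq a]
  refine (abs_cdf_gaussian_sub_le hv _ _).trans (le_of_eq ?_)
  rw [sub_sub_sub_cancel_left, abs_sub_comm]

theorem order_gaussian_zero (hs : 0 < s) {b : ℝ} (hb : 0 ≤ b) (hv : v ≠ 0) (a : ℝ) :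
    b ≤ order (Set.Icc 0 b) (perceived b (gaussianReal a v)) s 0 := by
  refine le_order hs (Set.right_mem_Icc.2 hb) (perceived_self b _) le_rfl fun q _ hqb => ?_
  rw [perceived_gaussian hqb, zero_div, sub_zero]
  exact cdf_gaussian_lt_one hv _

theorem order_gaussian_le (hs : 0 < s) {b a m w h : ℝ} (hb : 0 ≤ b) (hw : 0 ≤ w) (hh : 0 ≤ h)
    (hm : 1 - w / s ≤ cdf (gaussianReal 0 v) (h - m)) :
    order (Set.Icc 0 b) (perceived b (gaussianReal a v)) s w ≤ |a - m| + h := by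
  rcases lt_or_ge (|a - m| + h) b with hlt | hge
  · refine order_le_of_mem (b := b) subset_rfl ⟨by positivity, hlt.le⟩ ?_
    rw [perceived_gaussian hlt]
    refine hm.trans (monotone_cdf _ ?_)
    linarith [le_abs_self (a - m)]
  · exact (order_le hs subset_rfl (Set.right_mem_Icc.2 hb) (perceived_self b _) hw).trans hge

/-- Growth of the distribution function to the right of `0`, up to the critical ratio of the price
`c / 2`. -/
theorem exists_le_cdf_gaussian (hs : 0 < s) (hc : 0 < c) (hv : v ≠ 0) {m : ℝ}
    (hm : 1 - c / s ≤ cdf (gaussianReal 0 v) (-m)) :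
    ∃ g : ℝ, 0 ≤ g ∧ ∀ w, c / 2 ≤ w → w ≤ c →
      1 - w / s ≤ cdf (gaussianReal 0 v) (g * (c - w) - m) := by
  have hlim : ∀ᶠ x in Filter.atTop, 1 - c / 2 / s < cdf (gaussianReal 0 v) x := by
    refine (tendsto_cdf_atTop (gaussianReal 0 v)).eventually (lt_mem_nhds ?_)
    have : 0 < c / 2 / s := by positivity
    linarith
  -- Beyond `x₀` the critical ratio of every price at least `c / 2` is exceeded. Between `-m` and
  -- `x₀` the density is at least `p`, so the distribution function gains `(c - w) / s` within `(c -
  -- w) / (s p)`.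
  obtain ⟨x₀, hx₀⟩ := (hlim.and (Filter.eventually_ge_atTop (-m))).exists
  obtain ⟨p, hp, hpc⟩ := exists_le_cdf_gaussian_sub hv (max |m| |x₀|)
  refine ⟨1 / (s * p), by positivity, fun w hw hwc => ?_⟩
  set h := 1 / (s * p) * (c - w) with hh
  have hh0 : 0 ≤ h := mul_nonneg (by positivity) (by linarith)
  rcases le_total (h - m) x₀ with hle | hle
  · have h1 := hpc (-m) (h - m)
      (neg_le_neg ((le_abs_self m).trans (le_max_left _ _))) (by linarith)
      (hle.trans ((le_abs_self x₀).trans (le_max_right _ _)))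
    have h2 : p * (h - m - -m) = c / s - w / s := by
      rw [hh]; field_simp; ring
    linarith
  · have h1 := monotone_cdf (gaussianReal 0 v) hle
    have h2 : c / 2 / s ≤ w / s := by gcongr
    linarith [hx₀.1]

/-- Regret of LUNAC for a retailer with normal distributions, if some price above the unit cost is
profitable. -/
theorem lunac_regret_gaussian_le_of_lt (hc : 0 ≤ c) (hcs : c < s) (hq₀ : 0 < q₀) (hv : v ≠ 0)
    {m κ B : ℝ} (hκ : 0 ≤ κ) (hB : 0 ≤ B) (hm : cdf (gaussianReal 0 v) (-m) < 1 - c / s) :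
    ∃ C : ℝ, 0 ≤ C ∧ ∀ (b : ℝ) (T : ℕ), q₀ ≤ b → 1 ≤ T →
      ∀ sel : (Fin (gridSize b T) → ℝ) → Fin (gridSize b T), IsArgmaxRule sel →
      ∀ θ : ℕ → ℝ, (∀ i, 1 ≤ i → i + 1 < T →
          |θ (i + 1) - θ i| ≤ κ * (1 + Real.log T) / ((i : ℝ) + 1)) →
        (∀ t, 1 ≤ t → t < T → |θ t - m| ≤ B * √((1 + Real.log T) / t)) →
        (lunac c s b (levelCount b T) sel).regret c s
            (quantileOrder s b fun t => perceived b (gaussianReal (θ t) v)) T ≤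
          C * ((1 + Real.log T) ^ 3) ^ 3 * (b ^ (5 / 4 : ℝ) * (T : ℝ) ^ (3 / 4 : ℝ)) := by
  have hs : 0 < s := by linarith
  set p := gaussianPDFReal 0 v 0 with hp
  have hp0 : 0 < p := gaussianPDFReal_pos _ _ _ hv
  set g := 1 - c / s - cdf (gaussianReal 0 v) (-m) with hg
  have hg0 : 0 < g := by linarith
  have hg1 : g ≤ 1 - c / s := by linarith [cdf_nonneg (gaussianReal 0 v) (-m)]
  -- The gap `g` at the unit cost is split: a quarter pays for the markup of `w₁`, a quarter for the
  -- order `q₁`, and a quarter for the error of the fitted mean after time `τ ℓ`.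
  set w₁ := c + s * (g / 4) with hw₁
  have hsg : 0 < s * (g / 4) := by positivity
  have hw₁s : w₁ ≤ s := by
    have : s * g ≤ s * (1 - c / s) := mul_le_mul_of_nonneg_left hg1 hs.le
    have h2 : s * (1 - c / s) = s - c := by field_simp
    linarith
  set q₁ := min q₀ (g / (4 * p)) with hq₁
  set τ := max 1 ((4 * p * B / g) ^ 2) with hτ
  have hτ1 : 1 ≤ τ := le_max_left _ _
  obtain ⟨C, hC0, hC⟩ := lunac_regret_le_of_profitable (V₀ := 1 + p * κ) (w₁ := w₁) (q₁ := q₁)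
    (τ := τ) hc hcs hq₀ (by positivity) (by linarith) hw₁s (lt_min hq₀ (by positivity))
    (by linarith)
  refine ⟨C, hC0, fun b T hb hT sel hsel θ hstep hdev => ?_⟩
  have hb0 : 0 < b := by linarith
  have hT1 : (1 : ℝ) ≤ T := by exact_mod_cast hT
  set ℓ := 1 + Real.log T with hℓ
  have hℓ1 : 1 ≤ ℓ := by linarith [Real.log_nonneg hT1]
  have hX : 1 ≤ (1 + p * κ) * ℓ := by nlinarith [mul_nonneg hp0.le hκ]
  have hX0 : 0 ≤ (1 + p * κ) * ℓ := by linarith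
  refine hC b T (ℓ ^ 3) hb hT (le_self_pow₀ hℓ1 (by norm_num)) sel _
    (fun t => (1 + p * κ) * ℓ * harm t) hsel (fun t => perceived_self b _)
    (fun m n hmn => mul_le_mul_of_nonneg_left (harm_mono hmn) hX0) (by simp [harm]) ?_ ?_ ?_ ?_
  · have h1 := mul_le_mul_of_nonneg_left (harm_le T) hX0
    have h2 : ℓ ^ 2 ≤ ℓ ^ 3 := pow_le_pow_right₀ hℓ1 (by norm_num)
    calc (1 + p * κ) * ℓ * harm T ≤ (1 + p * κ) * ℓ ^ 2 := h1.trans (le_of_eq (by ring))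
      _ ≤ _ := by gcongr
  · refine abs_perceived_sub_le_harm hX fun i hi hiT q _ => ?_
    refine (abs_cdf_gaussian_mean_sub_le hv _ _ _).trans ?_
    calc p * |θ (i + 1) - θ i| ≤ p * (κ * ℓ / ((i : ℝ) + 1)) :=
          mul_le_mul_of_nonneg_left (hstep i hi hiT) hp0.le
      _ = p * κ * ℓ / ((i : ℝ) + 1) := by ring
      _ ≤ _ := by gcongr; linarith
  · intro t t' w _ _ _ hw _
    exact (order_le hs subset_rfl (Set.right_mem_Icc.2 hb0.le) (perceived_self b _) hw).trans
      (order_gaussian_zero hs hb0.le hv _)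
  · intro t ht htT
    have ht1 : τ * ℓ ≤ t := le_trans (by gcongr; exact le_self_pow₀ hℓ1 (by norm_num)) ht
    have ht0 : (1 : ℝ) ≤ t := by nlinarith
    have ht0' : 1 ≤ t := by exact_mod_cast ht0
    have hdt : |θ t - m| ≤ g / (4 * p) := by
      refine (hdev t ht0' htT).trans ?_
      rcases hB.eq_or_lt with h0 | h0
      · rw [← h0, zero_mul]; positivity
      · have h1 : √(ℓ / t) ≤ g / (4 * p * B) := by
          refine Real.sqrt_le_iff.2 ⟨by positivity, ?_⟩
          have h2 : (4 * p * B / g) ^ 2 * ℓ ≤ t :=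
            le_trans (mul_le_mul_of_nonneg_right (le_max_right _ _) (by linarith)) ht1
          rw [div_pow, div_le_div_iff₀ (by linarith) (by positivity)]
          rw [div_pow, div_mul_eq_mul_div, div_le_iff₀ (by positivity)] at h2
          linarith
        calc B * √(ℓ / t) ≤ B * (g / (4 * p * B)) := by gcongr
          _ = _ := by field_simp
    refine le_order hs (Set.right_mem_Icc.2 hb0.le) (perceived_self b _) (by linarith)
      fun q hq hqq => ?_
    have hqb : q < b := hqq.trans_le ((min_le_left _ _).trans hb)
    have hqg : q < g / (4 * p) := hqq.trans_le (min_le_right _ _)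
    rw [perceived_gaussian hqb]
    have h1 : cdf (gaussianReal 0 v) (q - θ t) ≤
        cdf (gaussianReal 0 v) (-m + (q + |θ t - m|)) :=
      monotone_cdf _ (by linarith [neg_abs_le (θ t - m)])
    have hq0 : 0 ≤ q + |θ t - m| := add_nonneg hq.1 (abs_nonneg _)
    have h2 := cdf_gaussian_sub_le hv (show -m ≤ -m + (q + |θ t - m|) by linarith)
    have h3 : p * (q + |θ t - m|) ≤ p * (g / (4 * p) + g / (4 * p)) :=
      mul_le_mul_of_nonneg_left (by linarith) hp0.le
    have h4 : p * (g / (4 * p) + g / (4 * p)) = g / 2 := by field_simp; ring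
    have h5 : w₁ / s = c / s + g / 4 := by rw [hw₁]; field_simp
    rw [add_sub_cancel_left] at h2
    linarith

/-- Regret of LUNAC for a retailer with normal distributions, if no price above the unit cost is
profitable in the limit. -/
theorem lunac_regret_gaussian_le_of_ge (hc : 0 ≤ c) (hcs : c < s) (hq₀ : 0 < q₀) (hv : v ≠ 0)
    {m κ B : ℝ} (hκ : 0 ≤ κ) (hB : 0 ≤ B) (hm : 1 - c / s ≤ cdf (gaussianReal 0 v) (-m)) :
    ∃ C : ℝ, 0 ≤ C ∧ ∀ (b : ℝ) (T : ℕ), q₀ ≤ b → 1 ≤ T →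
      ∀ sel : (Fin (gridSize b T) → ℝ) → Fin (gridSize b T), IsArgmaxRule sel →
      ∀ θ : ℕ → ℝ, (∀ i, 1 ≤ i → i + 1 < T →
          |θ (i + 1) - θ i| ≤ κ * (1 + Real.log T) / ((i : ℝ) + 1)) →
        (∀ t, 1 ≤ t → t < T → |θ t - m| ≤ B * √((1 + Real.log T) / t)) →
        (lunac c s b (levelCount b T) sel).regret c s
            (quantileOrder s b fun t => perceived b (gaussianReal (θ t) v)) T ≤
          C * ((1 + Real.log T) ^ 3) ^ 3 * (b ^ (5 / 4 : ℝ) * (T : ℝ) ^ (3 / 4 : ℝ)) := by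
  have hs : 0 < s := by linarith
  -- With zero unit cost the critical ratio would be `1`, which a normal distribution function never
  -- attains.
  have hc0 : 0 < c := by
    have h1 := cdf_gaussian_lt_one hv (-m)
    have h2 : 0 < c / s := by linarith
    by_contra hcon
    exact absurd h2 (not_lt.2 (div_nonpos_of_nonpos_of_nonneg (not_lt.1 hcon) hs.le))
  set p := gaussianPDFReal 0 v 0 with hp
  have hp0 : 0 < p := gaussianPDFReal_pos _ _ _ hv
  obtain ⟨g, hg0, hg⟩ := exists_le_cdf_gaussian hs hc0 hv hm
  obtain ⟨C₁, hC₁0, hC₁⟩ := lunac_regret_le_of_order_ge (V₀ := 1 + p * κ) (η := 1) hc hcs hq₀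
    (by positivity) one_pos
  obtain ⟨C₂, hC₂0, hC₂⟩ := lunac_regret_le_of_small_orders (V := p * (2 * B)) (B := B) (g := g)
    hc0 hcs hq₀ (by positivity) hB hg0
  refine ⟨max C₁ C₂, le_max_of_le_left hC₁0, fun b T hb hT sel hsel θ hstep hdev => ?_⟩
  have hb0 : 0 < b := by linarith
  have hT1 : (1 : ℝ) ≤ T := by exact_mod_cast hT
  set ℓ := 1 + Real.log T with hℓ
  have hℓ1 : 1 ≤ ℓ := by linarith [Real.log_nonneg hT1]
  have hFb : ∀ t, perceived b (gaussianReal (θ t) v) b = 1 := fun t => perceived_self b _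
  have hzero : ∀ t t' w, 1 ≤ t → t ≤ t' → t' < T → 0 ≤ w → w ≤ s →
      quantileOrder s b (fun t => perceived b (gaussianReal (θ t) v)) t w ≤
        quantileOrder s b (fun t => perceived b (gaussianReal (θ t) v)) t' 0 :=
    fun t t' w _ _ _ hw _ =>
      (order_le hs subset_rfl (Set.right_mem_Icc.2 hb0.le) (hFb t) hw).trans
        (order_gaussian_zero hs hb0.le hv _)
  -- Fine levels preserve the smallness of the orders under rounding. If the spacing exceeds `1`, so
  -- does every positive rounded order, and the bound for orders away from `0` applies.
  rcases le_or_gt (b / ((levelCount b T : ℕ) - 1 : ℝ)) 1 with hz | hz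
  · refine (hC₂ b T hb hT sel _ hsel hFb hz ?_ hzero ?_ ?_).trans ?_
    · intro t t' h1 h2 h3 q _
      refine abs_perceived_sub_le _ _ _ _ (by positivity) ?_
      refine (abs_cdf_gaussian_mean_sub_le hv _ _ _).trans ?_
      have h4 := hdev t h1 (h2.trans_lt h3)
      have h5 := (hdev t' (h1.trans h2) h3).trans
        (mul_le_mul_of_nonneg_left (sqrt_div_le_sqrt_div (by linarith) h1 h2) hB)
      have h6 : |θ t' - θ t| ≤ 2 * B * √(ℓ / t) := by
        have := abs_sub_le (θ t') m (θ t)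
        rw [abs_sub_comm m] at this
        linarith
      calc p * |θ t' - θ t| ≤ p * (2 * B * √(ℓ / t)) := by gcongr
        _ = _ := by ring
    · intro t w h1 h2 hw _
      have h3 := order_gaussian_le (a := θ t) hs hb0.le (hc.trans hw) le_rfl (m := m) (v := v) (by
        rw [zero_sub]
        have : c / s ≤ w / s := by gcongr
        linarith)
      rw [add_zero] at h3
      exact h3.trans (hdev t h1 h2)
    · intro t w h1 h2 hw hwc
      have h3 := order_gaussian_le (a := θ t) hs hb0.le (by linarith)
        (mul_nonneg hg0 (by linarith)) (hg w hw hwc)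
      exact h3.trans (by linarith [hdev t h1 h2])
    · gcongr
      exact le_max_right _ _
  · have hX : 1 ≤ (1 + p * κ) * ℓ := by nlinarith [mul_nonneg hp0.le hκ]
    have hX0 : 0 ≤ (1 + p * κ) * ℓ := by linarith
    refine (hC₁ b T (ℓ ^ 3) hb hT (le_self_pow₀ hℓ1 (by norm_num)) sel _
      (fun t => (1 + p * κ) * ℓ * harm t) hsel hFb
      (fun m n hmn => mul_le_mul_of_nonneg_left (harm_mono hmn) hX0) (by simp [harm]) ?_ ?_ hzero
      ?_).trans ?_
    · have h1 := mul_le_mul_of_nonneg_left (harm_le T) hX0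
      have h2 : ℓ ^ 2 ≤ ℓ ^ 3 := pow_le_pow_right₀ hℓ1 (by norm_num)
      calc (1 + p * κ) * ℓ * harm T ≤ (1 + p * κ) * ℓ ^ 2 := h1.trans (le_of_eq (by ring))
        _ ≤ _ := by gcongr
    · refine abs_perceived_sub_le_harm hX fun i hi hiT q _ => ?_
      refine (abs_cdf_gaussian_mean_sub_le hv _ _ _).trans ?_
      calc p * |θ (i + 1) - θ i| ≤ p * (κ * ℓ / ((i : ℝ) + 1)) :=
            mul_le_mul_of_nonneg_left (hstep i hi hiT) hp0.le
        _ = p * κ * ℓ / ((i : ℝ) + 1) := by ring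
        _ ≤ _ := by gcongr; linarith
    · intro hTb t w hw _
      have hN := two_le_levelCount hb0 hTb
      rcases (roundUp_nonneg (N := levelCount b T) hb0.le (by omega) (quantileOrder s b
        (fun t => perceived b (gaussianReal (θ t) v)) t w)).eq_or_lt with h | h
      · exact Or.inl h.symm
      · exact Or.inr (hz.le.trans (le_roundUp_of_pos hb0.le hN
          (order_le hs subset_rfl (Set.right_mem_Icc.2 hb0.le) (hFb t) hw) h))
    · gcongr
      exact le_max_left _ _

/-- Regret of LUNAC against the maximum likelihood estimator for normal demand. -/
theorem lunacRegret_gaussian_le (hc : 0 ≤ c) (hcs : c < s) (hq₀ : 0 < q₀) (hv : 0 < v)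
    (m : ℝ) {κ B : ℝ} (hκ : 0 ≤ κ) (hB : 0 ≤ B) :
    ∃ C : ℝ, 0 ≤ C ∧ ∀ (b : ℝ) (T : ℕ), q₀ ≤ b → 1 ≤ T →
      ∀ sel : (Fin (gridSize b T) → ℝ) → Fin (gridSize b T), IsArgmaxRule sel →
      ∀ est : (t : ℕ) → (Fin t → ℝ) → ℝ,
        IsMLE (fun (a x : ℝ) => gaussianPDFReal a v x) Set.univ est →
      ∀ ξ : ℕ → ℝ, (∀ i, i < T → |ξ i - m| ≤ κ * (1 + Real.log T)) →
        (∀ t, t < T → |∑ i ∈ Finset.range t, (ξ i - m)| ≤ B * √((1 + Real.log T) * t)) →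
        lunacRegret c s b T sel (fun a : ℝ => gaussianReal a v) est ξ ≤
          C * (1 + Real.log T) ^ 9 * (b ^ (5 / 4 : ℝ) * (T : ℝ) ^ (3 / 4 : ℝ)) := by
  have hv' : v ≠ 0 := hv.ne'
  have hmain : ∃ C : ℝ, 0 ≤ C ∧ ∀ (b : ℝ) (T : ℕ), q₀ ≤ b → 1 ≤ T →
      ∀ sel : (Fin (gridSize b T) → ℝ) → Fin (gridSize b T), IsArgmaxRule sel →
      ∀ θ : ℕ → ℝ, (∀ i, 1 ≤ i → i + 1 < T →
          |θ (i + 1) - θ i| ≤ 2 * κ * (1 + Real.log T) / ((i : ℝ) + 1)) →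
        (∀ t, 1 ≤ t → t < T → |θ t - m| ≤ B * √((1 + Real.log T) / t)) →
        (lunac c s b (levelCount b T) sel).regret c s
            (quantileOrder s b fun t => perceived b (gaussianReal (θ t) v)) T ≤
          C * ((1 + Real.log T) ^ 3) ^ 3 * (b ^ (5 / 4 : ℝ) * (T : ℝ) ^ (3 / 4 : ℝ)) := by
    -- The value at `0` of the true distribution function decides whether a price above the unit
    -- cost is profitable in the limit.
    rcases lt_or_ge (cdf (gaussianReal 0 v) (-m)) (1 - c / s) with h | h
    · exact lunac_regret_gaussian_le_of_lt hc hcs hq₀ hv' (by positivity) hB h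
    · exact lunac_regret_gaussian_le_of_ge hc hcs hq₀ hv' (by positivity) hB h
  obtain ⟨C, hC0, hC⟩ := hmain
  refine ⟨C, hC0, fun b T hb hT sel hsel est hest ξ hξ hsum => ?_⟩
  have hT1 : (1 : ℝ) ≤ T := by exact_mod_cast hT
  set ℓ := 1 + Real.log T with hℓ
  have hℓ1 : 1 ≤ ℓ := by linarith [Real.log_nonneg hT1]
  have hθ : ∀ t, 1 ≤ t → est t (fun i => ξ i) = (∑ i ∈ Finset.range t, ξ i) / t := fun t ht =>
    hest.gaussian hv ξ ht
  have h := hC b T hb hT sel hsel (fun t => est t fun i => ξ i) (fun i hi hiT => ?_)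
    fun t ht htT => ?_
  · rw [← pow_mul] at h
    exact h
  · have hi0 : (0 : ℝ) < i := by exact_mod_cast hi
    rw [hθ i hi, hθ _ (by omega), Finset.sum_range_succ, mean_succ_sub _ _ hi, abs_div,
      abs_of_pos (by positivity : (0 : ℝ) < (i : ℝ) + 1)]
    have h1 := sum_div_mem_Icc (f := ξ) (l := m - κ * ℓ) (u := m + κ * ℓ) hi fun j hj => by
      have := abs_le.1 (hξ j (by omega))
      constructor <;> linarith
    have h2 := abs_le.1 (hξ i (by omega))
    gcongr
    rw [abs_le]
    constructor <;> linarith [h1.1, h1.2]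
  · have ht0 : (0 : ℝ) < t := by exact_mod_cast ht
    have h1 : (∑ i ∈ Finset.range t, ξ i) / t - m = (∑ i ∈ Finset.range t, (ξ i - m)) / t := by
      rw [Finset.sum_sub_distrib, Finset.sum_const, Finset.card_range, nsmul_eq_mul]
      field_simp
    rw [hθ t ht, h1, abs_div, abs_of_pos ht0, div_le_iff₀ ht0]
    refine (hsum t htT).trans (le_of_eq ?_)
    have h2 : √(ℓ * t) = √(ℓ / t) * t := by
      have h3 : ℓ * t = ℓ / t * (t * t) := by field_simp
      rw [h3, Real.sqrt_mul (by positivity), Real.sqrt_mul_self ht0.le]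
    rw [h2, mul_assoc]

/-- The constant `3` gives the exponent `-9 ℓ / 2`; the surplus over `-2 ℓ` absorbs the factor `2`
of the two-sided bound. -/
theorem measure_lt_abs_sum_le_exp {Ω : Type*} [MeasurableSpace Ω] {P : Measure Ω}
    [IsProbabilityMeasure P] (hv : 0 < v) {X : ℕ → Ω → ℝ} (hind : iIndepFun X P)
    (h : ∀ i, HasSubgaussianMGF (X i) v P) (n : ℕ) {ℓ : ℝ} (hℓ : 1 ≤ ℓ) :
    P {ω | 3 * √(v : ℝ) * √(ℓ * n) < |∑ i ∈ Finset.range n, X i ω|} ≤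
      ENNReal.ofReal (Real.exp (-(2 * ℓ))) := by
  have hv' : (0 : ℝ) < v := by exact_mod_cast hv
  rcases Nat.eq_zero_or_pos n with rfl | hn
  · simp
  · have hn' : (0 : ℝ) < n := by exact_mod_cast hn
    refine (measure_lt_abs_sum_le hind h n (by positivity)).trans ?_
    have h1 : -(3 * √(v : ℝ) * √(ℓ * n)) ^ 2 / (2 * n * v) = -(9 / 2 * ℓ) := by
      rw [mul_pow, mul_pow, Real.sq_sqrt hv'.le, Real.sq_sqrt (by positivity)]
      field_simp
      norm_num
    rw [h1, ← ENNReal.ofReal_ofNat, ← ENNReal.ofReal_mul (by norm_num)]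
    refine ENNReal.ofReal_le_ofReal ?_
    have h2 : (2 : ℝ) ≤ Real.exp 1 := by
      have := Real.add_one_le_exp (1 : ℝ)
      linarith
    calc 2 * Real.exp (-(9 / 2 * ℓ)) ≤ Real.exp 1 * Real.exp (-(9 / 2 * ℓ)) := by gcongr
      _ = Real.exp (1 + -(9 / 2 * ℓ)) := (Real.exp_add _ _).symm
      _ ≤ _ := Real.exp_le_exp.2 (by linarith)

/-- Regret of LUNAC for normal demand, with high probability. -/
theorem lunac_normal (hc : 0 ≤ c) (hcs : c < s) (m : ℝ) (hv : 0 < v) (hq₀ : 0 < q₀) :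
    ∃ (C : ℝ) (k : ℕ),
      ∀ (b : ℝ) (T : ℕ), q₀ ≤ b → 1 ≤ T →
      ∀ sel : (Fin (gridSize b T) → ℝ) → Fin (gridSize b T), IsArgmaxRule sel →
      ∀ est : (t : ℕ) → (Fin t → ℝ) → ℝ,
        IsMLE (fun (a x : ℝ) => gaussianPDFReal a v x) Set.univ est →
      ∀ (Ω : Type*) [MeasurableSpace Ω] (P : Measure Ω) [IsProbabilityMeasure P] (ξ : ℕ → Ω → ℝ),
        iIndepFun ξ P → (∀ i, HasLaw (ξ i) (gaussianReal m v) P) →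
        P {ω | C * (1 + Real.log T) ^ k *
              (b ^ (5 / 4 : ℝ) * (T : ℝ) ^ (3 / 4 : ℝ) + b ^ (17 / 12 : ℝ) * (T : ℝ) ^ (7 / 12 : ℝ))
            < lunacRegret c s b T sel (fun a : ℝ => gaussianReal a v) est
                (fun i => ξ i ω)} ≤ (T : ℝ≥0∞)⁻¹ := by
  have hvR : (0 : ℝ) < v := by exact_mod_cast hv
  set B := 3 * √(v : ℝ) with hB
  have hB0 : 0 ≤ B := by positivity
  obtain ⟨C, hC0, hC⟩ := lunacRegret_gaussian_le (κ := B) (B := B) hc hcs hq₀ hv m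
    hB0 hB0
  refine ⟨C, 9, fun b T hb hT sel hsel est hest Ω _ P _ ξ hind hlaw => ?_⟩
  have hT1 : (1 : ℝ) ≤ T := by exact_mod_cast hT
  have hb0 : 0 < b := by linarith
  set ℓ := 1 + Real.log T with hℓ
  have hℓ1 : 1 ≤ ℓ := by linarith [Real.log_nonneg hT1]
  have hsqrt : √ℓ ≤ ℓ := Real.sqrt_le_iff.2 ⟨by linarith, by nlinarith⟩
  set X : ℕ → Ω → ℝ := fun i ω => ξ i ω - m with hX
  have hsub : ∀ i, HasSubgaussianMGF (X i) v P := fun i => by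
    refine hasSubgaussianMGF_gaussian ?_
    have := gaussianReal_sub_const (hlaw i) m
    rwa [sub_self] at this
  have hindX : iIndepFun X P := hind.comp (fun _ x => x - m) fun _ => by fun_prop
  have hp₁ : P {ω | ∃ i, i < T ∧ ω ∈ {ω | B * √ℓ < |X i ω|}} ≤ (3 * T : ℝ≥0∞)⁻¹ := by
    refine measure_exists_lt_le hT fun i _ => ?_
    -- A single deviation is a sum of length one of the shifted sequence.
    have h := measure_lt_abs_sum_le_exp hv (hindX.precomp (g := fun j => i + j)
      (add_right_injective i)) (fun j => hsub (i + j)) 1 hℓ1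
    simpa using h
  have hp₂ : P {ω | ∃ t, t < T ∧ ω ∈ {ω | B * √(ℓ * t) < |∑ i ∈ Finset.range t, X i ω|}} ≤
      (3 * T : ℝ≥0∞)⁻¹ :=
    measure_exists_lt_le hT fun t _ => measure_lt_abs_sum_le_exp hv hindX hsub t hℓ1
  set B₁ := {ω | ∃ i, i < T ∧ ω ∈ {ω | B * √ℓ < |X i ω|}}
  set B₂ := {ω | ∃ t, t < T ∧ ω ∈ {ω | B * √(ℓ * t) < |∑ i ∈ Finset.range t, X i ω|}}
  calc P _ ≤ P (B₁ ∪ B₂) := by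
        refine measure_mono fun ω hω => ?_
        by_contra hcon
        obtain ⟨hn₁, hn₂⟩ := not_or.1 hcon
        simp only [B₁, B₂, Set.mem_ofPred_eq, not_exists, not_and, not_lt] at hn₁ hn₂
        have h1 := hC b T hb hT sel hsel est hest (fun i => ξ i ω) (fun i hi =>
          (hn₁ i hi).trans (mul_le_mul_of_nonneg_left hsqrt hB0)) hn₂
        have h2 : (0 : ℝ) ≤ b ^ (17 / 12 : ℝ) * (T : ℝ) ^ (7 / 12 : ℝ) := by positivity
        exact absurd (h1.trans (rate_le_rate_add hC0 le_rfl (by linarith) (by positivity) h2))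
          (not_le.2 hω)
    _ ≤ P B₁ + P B₂ := measure_union_le _ _
    _ ≤ (3 * T : ℝ≥0∞)⁻¹ + (3 * T : ℝ≥0∞)⁻¹ := add_le_add hp₁ hp₂
    _ ≤ (T : ℝ≥0∞)⁻¹ := by
        rw [← inv_three_mul_add T]
        exact le_self_add

end Normal

end Wholesale

end

/-! ### The four demand models together -/

open Wholesale in
theorem theorem6 (s c : ℝ) (hc : 0 ≤ c) (hcs : c < s) :
    -- Poisson demand with mean `lam`
    (∀ lam : ℝ≥0, 0 < lam → ∀ q₀ : ℝ, 0 < q₀ → ∃ (C : ℝ) (k : ℕ),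
      ∀ (b : ℝ) (T : ℕ), q₀ ≤ b → 1 ≤ T →
      ∀ sel : (Fin (gridSize b T) → ℝ) → Fin (gridSize b T), IsArgmaxRule sel →
      ∀ est : (t : ℕ) → (Fin t → ℕ) → ℝ≥0,
        IsMLE (fun (l : ℝ≥0) (n : ℕ) => (poissonMeasure l).real {n}) Set.univ est →
      ∀ (Ω : Type*) [MeasurableSpace Ω] (P : Measure Ω) [IsProbabilityMeasure P] (ξ : ℕ → Ω → ℕ),
        iIndepFun ξ P → (∀ i, HasLaw (ξ i) (poissonMeasure lam) P) →
        P {ω | C * (1 + Real.log T) ^ k *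
              (b ^ (5 / 4 : ℝ) * (T : ℝ) ^ (3 / 4 : ℝ) + b ^ (17 / 12 : ℝ) * (T : ℝ) ^ (7 / 12 : ℝ))
            < lunacRegret c s b T sel
                (fun l : ℝ≥0 => (poissonMeasure l).map (fun n : ℕ => (n : ℝ))) est
                (fun i => ξ i ω)} ≤ (T : ℝ≥0∞)⁻¹) ∧
    -- categorical demand on `M` points; `b` is the largest point
    (∀ η : ℝ, 0 < η → ∃ (C : ℝ) (k : ℕ),
      ∀ (M : ℕ) (y : Fin M → ℝ) (b : ℝ) (T : ℕ), StrictMono y → (∀ m, 0 ≤ y m) →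
        (∀ m, 0 < y m → η ≤ y m) → IsGreatest (Set.range y) b → 0 < b → 1 ≤ T →
      ∀ sel : (Fin (gridSize b T) → ℝ) → Fin (gridSize b T), IsArgmaxRule sel →
      ∀ est : (t : ℕ) → (Fin t → Fin M) → PMF (Fin M),
        IsMLE (fun (p : PMF (Fin M)) (m : Fin M) => (p m).toReal) Set.univ est →
      ∀ (p₀ : PMF (Fin M)) (Ω : Type*) [MeasurableSpace Ω] (P : Measure Ω) [IsProbabilityMeasure P]
        (ξ : ℕ → Ω → Fin M), iIndepFun ξ P → (∀ i, HasLaw (ξ i) p₀.toMeasure P) →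
        (∀ᵐ ω ∂P, lunaRegret c s b y T sel (fun p : PMF (Fin M) => p.toMeasure.map y) est
              (fun i => ξ i ω)
            ≤ C * (1 + Real.log T) ^ k *
                (b ^ (4 / 3 : ℝ) * (M : ℝ) ^ (1 / 3 : ℝ) * (T : ℝ) ^ (2 / 3 : ℝ))) ∧
        Integrable (fun ω => lunaRegret c s b y T sel (fun p : PMF (Fin M) => p.toMeasure.map y) est
              (fun i => ξ i ω)) P ∧
        ∫ ω, lunaRegret c s b y T sel (fun p : PMF (Fin M) => p.toMeasure.map y) est
              (fun i => ξ i ω) ∂P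
            ≤ C * (1 + Real.log T) ^ k *
                (b ^ (4 / 3 : ℝ) * (M : ℝ) ^ (1 / 3 : ℝ) * (T : ℝ) ^ (2 / 3 : ℝ))) ∧
    -- exponential demand with rate `lam`
    (∀ lam : ℝ, 0 < lam → ∀ q₀ : ℝ, 0 < q₀ → ∃ (C : ℝ) (k : ℕ),
      ∀ (b : ℝ) (T : ℕ), q₀ ≤ b → 1 ≤ T →
      ∀ sel : (Fin (gridSize b T) → ℝ) → Fin (gridSize b T), IsArgmaxRule sel →
      ∀ est : (t : ℕ) → (Fin t → ℝ) → Set.Ioi (0 : ℝ),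
        IsMLE (fun (l : Set.Ioi (0 : ℝ)) (x : ℝ) => exponentialPDFReal l x) (Set.Ioi 0) est →
      ∀ (Ω : Type*) [MeasurableSpace Ω] (P : Measure Ω) [IsProbabilityMeasure P] (ξ : ℕ → Ω → ℝ),
        iIndepFun ξ P → (∀ i, HasLaw (ξ i) (expMeasure lam) P) →
        P {ω | C * (1 + Real.log T) ^ k *
              (b ^ (5 / 4 : ℝ) * (T : ℝ) ^ (3 / 4 : ℝ) + b ^ (17 / 12 : ℝ) * (T : ℝ) ^ (7 / 12 : ℝ))
            < lunacRegret c s b T sel (fun l : Set.Ioi (0 : ℝ) => expMeasure l) est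
                (fun i => ξ i ω)} ≤ (T : ℝ≥0∞)⁻¹) ∧
    -- normal demand with mean `m` and variance `v`; the variance is known to the retailer
    (∀ (m : ℝ) (v : ℝ≥0), 0 < v → ∀ q₀ : ℝ, 0 < q₀ → ∃ (C : ℝ) (k : ℕ),
      ∀ (b : ℝ) (T : ℕ), q₀ ≤ b → 1 ≤ T →
      ∀ sel : (Fin (gridSize b T) → ℝ) → Fin (gridSize b T), IsArgmaxRule sel →
      ∀ est : (t : ℕ) → (Fin t → ℝ) → ℝ,
        IsMLE (fun (a x : ℝ) => gaussianPDFReal a v x) Set.univ est →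
      ∀ (Ω : Type*) [MeasurableSpace Ω] (P : Measure Ω) [IsProbabilityMeasure P] (ξ : ℕ → Ω → ℝ),
        iIndepFun ξ P → (∀ i, HasLaw (ξ i) (gaussianReal m v) P) →
        P {ω | C * (1 + Real.log T) ^ k *
              (b ^ (5 / 4 : ℝ) * (T : ℝ) ^ (3 / 4 : ℝ) + b ^ (17 / 12 : ℝ) * (T : ℝ) ^ (7 / 12 : ℝ))
            < lunacRegret c s b T sel (fun a : ℝ => gaussianReal a v) est
                (fun i => ξ i ω)} ≤ (T : ℝ≥0∞)⁻¹) := by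
  refine ⟨fun lam _ q₀ hq₀ => ?_, fun η hη => ?_, fun lam hlam q₀ hq₀ =>
    lunac_exponential hc hcs hlam hq₀, fun m v hv q₀ hq₀ => lunac_normal hc hcs m hv hq₀⟩
  · obtain ⟨C, k, h⟩ := lunac_poisson hc hcs lam hq₀
    exact ⟨C, k, fun b T hb hT sel hsel est hest Ω _ P _ ξ _ hlaw =>
      h b T hb hT sel hsel est hest Ω P ξ hlaw⟩
  · obtain ⟨C, k, h⟩ := luna_categorical hc hcs hη
    exact ⟨C, k, fun M y b T _ hy0 hyη hyb hb hT sel hsel est hest p₀ Ω _ P _ ξ _ hlaw =>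
      h M y b T hy0 hyη hyb hb hT sel hsel est hest p₀ Ω P ξ hlaw⟩
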